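/- Each unit carries covariates $X\in\mathcal X$, a treatment $T\in\{0,1\}$, potential surrogates $S(0),S(1)\in\mathcal S$, potential outcomes $Y(0),Y(1)\in\mathbb R$ and a labelling indicator $R\in\{0,1\}$, where $\mathcal X,\mathcal S$ are standard Borel spaces (e.g. Borel subsets of Euclidean spaces). Put $S=S(T)$ and $Y=Y(T)$. A population $\mathbb P$ is given by the two conditional laws of $(X,T,S(0),S(1),Y(0),Y(1))$ given $R=1$ and given $R=0$ and by $\mathbb P(R=1)\in[0,1]$; the value $\mathbb P(R=1)=0$ is allowed. Conditional independence statements about $R$ are understood for the mixture of the two conditional laws in which $R=1$ has some probability in $(0,1)$ (which one is immaterial). Fix $\epsilon\in(0,1/2)$ and $C>0$, and consider the following conditions on $\mathbb P$: for $t=0,1$, (i) $(Y(t),S(t))\perp T\mid X$; (ii) $R\perp Y(t)\mid (X,T=t,S(t))$; (iii) $R\perp S(t)\mid T,X$; (iv) $R\perp T\mid X$; (v) $\epsilon\le e^*(X)\le 1-\epsilon$ almost surely, where $e^*(x)=\mathbb P(T=1\mid X=x)$; (vi) the law of $X$ has a density $\lambda^*=f^*(X)/f^*(X\mid R=1)$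 with respect to the law of $X$ given $R=1$, and $\lambda^*(X)\le C$ almost surely; (vii) $\mathbb E[Y(t)^2]<\infty$ and $\mathbb E[|Y|\mid R=1]<\infty$. Let $\mathbb P$ satisfy (i)-(vii). Suppose that only labelled data are observed, i.e. i.i.d. copies of $(X,T,S,Y)$ from its conditional law $Q$ given $R=1$, and that the unconditional law of $(X,T,S)$ is known; that is, let the model $\mathcal M$ consist of all populations that satisfy (i)-(vii) (with the same $\epsilon$, $C$) and have the same unconditional law of $(X,T,S)$ as $\mathbb P$. The parameter is the average treatment effect $\delta=\mathbb E[Y(1)]-\mathbb E[Y(0)]$. A smooth submodel with score $g\in L^2(Q)$ is a family $(\mathbb P_\theta)_{\theta\in\mathbb R}$ in $\mathcal M$ whose laws $Q_\theta$ of $(X,T,S,Y)$ given $R=1$ are dominated by a common $\sigma$-finite measure, satisfy $Q_0=Q$, and are differentiable in quadratic mean at $\theta=0$ with score $g$, and along which $\mathbb E_{\mathbb P_\theta}[Y(t)^2]$, $t=0,1$, is bounded. Let $\tilde\mu^*(t,x,s)=\mathbb E[Y\mid T=t,X=x,S=s,R=1]$ and $$\tilde\psi=\frac{T\lambda^*(X)}{e^*(X)}\bigl(Y-\tilde\mu^*(1,X,S)\bigr)-\frac{(1-T)\lambda^*(X)}{1-e^*(X)}\bigl(Y-\tilde\mu^*(0,X,S)\bigr).$$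 Then $\tilde\psi$ is the efficient influence function of $\delta$ at $\mathbb P$ in $\mathcal M$: it belongs to the tangent space (the closed linear span in $L^2(Q)$ of the scores of all smooth submodels), and along every smooth submodel with score $g$ the map $\theta\mapsto\delta(\mathbb P_\theta)$ is differentiable at $0$ with derivative $\mathbb E[\tilde\psi g\mid R=1]$. The efficiency lower bound, i.e. the supremum over all smooth submodels of the Cramér-Rao bounds $\bigl(\tfrac{d}{d\theta}\delta(\mathbb P_\theta)|_{\theta=0}\bigr)^2/\mathbb E[g^2\mid R=1]$ (with $0/0=0$), is $$\tilde V^*=\mathbb E[\tilde\psi^2\mid R=1].$$ -/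

import Mathlib

open MeasureTheory ProbabilityTheory Filter Topology
open scoped ENNReal NNReal

namespace SurrogateATE

noncomputable section

/-! ### Units, populations and observed data

Binary variables take values in `Bool`, with `true` for `1` and `false` for `0`.  The covariate space
`𝒳` and the surrogate space `𝒮` are standard Borel spaces, e.g. Borel subsets of Euclidean spaces. -/

/-- One unit without its label: `(X, T, (S(0), S(1)), (Y(0), Y(1)))`. -/
abbrev Unlabelled (𝒳 𝒮 : Type*) := 𝒳 × Bool × (Bool → 𝒮) × (Bool → ℝ)

/-- One full unit: `(X, T, (S(0), S(1)), (Y(0), Y(1)))` together with the labelling indicator `R`. -/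
abbrev Full (𝒳 𝒮 : Type*) := Unlabelled 𝒳 𝒮 × Bool

/-- What is seen of a labelled unit: `(X, T, S, Y)`. -/
abbrev Obs (𝒳 𝒮 : Type*) := 𝒳 × Bool × 𝒮 × ℝ

section Variables

variable {𝒳 𝒮 : Type*}

/-- Covariates. -/
def X (w : Full 𝒳 𝒮) : 𝒳 := w.1.1

/-- Treatment indicator. -/
def T (w : Full 𝒳 𝒮) : Bool := w.1.2.1

/-- Potential surrogates. -/
def Spot (a : Bool) (w : Full 𝒳 𝒮) : 𝒮 := w.1.2.2.1 a

/-- Potential outcomes. -/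
def Ypot (a : Bool) (w : Full 𝒳 𝒮) : ℝ := w.1.2.2.2 a

/-- Labelling indicator. -/
def R (w : Full 𝒳 𝒮) : Bool := w.2

/-- The actual surrogate `S = S(T)`. -/
def S (w : Full 𝒳 𝒮) : 𝒮 := Spot (T w) w

/-- The actual outcome `Y = Y(T)`. -/
def Y (w : Full 𝒳 𝒮) : ℝ := Ypot (T w) w

/-- The observed variables `(X, T, S, Y)`. -/
def obs (w : Full 𝒳 𝒮) : Obs 𝒳 𝒮 := (X w, T w, S w, Y w)

variable [MeasurableSpace 𝒳] [MeasurableSpace 𝒮]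

theorem measurable_X : Measurable (X : Full 𝒳 𝒮 → 𝒳) :=
  measurable_fst.comp measurable_fst

theorem measurable_T : Measurable (T : Full 𝒳 𝒮 → Bool) :=
  measurable_fst.comp (measurable_snd.comp measurable_fst)

theorem measurable_Spot (a : Bool) : Measurable (Spot a : Full 𝒳 𝒮 → 𝒮) :=
  (measurable_pi_apply a).comp
    (measurable_fst.comp (measurable_snd.comp (measurable_snd.comp measurable_fst)))

theorem measurable_Ypot (a : Bool) : Measurable (Ypot a : Full 𝒳 𝒮 → ℝ) :=
  (measurable_pi_apply a).comp
    (measurable_snd.comp (measurable_snd.comp (measurable_snd.comp measurable_fst)))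

theorem measurable_R : Measurable (R : Full 𝒳 𝒮 → Bool) := measurable_snd

theorem measurable_S : Measurable (S : Full 𝒳 𝒮 → 𝒮) := by
  have h : (S : Full 𝒳 𝒮 → 𝒮) = fun w => if T w = true then Spot true w else Spot false w := by
    funext w
    cases h : T w <;> simp [S, h]
  rw [h]
  exact Measurable.ite (measurable_T (measurableSet_singleton true))
    (measurable_Spot true) (measurable_Spot false)

theorem measurable_Y : Measurable (Y : Full 𝒳 𝒮 → ℝ) := by
  have h : (Y : Full 𝒳 𝒮 → ℝ) = fun w => if T w = true then Ypot true w else Ypot false w := by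
    funext w
    cases h : T w <;> simp [Y, h]
  rw [h]
  exact Measurable.ite (measurable_T (measurableSet_singleton true))
    (measurable_Ypot true) (measurable_Ypot false)

theorem measurable_obs : Measurable (obs : Full 𝒳 𝒮 → Obs 𝒳 𝒮) :=
  measurable_X.prodMk (measurable_T.prodMk (measurable_S.prodMk measurable_Y))

end Variables

/-- A population: the conditional laws of `(X, T, S(·), Y(·))` given `R = 1` (`law true`) and given
`R = 0` (`law false`), and the probability `P(R = 1)`.  Keeping the two conditional laws apart makes
"given `R = 1`" meaningful also when `P(R = 1) = 0`. -/
structure Population (𝒳 𝒮 : Type*) [MeasurableSpace 𝒳] [MeasurableSpace 𝒮] where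
  /-- `P(R = 1)`; the value `0` is allowed. -/
  labelProb : unitInterval
  /-- Conditional law of the unit given its label. -/
  law : Bool → ProbabilityMeasure (Unlabelled 𝒳 𝒮)

namespace Population

variable {𝒳 𝒮 : Type*} [MeasurableSpace 𝒳] [MeasurableSpace 𝒮]

/-- The law of a full unit given `R = ℓ`. -/
def given (p : Population 𝒳 𝒮) (ℓ : Bool) : Measure (Full 𝒳 𝒮) :=
  (p.law ℓ : Measure (Unlabelled 𝒳 𝒮)).prod (Measure.dirac ℓ)

instance (p : Population 𝒳 𝒮) (ℓ : Bool) : IsProbabilityMeasure (p.given ℓ) := by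
  unfold given; infer_instance

/-- The law of a full unit that has the same conditional laws given `R = 1` and given `R = 0` as the
population `p`, but in which `R = 1` has probability `ρ`. -/
def mix (p : Population 𝒳 𝒮) (ρ : unitInterval) : Measure (Full 𝒳 𝒮) :=
  unitInterval.toNNReal ρ • p.given true +
    unitInterval.toNNReal (unitInterval.symm ρ) • p.given false

instance (p : Population 𝒳 𝒮) (ρ : unitInterval) : IsFiniteMeasure (p.mix ρ) := by
  unfold mix; infer_instance

/-- The law `P` of a full unit. -/
def P (p : Population 𝒳 𝒮) : Measure (Full 𝒳 𝒮) := p.mix p.labelProb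

instance (p : Population 𝒳 𝒮) : IsProbabilityMeasure p.P := by
  refine ⟨?_⟩
  have h : unitInterval.toNNReal p.labelProb
      + unitInterval.toNNReal (unitInterval.symm p.labelProb) = 1 := by
    ext
    simp
  rw [P, mix, Measure.add_apply, Measure.smul_apply, Measure.smul_apply, measure_univ, measure_univ,
    ← add_smul, h, one_smul]

/-- The law `Q` of the observed data: the conditional law of `(X, T, S, Y)` given `R = 1`. -/
def Q (p : Population 𝒳 𝒮) : Measure (Obs 𝒳 𝒮) := (p.given true).map obs

instance (p : Population 𝒳 𝒮) : IsProbabilityMeasure p.Q :=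
  Measure.isProbabilityMeasure_map measurable_obs.aemeasurable

/-- The unconditional law of `(X, T, S)`. -/
def lawXTS (p : Population 𝒳 𝒮) : Measure (𝒳 × Bool × 𝒮) :=
  p.P.map fun w => (X w, T w, S w)

/-- The average treatment effect `δ* = E[Y(1)] - E[Y(0)]`. -/
def ate (p : Population 𝒳 𝒮) : ℝ :=
  (∫ w, Ypot true w ∂p.P) - ∫ w, Ypot false w ∂p.P

/-- The law of the covariates under `P`. -/
def lawX (p : Population 𝒳 𝒮) : Measure 𝒳 := p.P.map X

/-- The law of the covariates given `R = 1`. -/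
def lawXLabelled (p : Population 𝒳 𝒮) : Measure 𝒳 := (p.given true).map X

/-- The density ratio `λ*(x) = f*(x) / f*(x | R = 1)`: the density of the law of `X` under `P` with
respect to the law of `X` given `R = 1`. -/
def densityRatio (p : Population 𝒳 𝒮) (x : 𝒳) : ℝ :=
  (p.lawX.rnDeriv p.lawXLabelled x).toReal

/-- The propensity score `e*(x) = P(T = 1 | X = x)`. -/
def propensity (p : Population 𝒳 𝒮) (x : 𝒳) : ℝ :=
  (condDistrib T X p.P x).real {true}

/-- The regression function `μ̃*(t, x, s) = E[Y | T = t, X = x, S = s, R = 1]`. -/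
def regression (p : Population 𝒳 𝒮) (t : Bool) (x : 𝒳) (s : 𝒮) : ℝ :=
  ∫ y, y ∂(condDistrib Y (fun w => (X w, T w, S w)) (p.given true) (x, t, s))

/-- The function `ψ̃(x, t, s, y)`. -/
def psi (p : Population 𝒳 𝒮) : Obs 𝒳 𝒮 → ℝ
  | (x, t, s, y) =>
    (if t then (1 : ℝ) else 0) * p.densityRatio x / p.propensity x *
        (y - p.regression true x s) -
      (1 - (if t then (1 : ℝ) else 0)) * p.densityRatio x / (1 - p.propensity x) *
        (y - p.regression false x s)

end Population

/-! ### Assumptions and the statistical model -/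

section Model

variable {𝒳 𝒮 : Type*} [MeasurableSpace 𝒳] [MeasurableSpace 𝒮]
  [StandardBorelSpace 𝒳] [StandardBorelSpace 𝒮]

/-- The conditions on a population.  Conditions on the labelling indicator `R` are conditions on the
two conditional laws given `R = 1` and given `R = 0`: conditional independence of `R` is required in a
mixture of these laws in which both labels have positive probability.  Reweighting the two labels does
not affect it, so the choice of the probability `ρ ∈ (0, 1)` does not matter; if `0 < P(R = 1) < 1`, one
can take `ρ = P(R = 1)` and the mixture is `P` itself. -/
structure Assumptions (ε : ℝ) (C : ℝ≥0) (p : Population 𝒳 𝒮) : Prop where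
  /-- `(Y(t), S(t)) ⊥ T ∣ X`. -/
  unconfounded : ∀ a : Bool,
    CondIndepFun (MeasurableSpace.comap X inferInstance) measurable_X.comap_le
      (fun w => (Ypot a w, Spot a w)) T p.P
  /-- `R ⊥ Y(t) ∣ (X, T = t, S(t))`. -/
  missing_at_random : ∀ a : Bool, ∃ ρ : unitInterval, 0 < ρ ∧ ρ < 1 ∧
    CondIndepFun (MeasurableSpace.comap (fun w => (X w, Spot a w)) inferInstance)
      (measurable_X.prodMk (measurable_Spot a)).comap_le
      R (Ypot a) (cond (p.mix ρ) {w | T w = a})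
  /-- `R ⊥ S(t) ∣ T, X`. -/
  label_surrogate : ∀ a : Bool, ∃ ρ : unitInterval, 0 < ρ ∧ ρ < 1 ∧
    CondIndepFun (MeasurableSpace.comap (fun w => (T w, X w)) inferInstance)
      (measurable_T.prodMk measurable_X).comap_le R (Spot a) (p.mix ρ)
  /-- `R ⊥ T ∣ X`. -/
  label_treatment : ∃ ρ : unitInterval, 0 < ρ ∧ ρ < 1 ∧
    CondIndepFun (MeasurableSpace.comap X inferInstance) measurable_X.comap_le R T (p.mix ρ)
  /-- Strict overlap of the treatment propensity: `ε ≤ e*(X) ≤ 1 - ε` almost surely. -/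
  overlap : ∀ᵐ x ∂p.lawX, ε ≤ p.propensity x ∧ p.propensity x ≤ 1 - ε
  /-- The density ratio exists ... -/
  absolutelyContinuous : p.lawX ≪ p.lawXLabelled
  /-- ... and is bounded: `‖λ*(X)‖_∞ ≤ C`. -/
  densityRatio_le : ∀ᵐ x ∂p.lawX, p.densityRatio x ≤ C
  /-- The potential outcomes are square integrable ... -/
  outcome_memLp : ∀ a : Bool, MemLp (Ypot a) 2 p.P
  /-- ... and the outcome has a mean given `R = 1`, so that `μ̃*` is meaningful. -/
  outcome_integrable : Integrable Y (p.given true)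

/-- The semiparametric model around `p₀`: all populations that satisfy the conditions and in which the
unconditional law of `(X, T, S)` is the known one. -/
def model (ε : ℝ) (C : ℝ≥0) (p₀ : Population 𝒳 𝒮) : Set (Population 𝒳 𝒮) :=
  {p | Assumptions ε C p ∧ p.lawXTS = p₀.lawXTS}

end Model

/-! ### Semiparametric efficiency -/

section Efficiency

/-- Differentiability in quadratic mean at `0` of a one-parameter family of laws `Q θ`, dominated by a
`σ`-finite measure `μ`, with score `g`:
`∫ ((√(q_θ) - √(q_0)) / θ - g √(q_0) / 2)² dμ → 0` as `θ → 0`, where `q_θ = dQ_θ/dμ`. -/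
def HasScore {O : Type*} [MeasurableSpace O] (Q : ℝ → Measure O) (g : O → ℝ) : Prop :=
  ∃ μ : Measure O, SigmaFinite μ ∧ (∀ θ, Q θ ≪ μ) ∧
    Tendsto
      (fun θ : ℝ => ∫⁻ o, ENNReal.ofReal
        (((√((Q θ).rnDeriv μ o).toReal - √((Q 0).rnDeriv μ o).toReal) / θ
          - g o * √((Q 0).rnDeriv μ o).toReal / 2) ^ 2) ∂μ)
      (𝓝[≠] 0) (𝓝 0)

variable {𝒳 𝒮 : Type*} [MeasurableSpace 𝒳] [MeasurableSpace 𝒮]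

/-- A smooth one-dimensional parametric submodel of `M` through `p₀` with score `g`: a family `γ` of
populations in `M` whose laws of the observed data pass through that of `p₀` at the parameter value
`0`, are differentiable in quadratic mean there with score `g`, and for which the second moments of the
potential outcomes stay bounded. -/
structure IsSmoothSubmodel (M : Set (Population 𝒳 𝒮)) (p₀ : Population 𝒳 𝒮)
    (γ : ℝ → Population 𝒳 𝒮) (g : Lp ℝ 2 p₀.Q) : Prop where
  mem : ∀ θ, γ θ ∈ M
  base : (γ 0).Q = p₀.Q
  score : HasScore (fun θ => (γ θ).Q) g
  moment : ∃ K : ℝ, ∀ (θ : ℝ) (a : Bool), ∫ w, Ypot a w ^ 2 ∂(γ θ).P ≤ K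

/-- The tangent space at `p₀`: the closed linear span in `L²(Q)` of the scores of smooth submodels. -/
def tangentSpace (M : Set (Population 𝒳 𝒮)) (p₀ : Population 𝒳 𝒮) :
    Submodule ℝ (Lp ℝ 2 p₀.Q) :=
  (Submodule.span ℝ {g | ∃ γ, IsSmoothSubmodel M p₀ γ g}).topologicalClosure

/-- `φ` is the efficient influence function at `p₀` of the average treatment effect in the model `M`:
it is a square-integrable element of the tangent space, and along every smooth submodel the derivative
of the average treatment effect at `p₀` is the `L²(Q)` inner product of `φ` with the score. -/
def IsEfficientInfluenceFunction (M : Set (Population 𝒳 𝒮)) (p₀ : Population 𝒳 𝒮)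
    (φ : Obs 𝒳 𝒮 → ℝ) : Prop :=
  (∃ h : MemLp φ 2 p₀.Q, h.toLp φ ∈ tangentSpace M p₀) ∧
    ∀ (γ : ℝ → Population 𝒳 𝒮) (g : Lp ℝ 2 p₀.Q), IsSmoothSubmodel M p₀ γ g →
      HasDerivAt (fun θ => (γ θ).ate) (∫ o, φ o * g o ∂p₀.Q) 0

/-- The efficiency lower bound at `p₀` for the average treatment effect in the model `M`: the supremum
of the Cramér-Rao bounds `d² / E[g²]` over all smooth submodels, where `g` is the score of the submodel
and `d` is the derivative of the average treatment effect along it. -/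
def efficiencyBound (M : Set (Population 𝒳 𝒮)) (p₀ : Population 𝒳 𝒮) : ℝ≥0∞ :=
  ⨆ (γ : ℝ → Population 𝒳 𝒮) (g : Lp ℝ 2 p₀.Q) (_ : IsSmoothSubmodel M p₀ γ g)
    (d : ℝ) (_ : HasDerivAt (fun θ => (γ θ).ate) d 0),
    ENNReal.ofReal (d ^ 2) / ENNReal.ofReal (∫ o, g o ^ 2 ∂p₀.Q)

end Efficiency

end

end SurrogateATE

/-! Write $Q_\theta$ for the law of the labelled data along a smooth submodel and $\lambda_\theta$
for its density ratio. The independence conditions on $R$ say that $(T,S,Y)$ has the same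
conditional law given $X$ under both labels, so the law of $(X,T,S,Y)$ under $\mathbb P_\theta$ is
$\lambda_\theta(X)\,Q_\theta$ (`map_obs_P`). By unconfoundedness $\delta$ is the inverse propensity
weighted mean of $Y$ (`ate_eq_integral_ipWeight`). The law of $(X,T,S)$ is known, hence so is the
propensity, and replacing $Y$ by $Y-\tilde\mu^*$, with the regression of the base point, changes
$\delta$ only by a known constant. Thus $\delta(\mathbb P_\theta)=\int\lambda_\theta
f\,dQ_\theta+\text{const}$ with one fixed function $f$, the weighted residual
(`ate_eq_integral_residual`).

Since $f$ is centred given $X$ under $Q_0$, moving $\lambda_\theta$ should have no first-order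
effect, which leaves the derivative $\int\lambda_0 f g\,dQ_0=\int\tilde\psi g\,dQ_0$. The difficulty
is that $\lambda_\theta$ is not assumed smooth in $\theta$, and that $f$ is square integrable only
after weighting by $\lambda_\theta$. What helps is that $\lambda_\theta Q_\theta$ always has the
same marginal law of $X$. This gives $\lambda_\theta\wedge4\lambda_0\to\lambda_0$ in $L^2(Q_0)$, and
shows that the set $\{\lambda_\theta>4\lambda_0\}$ has mass $o(\theta^2)$
(`hasDerivAt_weighted_integral`).

For the tangent space, every bounded function with mean zero given $(X,T,S)$ is a score: tilt the
conditional law of $Y$ given $(X,T,S)$ linearly and keep everything else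
(`exists_isSmoothSubmodel`). Truncating $\tilde\psi$ and recentring gives such functions converging
to $\tilde\psi$ in $L^2(Q)$ (`exists_tendsto_score`). The bound then follows from Cauchy-Schwarz in
one direction and from these scores in the other. -/

namespace SurrogateATE

/-! ### Square-integrable functions: norms, tails and weak convergence. -/

section SquareIntegrable

variable {Ω : Type*} [MeasurableSpace Ω] {μ : Measure Ω}

theorem eLpNorm_two_sq (u : Ω → ℝ) :
    eLpNorm u 2 μ ^ 2 = ∫⁻ o, ENNReal.ofReal (u o ^ 2) ∂μ := by
  rw [eLpNorm_eq_lintegral_rpow_enorm_toReal (by norm_num) (by norm_num)]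
  have h : ∀ o, ‖u o‖ₑ ^ ((2 : ℝ≥0∞).toReal) = ENNReal.ofReal (u o ^ 2) := fun o => by
    rw [← sq_abs, ENNReal.ofReal_pow (abs_nonneg _), ← Real.enorm_eq_ofReal_abs]
    simp
  simp only [h]
  rw [← ENNReal.rpow_natCast, ← ENNReal.rpow_mul]
  simp

theorem eLpNorm_two_eq (u : Ω → ℝ) :
    eLpNorm u 2 μ = (∫⁻ o, ENNReal.ofReal (u o ^ 2) ∂μ) ^ (1 / 2 : ℝ) := by
  rw [← eLpNorm_two_sq, ← ENNReal.rpow_natCast, ← ENNReal.rpow_mul]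
  simp

theorem enorm_integral_mul_le {u v : Ω → ℝ} (hu : Measurable u) (hv : Measurable v) :
    ‖∫ o, u o * v o ∂μ‖ₑ ≤ eLpNorm u 2 μ * eLpNorm v 2 μ := by
  refine (enorm_integral_le_lintegral_enorm _).trans ?_
  rw [← eLpNorm_one_eq_lintegral_enorm]
  exact (eLpNorm_smul_le_mul_eLpNorm (p := 2) (q := 2) (r := 1) (f := v) (φ := u)
    hv.aestronglyMeasurable hu.aestronglyMeasurable :)

theorem integrable_mul_of_eLpNorm_two {u v : Ω → ℝ} (hu : Measurable u) (hv : Measurable v)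
    (hu2 : eLpNorm u 2 μ ≠ ∞) (hv2 : eLpNorm v 2 μ ≠ ∞) :
    Integrable (fun o => u o * v o) μ :=
  MemLp.integrable_mul (p := 2) (q := 2) ⟨hu.aestronglyMeasurable, hu2.lt_top⟩
    ⟨hv.aestronglyMeasurable, hv2.lt_top⟩

theorem eLpNorm_two_mono {u v : Ω → ℝ} (h : ∀ o, |u o| ≤ |v o|) :
    eLpNorm u 2 μ ≤ eLpNorm v 2 μ := eLpNorm_mono h

theorem eLpNorm_two_const_mul (c : ℝ) (u : Ω → ℝ) :
    eLpNorm (fun o => c * u o) 2 μ = ENNReal.ofReal |c| * eLpNorm u 2 μ := by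
  rw [← Real.enorm_eq_ofReal_abs]
  exact eLpNorm_const_smul c u 2 μ

theorem eLpNorm_two_le_const_mul {u v : Ω → ℝ} {c : ℝ} (hc : 0 ≤ c)
    (h : ∀ o, |u o| ≤ c * |v o|) :
    eLpNorm u 2 μ ≤ ENNReal.ofReal c * eLpNorm v 2 μ := by
  have := eLpNorm_two_const_mul (μ := μ) c v
  rw [abs_of_nonneg hc] at this
  rw [← this]
  exact eLpNorm_two_mono fun o => by rw [abs_mul, abs_of_nonneg hc]; exact h o

theorem eLpNorm_two_add_le {u v : Ω → ℝ} (hu : Measurable u) (hv : Measurable v) :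
    eLpNorm (fun o => u o + v o) 2 μ ≤ eLpNorm u 2 μ + eLpNorm v 2 μ :=
  eLpNorm_add_le hu.aestronglyMeasurable hv.aestronglyMeasurable (by norm_num)

/-- The part of a square-integrable function outside the sublevel sets of a function vanishes. -/
theorem tendsto_eLpNorm_two_tail {f k : Ω → ℝ} (hf : Measurable f) (hk : Measurable k)
    (hk2 : eLpNorm k 2 μ ≠ ∞) :
    Tendsto (fun n : ℕ => eLpNorm ({o | (n : ℝ) < |f o|}.indicator k) 2 μ) atTop (𝓝 0) := by
  simp only [eLpNorm_two_eq]
  have h : Tendsto (fun n : ℕ => ∫⁻ o, ENNReal.ofReal ({o | (n : ℝ) < |f o|}.indicator k o ^ 2) ∂μ)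
      atTop (𝓝 (∫⁻ _, 0 ∂μ)) := by
    refine tendsto_lintegral_filter_of_dominated_convergence
      (fun o => ENNReal.ofReal (k o ^ 2)) (Eventually.of_forall fun n => ?_)
      (Eventually.of_forall fun n => ae_of_all _ fun o => ?_) ?_ (ae_of_all _ fun o => ?_)
    · exact ((hk.indicator (measurableSet_lt measurable_const hf.abs)).pow_const 2).ennreal_ofReal
    · refine ENNReal.ofReal_le_ofReal ?_
      by_cases ho : o ∈ {o | (n : ℝ) < |f o|}
      · rw [Set.indicator_of_mem ho]
      · rw [Set.indicator_of_notMem ho]; simpa using sq_nonneg (k o)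
    · rw [← eLpNorm_two_sq]; exact ENNReal.pow_ne_top hk2
    · refine tendsto_const_nhds.congr' ?_
      filter_upwards [eventually_ge_atTop ⌈|f o|⌉₊] with n hn
      have : o ∉ {o | (n : ℝ) < |f o|} := by
        simp only [Set.mem_ofPred_eq, not_lt]
        exact (Nat.le_ceil _).trans (by exact_mod_cast hn)
      rw [Set.indicator_of_notMem this]; simp
  have := h.ennrpow_const (1 / 2 : ℝ)
  simpa using this

/-- If `r i → 0` in `L²` and `f * r i` stays bounded in `L²`, then `f * r i → 0` weakly in `L²`. -/
theorem tendsto_enorm_integral_mul_mul {ι : Type*} {l : Filter ι} {f k : Ω → ℝ} {r : ι → Ω → ℝ}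
    (hf : Measurable f) (hk : Measurable k) (hr : ∀ i, Measurable (r i))
    (hk2 : eLpNorm k 2 μ ≠ ∞) {K : ℝ≥0} (hfr : ∀ i, eLpNorm (fun o => f o * r i o) 2 μ ≤ K)
    (hr0 : Tendsto (fun i => eLpNorm (r i) 2 μ) l (𝓝 0)) :
    Tendsto (fun i => ‖∫ o, f o * r i o * k o ∂μ‖ₑ) l (𝓝 0) := by
  -- Split at level $n$ of $|f|$: below it `f` is bounded and `r i` supplies the smallness, above it
  -- the tail of `k` does. Then $n$ is fixed before the limit in `i`.
  have key : ∀ (n : ℕ) (i : ι), ‖∫ o, f o * r i o * k o ∂μ‖ₑ ≤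
      ENNReal.ofReal n * eLpNorm (r i) 2 μ * eLpNorm k 2 μ +
        K * eLpNorm ({o | (n : ℝ) < |f o|}.indicator k) 2 μ := by
    intro n i
    have hs : MeasurableSet {o | (n : ℝ) < |f o|} := measurableSet_lt measurable_const hf.abs
    refine (enorm_integral_le_lintegral_enorm _).trans ?_
    have h1 : ∀ o, ‖f o * r i o * k o‖ₑ ≤
        ‖((n : ℝ) * r i o) * k o‖ₑ +
          ‖(f o * r i o) * {o | (n : ℝ) < |f o|}.indicator k o‖ₑ := by
      intro o
      by_cases ho : o ∈ {o | (n : ℝ) < |f o|}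
      · rw [Set.indicator_of_mem ho]; exact le_add_self
      · refine le_trans ?_ le_self_add
        rw [enorm_le_iff_norm_le]
        simp only [Set.mem_ofPred_eq, not_lt] at ho
        simp only [norm_mul, Real.norm_eq_abs, Nat.abs_cast]
        gcongr
    refine (lintegral_mono h1).trans ?_
    rw [lintegral_add_left (by fun_prop)]
    refine add_le_add ?_ ?_
    · rw [← eLpNorm_one_eq_lintegral_enorm]
      refine (eLpNorm_smul_le_mul_eLpNorm (p := 2) (q := 2) (r := 1) hk.aestronglyMeasurable
        ((hr i).const_mul _).aestronglyMeasurable).trans ?_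
      rw [eLpNorm_two_const_mul, abs_of_nonneg (Nat.cast_nonneg n)]
    · rw [← eLpNorm_one_eq_lintegral_enorm]
      refine (eLpNorm_smul_le_mul_eLpNorm (p := 2) (q := 2) (r := 1)
        (hk.indicator hs).aestronglyMeasurable
        (hf.mul (hr i)).aestronglyMeasurable).trans ?_
      gcongr
      exact hfr i
  rw [ENNReal.tendsto_nhds_zero]
  intro δ hδ
  have hδ2 : 0 < δ / 2 := ENNReal.half_pos hδ.ne'
  have ht : Tendsto (fun n : ℕ => K * eLpNorm ({o | (n : ℝ) < |f o|}.indicator k) 2 μ)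
      atTop (𝓝 0) := by
    simpa using ENNReal.Tendsto.const_mul (tendsto_eLpNorm_two_tail hf hk hk2)
      (Or.inr ENNReal.coe_ne_top)
  obtain ⟨n, hn⟩ := ((ENNReal.tendsto_nhds_zero.1 ht) _ hδ2).exists
  have h2 : Tendsto (fun i => ENNReal.ofReal n * eLpNorm (r i) 2 μ * eLpNorm k 2 μ) l (𝓝 0) := by
    have := ENNReal.Tendsto.mul_const (ENNReal.Tendsto.const_mul (a := ENNReal.ofReal n) hr0
      (Or.inr ENNReal.ofReal_ne_top)) (Or.inr hk2)
    simpa using this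
  filter_upwards [ENNReal.tendsto_nhds_zero.1 h2 _ hδ2] with i hi
  exact (key n i).trans ((add_le_add hi hn).trans (ENNReal.add_halves δ).le)

end SquareIntegrable

/-! ### Two laws reweighted to the same marginal law. -/

section Reweighting

variable {Ω E : Type*} [MeasurableSpace Ω] [MeasurableSpace E] {μ : Measure Ω} {π : Ω → E}

theorem integral_map_withDensity_sq (hπ : Measurable π) {l : E → ℝ} (hl : Measurable l)
    (hl0 : ∀ x, 0 ≤ l x) {a : Ω → ℝ} (ha : Measurable a) {P : Measure E}
    (hP : (μ.withDensity fun o => ENNReal.ofReal (l (π o) * a o ^ 2)).map π = P)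
    {s : E → ℝ} (hs : Measurable s) :
    ∫ o, s (π o) * (l (π o) * a o ^ 2) ∂μ = ∫ x, s x ∂P := by
  have hm : Measurable fun o => ENNReal.ofReal (l (π o) * a o ^ 2) :=
    ((hl.comp hπ).mul (ha.pow_const 2)).ennreal_ofReal
  rw [← hP, integral_map hπ.aemeasurable hs.aestronglyMeasurable,
    integral_withDensity_eq_integral_toReal_smul hm (by simp)]
  refine integral_congr_ae (ae_of_all _ fun o => ?_)
  simp only [smul_eq_mul]
  rw [ENNReal.toReal_ofReal (mul_nonneg (hl0 _) (sq_nonneg _)), mul_comm]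

/-- The right side involves neither `l` nor `a`. Hence on any event in the covariates two reweighted
density roots have exactly the same norm, which is how the known covariate law enters the estimates.
-/
theorem eLpNorm_indicator_sqrt_mul_sq (hπ : Measurable π) {l : E → ℝ}
    (hl0 : ∀ x, 0 ≤ l x) {a : Ω → ℝ} {P : Measure E}
    (hP : (μ.withDensity fun o => ENNReal.ofReal (l (π o) * a o ^ 2)).map π = P)
    {B : Set E} (hB : MeasurableSet B) :
    eLpNorm ((π ⁻¹' B).indicator fun o => √(l (π o)) * a o) 2 μ ^ 2 = P B := by
  rw [eLpNorm_two_sq, ← hP, Measure.map_apply hπ hB, withDensity_apply _ (hπ hB),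
    ← lintegral_indicator (hπ hB)]
  refine lintegral_congr fun o => ?_
  by_cases ho : o ∈ π ⁻¹' B
  · rw [Set.indicator_of_mem ho, Set.indicator_of_mem ho, mul_pow, Real.sq_sqrt (hl0 _)]
  · rw [Set.indicator_of_notMem ho, Set.indicator_of_notMem ho]; simp

/-- Absorbs half of `x` into the left side; finiteness of `x` is essential. -/
theorem ENNReal_le_two_mul_of_le_half_add {x y : ℝ≥0∞} (hx : x ≠ ∞)
    (h : x ≤ ENNReal.ofReal (1 / 2) * x + y) : x ≤ ENNReal.ofReal 2 * y := by
  by_cases hy : y = ∞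
  · simp [hy]
  have h1 := ENNReal.toReal_mono (by finiteness) h
  rw [ENNReal.toReal_add (by finiteness) hy, ENNReal.toReal_mul,
    ENNReal.toReal_ofReal (by norm_num)] at h1
  rw [← ENNReal.toReal_le_toReal hx (by finiteness), ENNReal.toReal_mul,
    ENNReal.toReal_ofReal (by norm_num)]
  linarith

variable {l l₀ : E → ℝ} {a b : Ω → ℝ} {P : Measure E} {C : ℝ}

/-- Where the density ratio has become more than four times as large, the base density root is
controlled by its increment. -/
theorem eLpNorm_indicator_highRatio_le (hπ : Measurable π)
    (hl : Measurable l) (hl0 : ∀ x, 0 ≤ l x) (hl₀ : Measurable l₀) (hl₀0 : ∀ x, 0 ≤ l₀ x)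
    (ha : Measurable a) (hb : Measurable b) [IsFiniteMeasure P]
    (hP : (μ.withDensity fun o => ENNReal.ofReal (l (π o) * a o ^ 2)).map π = P)
    (hP₀ : (μ.withDensity fun o => ENNReal.ofReal (l₀ (π o) * b o ^ 2)).map π = P) :
    eLpNorm ((π ⁻¹' {x | 4 * l₀ x < l x}).indicator fun o => √(l₀ (π o)) * b o) 2 μ ≤
      ENNReal.ofReal 2 * eLpNorm ((π ⁻¹' {x | 4 * l₀ x < l x}).indicator
        fun o => √(l₀ (π o)) * (a o - b o)) 2 μ := by
  have hBm : MeasurableSet {x | 4 * l₀ x < l x} := measurableSet_lt (hl₀.const_mul 4) hl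
  set B := {x | 4 * l₀ x < l x} with hB
  have e1 := eLpNorm_indicator_sqrt_mul_sq hπ hl0 hP hBm
  have e2 := eLpNorm_indicator_sqrt_mul_sq hπ hl₀0 hP₀ hBm
  have e3 : eLpNorm ((π ⁻¹' B).indicator fun o => √(l (π o)) * a o) 2 μ =
      eLpNorm ((π ⁻¹' B).indicator fun o => √(l₀ (π o)) * b o) 2 μ :=
    (ENNReal.pow_right_strictMono (two_ne_zero)).injective (e1.trans e2.symm)
  refine ENNReal_le_two_mul_of_le_half_add ?_ ?_
  · intro h
    rw [h] at e2
    simp at e2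
    exact measure_ne_top P B e2.symm
  · rw [← e3]
    have hm : Measurable ((π ⁻¹' B).indicator fun o => √(l₀ (π o)) * a o) :=
      (((hl₀.comp hπ).sqrt).mul ha).indicator (hπ hBm)
    have hm' : Measurable ((π ⁻¹' B).indicator fun o => √(l₀ (π o)) * (a o - b o)) :=
      (((hl₀.comp hπ).sqrt).mul (ha.sub hb)).indicator (hπ hBm)
    -- The threshold $4$ makes $\sqrt{l_0}\le\frac12\sqrt l$ on `B`. As $\sqrt l\,a$ and
    -- $\sqrt{l_0}\,b$ have equal norms there, the triangle inequality leaves a term that can be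
    -- absorbed.
    have h1 : eLpNorm ((π ⁻¹' B).indicator fun o => √(l₀ (π o)) * a o) 2 μ ≤
        ENNReal.ofReal (1 / 2) *
          eLpNorm ((π ⁻¹' B).indicator fun o => √(l (π o)) * a o) 2 μ := by
      refine eLpNorm_two_le_const_mul (by norm_num) fun o => ?_
      by_cases ho : o ∈ π ⁻¹' B
      · rw [Set.indicator_of_mem ho, Set.indicator_of_mem ho, abs_mul, abs_mul, ← mul_assoc]
        refine mul_le_mul_of_nonneg_right ?_ (abs_nonneg _)
        rw [abs_of_nonneg (Real.sqrt_nonneg _), abs_of_nonneg (Real.sqrt_nonneg _)]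
        have h4 : 4 * l₀ (π o) < l (π o) := ho
        have h5 : √(4 * l₀ (π o)) ≤ √(l (π o)) := Real.sqrt_le_sqrt h4.le
        rw [Real.sqrt_mul (by norm_num), show √4 = (2 : ℝ) by
          rw [show (4 : ℝ) = 2 ^ 2 by norm_num]; simp] at h5
        linarith
      · rw [Set.indicator_of_notMem ho, Set.indicator_of_notMem ho]; simp
    calc eLpNorm ((π ⁻¹' B).indicator fun o => √(l (π o)) * a o) 2 μ
        = eLpNorm (fun o => (π ⁻¹' B).indicator (fun o => √(l₀ (π o)) * a o) o +
            (-1) * (π ⁻¹' B).indicator (fun o => √(l₀ (π o)) * (a o - b o)) o) 2 μ := by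
          rw [e3]; congr 1; ext o
          by_cases ho : o ∈ π ⁻¹' B
          · simp only [Set.indicator_of_mem ho]; ring
          · simp only [Set.indicator_of_notMem ho]; ring
      _ ≤ _ := by
          refine (eLpNorm_two_add_le hm (hm'.const_mul _)).trans ?_
          rw [eLpNorm_two_const_mul]
          simp only [abs_neg, abs_one, ENNReal.ofReal_one, one_mul]
          gcongr

theorem abs_min_sub_le {u v : ℝ} (hv : 0 ≤ v) : |min u (4 * v) - v| ≤ |u - v| := by
  rcases le_total u (4 * v) with h | h
  · rw [min_eq_left h]
  · rw [min_eq_right h, abs_of_nonneg (by linarith), abs_of_nonneg (by linarith)]; linarith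

/-- Densities of a fixed measure with respect to two close laws are close. -/
theorem eLpNorm_min_sub_mul_sq_le (hπ : Measurable π)
    (hl : Measurable l) (hl0 : ∀ x, 0 ≤ l x) (hlC : ∀ x, l x ≤ C)
    (hl₀ : Measurable l₀) (hl₀0 : ∀ x, 0 ≤ l₀ x) (hl₀C : ∀ x, l₀ x ≤ C)
    (hC : 0 ≤ C) (ha : Measurable a) (hb : Measurable b)
    (ha1 : eLpNorm a 2 μ ≤ 1) (hb1 : eLpNorm b 2 μ ≤ 1)
    (hP : (μ.withDensity fun o => ENNReal.ofReal (l (π o) * a o ^ 2)).map π = P)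
    (hP₀ : (μ.withDensity fun o => ENNReal.ofReal (l₀ (π o) * b o ^ 2)).map π = P) :
    eLpNorm (fun o => (min (l (π o)) (4 * l₀ (π o)) - l₀ (π o)) * b o) 2 μ ^ 2 ≤
      ENNReal.ofReal C * (ENNReal.ofReal C * 2 * eLpNorm (fun o => a o - b o) 2 μ) := by
  -- The sign of $l-l_0$ is a function of the covariates, so it has the same integral against
  -- $l\,a^2$ and $l_0\,b^2$. This turns $\int|l-l_0|b^2$ into $\int s\,l\,(b^2-a^2)$, which is
  -- controlled by $\|a-b\|$.
  set s : E → ℝ := fun x => if l₀ x ≤ l x then 1 else -1 with hs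
  have hsm : Measurable s :=
    Measurable.ite (measurableSet_le hl₀ hl) measurable_const measurable_const
  have hs1 : ∀ x, |s x| = 1 := fun x => by simp only [hs]; split_ifs <;> simp
  have hsabs : ∀ x, s x * (l x - l₀ x) = |l x - l₀ x| := fun x => by
    simp only [hs]; split_ifs with h
    · rw [abs_of_nonneg (by linarith)]; ring
    · rw [abs_of_nonpos (by linarith)]; ring
  have hlπ : Measurable fun o => l (π o) := hl.comp hπ
  have hl₀π : Measurable fun o => l₀ (π o) := hl₀.comp hπ
  have hsπ : Measurable fun o => s (π o) := hsm.comp hπ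
  have hbd : ∀ x, |s x * l x| ≤ C := fun x => by
    rw [abs_mul, hs1, one_mul, abs_of_nonneg (hl0 x)]; exact hlC x
  have hfin : ∀ {u : Ω → ℝ}, eLpNorm u 2 μ ≤ 1 → eLpNorm u 2 μ ≠ ∞ :=
    fun h => (h.trans_lt ENNReal.one_lt_top).ne
  have hint : ∀ {h : Ω → ℝ} {u : Ω → ℝ}, Measurable h → (∀ o, |h o| ≤ C) → Measurable u →
      eLpNorm u 2 μ ≤ 1 → Integrable (fun o => h o * u o ^ 2) μ := by
    intro h u hh hhC hu hu1
    have h2 := integrable_mul_of_eLpNorm_two hu hu (hfin hu1) (hfin hu1)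
    have := h2.bdd_mul (c := C) hh.aestronglyMeasurable (ae_of_all _ hhC)
    simpa only [sq] using this
  have i1 : Integrable (fun o => s (π o) * l (π o) * b o ^ 2) μ :=
    hint (hsπ.mul hlπ) (fun o => hbd _) hb hb1
  have i2 : Integrable (fun o => s (π o) * l (π o) * a o ^ 2) μ :=
    hint (hsπ.mul hlπ) (fun o => hbd _) ha ha1
  have i3 : Integrable (fun o => s (π o) * l₀ (π o) * b o ^ 2) μ :=
    hint (hsπ.mul hl₀π) (fun o => by
      rw [abs_mul, hs1, one_mul, abs_of_nonneg (hl₀0 _)]; exact hl₀C _) hb hb1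
  have e : ∫ o, |l (π o) - l₀ (π o)| * b o ^ 2 ∂μ =
      ∫ o, (s (π o) * l (π o) * (a o + b o)) * (b o - a o) ∂μ := by
    have m1 := integral_map_withDensity_sq hπ hl hl0 ha hP hsm
    have m2 := integral_map_withDensity_sq hπ hl₀ hl₀0 hb hP₀ hsm
    have m3 : ∫ o, s (π o) * l (π o) * a o ^ 2 ∂μ = ∫ o, s (π o) * l₀ (π o) * b o ^ 2 ∂μ := by
      simp only [mul_assoc]; rw [m1, m2]
    calc ∫ o, |l (π o) - l₀ (π o)| * b o ^ 2 ∂μ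
        = ∫ o, (s (π o) * l (π o) * b o ^ 2 - s (π o) * l₀ (π o) * b o ^ 2) ∂μ := by
          congr 1; ext o; rw [← hsabs]; ring
      _ = ∫ o, (s (π o) * l (π o) * b o ^ 2 - s (π o) * l (π o) * a o ^ 2) ∂μ := by
          rw [integral_sub i1 i3, integral_sub i1 i2, m3]
      _ = _ := by congr 1; ext o; ring
  have hbound : ENNReal.ofReal (∫ o, |l (π o) - l₀ (π o)| * b o ^ 2 ∂μ) ≤
      ENNReal.ofReal C * 2 * eLpNorm (fun o => a o - b o) 2 μ := by
    rw [← abs_of_nonneg (integral_nonneg (μ := μ) (f := fun o => |l (π o) - l₀ (π o)| * b o ^ 2)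
      fun o => by positivity), ← Real.enorm_eq_ofReal_abs, e]
    refine (enorm_integral_mul_le ((hsπ.mul hlπ).mul (ha.add hb)) (hb.sub ha)).trans ?_
    have h1 : eLpNorm (fun o => s (π o) * l (π o) * (a o + b o)) 2 μ ≤ ENNReal.ofReal C * 2 := by
      refine (eLpNorm_two_le_const_mul hC (v := fun o => a o + b o) fun o => ?_).trans ?_
      · rw [abs_mul]; gcongr; exact hbd _
      · gcongr
        exact (eLpNorm_two_add_le ha hb).trans ((add_le_add ha1 hb1).trans (by norm_num))
    have h2 : eLpNorm (fun o => b o - a o) 2 μ ≤ eLpNorm (fun o => a o - b o) 2 μ :=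
      eLpNorm_two_mono fun o => (abs_sub_comm _ _).le
    exact mul_le_mul' h1 h2
  rw [eLpNorm_two_sq]
  have i4 : Integrable (fun o => |l (π o) - l₀ (π o)| * b o ^ 2) μ := by
    refine (i1.sub i3).congr (ae_of_all _ fun o => ?_)
    simp only [Pi.sub_apply]; rw [← hsabs]; ring
  calc ∫⁻ o, ENNReal.ofReal (((min (l (π o)) (4 * l₀ (π o)) - l₀ (π o)) * b o) ^ 2) ∂μ
      ≤ ∫⁻ o, ENNReal.ofReal C * ENNReal.ofReal (|l (π o) - l₀ (π o)| * b o ^ 2) ∂μ := by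
        refine lintegral_mono fun o => ?_
        rw [← ENNReal.ofReal_mul hC]
        refine ENNReal.ofReal_le_ofReal ?_
        rw [mul_pow, ← mul_assoc]
        refine mul_le_mul_of_nonneg_right ?_ (sq_nonneg _)
        rw [← sq_abs, sq]
        refine mul_le_mul ?_ (abs_min_sub_le (hl₀0 _)) (abs_nonneg _) hC
        rw [abs_le]
        constructor
        · have : 0 ≤ min (l (π o)) (4 * l₀ (π o)) := le_min (hl0 _) (by linarith [hl₀0 (π o)])
          linarith [hl₀C (π o)]
        · linarith [min_le_left (l (π o)) (4 * l₀ (π o)), hlC (π o), hl₀0 (π o)]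
    _ = ENNReal.ofReal C * ENNReal.ofReal (∫ o, |l (π o) - l₀ (π o)| * b o ^ 2 ∂μ) := by
        rw [lintegral_const_mul _ (by fun_prop),
          ofReal_integral_eq_lintegral_ofReal i4 (ae_of_all _ fun o => by positivity)]
    _ ≤ _ := by gcongr

end Reweighting

/-! ### Differentiating a weighted integral when the weights are not smooth. -/

section WeightedDerivative

variable {Ω E : Type*} [MeasurableSpace Ω] [MeasurableSpace E] {μ : Measure Ω} {π : Ω → E}

/-- A square-integrable function vanishes in `L²` along sets of vanishing weighted mass. -/
theorem tendsto_eLpNorm_indicator_mul {ι : Type*} {F : Filter ι} {v g : Ω → ℝ} (hv : Measurable v)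
    (hg : Measurable g) (hgv : eLpNorm (fun o => g o * v o) 2 μ ≠ ∞) {s : ι → Set Ω}
    (hs : ∀ i, MeasurableSet (s i))
    (h : Tendsto (fun i => eLpNorm ((s i).indicator v) 2 μ) F (𝓝 0)) :
    Tendsto (fun i => eLpNorm ((s i).indicator fun o => g o * v o) 2 μ) F (𝓝 0) := by
  -- With respect to $v^2\mu$ the function $g^2$ is integrable, and the claim becomes absolute
  -- continuity of its integral.
  set ρ := μ.withDensity fun o => ENNReal.ofReal (v o ^ 2) with hρ
  have hvm : Measurable fun o => ENNReal.ofReal (v o ^ 2) := (hv.pow_const 2).ennreal_ofReal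
  have hgm : Measurable fun o => ENNReal.ofReal (g o ^ 2) := (hg.pow_const 2).ennreal_ofReal
  have e : ∀ (u : Ω → ℝ) (i : ι), eLpNorm ((s i).indicator u) 2 μ =
      (∫⁻ o in s i, ENNReal.ofReal (u o ^ 2) ∂μ) ^ (1 / 2 : ℝ) := fun u i => by
    rw [eLpNorm_indicator_eq_eLpNorm_restrict (hs i), eLpNorm_two_eq]
  have h1 : Tendsto (ρ ∘ s) F (𝓝 0) := by
    have h2 : Tendsto (fun i => eLpNorm ((s i).indicator v) 2 μ ^ 2) F (𝓝 (0 ^ 2)) :=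
      ENNReal.Tendsto.pow h
    simp only [ne_eq, OfNat.ofNat_ne_zero, not_false_eq_true, zero_pow] at h2
    refine h2.congr fun i => ?_
    rw [eLpNorm_indicator_eq_eLpNorm_restrict (hs i), eLpNorm_two_sq, Function.comp_apply, hρ,
      withDensity_apply _ (hs i)]
  have h3 := tendsto_setLIntegral_zero (μ := ρ) (f := fun o => ENNReal.ofReal (g o ^ 2)) ?_ h1
  · have h4 : ∀ i, eLpNorm ((s i).indicator fun o => g o * v o) 2 μ =
        (∫⁻ o in s i, ENNReal.ofReal (g o ^ 2) ∂ρ) ^ (1 / 2 : ℝ) := fun i => by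
      rw [e, hρ, setLIntegral_withDensity_eq_setLIntegral_mul _ hvm hgm (hs i)]
      congr 1
      refine lintegral_congr fun o => ?_
      rw [Pi.mul_apply, ← ENNReal.ofReal_mul (sq_nonneg _)]
      congr 1; ring
    simp only [h4]
    have := h3.ennrpow_const (1 / 2 : ℝ)
    simpa using this
  · rw [hρ, lintegral_withDensity_eq_lintegral_mul _ hvm hgm]
    have : ∫⁻ o, ((fun o => ENNReal.ofReal (v o ^ 2)) * fun o => ENNReal.ofReal (g o ^ 2)) o ∂μ =
        eLpNorm (fun o => g o * v o) 2 μ ^ 2 := by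
      rw [eLpNorm_two_sq]
      refine lintegral_congr fun o => ?_
      rw [Pi.mul_apply, ← ENNReal.ofReal_mul (sq_nonneg _)]
      congr 1; ring
    rw [this]
    exact ENNReal.pow_ne_top hgv

/-- Only $f\sqrt c\,v$ is known to be square integrable, not $f v$. A weight `u` dominated by `c`
can be spent as $\sqrt u\sqrt u$, one factor becoming $\sqrt C$ and the other $k\sqrt c$. -/
theorem abs_mul_mul_le_sqrt {u c C k f v : ℝ} (hu : 0 ≤ u) (huc : u ≤ k ^ 2 * c) (hk : 0 ≤ k)
    (huC : u ≤ C) : |u * f * v| ≤ k * √C * |f * (√c * v)| := by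
  have h1 : u ≤ √C * (k * √c) := by
    calc u = √u * √u := (Real.mul_self_sqrt hu).symm
      _ ≤ √C * √(k ^ 2 * c) :=
        mul_le_mul (Real.sqrt_le_sqrt huC) (Real.sqrt_le_sqrt huc) (Real.sqrt_nonneg _)
          (Real.sqrt_nonneg _)
      _ = √C * (k * √c) := by rw [Real.sqrt_mul (sq_nonneg k), Real.sqrt_sq hk]
  calc |u * f * v| = u * (|f| * |v|) := by rw [abs_mul, abs_mul, abs_of_nonneg hu, mul_assoc]
    _ ≤ √C * (k * √c) * (|f| * |v|) := by gcongr
    _ = k * √C * |f * (√c * v)| := by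
      rw [abs_mul, abs_mul, abs_of_nonneg (Real.sqrt_nonneg c)]; ring

/-- Along a family of laws `a θ ^ 2 • μ` that is differentiable in quadratic mean with score `g`,
and with weights `l θ` that turn the law of `π` into a fixed measure `P`, the weighted integral of
a function `f` that is centred given `π` is differentiable, and the weights do not contribute to
the derivative. -/
theorem hasDerivAt_weighted_integral (hπ : Measurable π) {a : ℝ → Ω → ℝ}
    (ha : ∀ θ, Measurable (a θ)) (ha1 : ∀ θ, eLpNorm (a θ) 2 μ ≤ 1)
    {l : ℝ → E → ℝ} (hl : ∀ θ, Measurable (l θ)) (hl0 : ∀ θ x, 0 ≤ l θ x) {C : ℝ} (hC : 0 ≤ C)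
    (hlC : ∀ θ x, l θ x ≤ C) {P : Measure E} [IsFiniteMeasure P]
    (hP : ∀ θ, (μ.withDensity fun o => ENNReal.ofReal (l θ (π o) * a θ o ^ 2)).map π = P)
    {f : Ω → ℝ} (hf : Measurable f) {K : ℝ≥0}
    (hK : ∀ θ, eLpNorm (fun o => f o * (√(l θ (π o)) * a θ o)) 2 μ ≤ K)
    (hfi : Integrable (fun o => f o * a 0 o ^ 2) μ)
    (hf0 : ∀ h : E → ℝ, Measurable h → (∀ x, |h x| ≤ C) →
      ∫ o, h (π o) * (f o * a 0 o ^ 2) ∂μ = 0)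
    {g : Ω → ℝ} (hg : Measurable g) (hg2 : eLpNorm (fun o => g o * a 0 o) 2 μ ≠ ∞)
    (hsc : Tendsto (fun θ => eLpNorm (fun o => (a θ o - a 0 o) / θ - g o * a 0 o / 2) 2 μ)
      (𝓝[≠] 0) (𝓝 0)) :
    HasDerivAt (fun θ => ∫ o, l θ (π o) * (f o * a θ o ^ 2) ∂μ)
      (∫ o, l 0 (π o) * f o * g o * a 0 o ^ 2 ∂μ) 0 := by
  set b := a 0 with hb
  -- Truncating at a multiple of `l 0` keeps $h f b$ in $L^2$, although $l_\theta f b$ need not be.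
  set h : ℝ → E → ℝ := fun θ x => min (l θ x) (4 * l 0 x) with hh
  set B : ℝ → Set E := fun θ => {x | 4 * l 0 x < l θ x} with hB
  set d : ℝ → Ω → ℝ := fun θ o => (a θ o - b o) / θ - g o * b o / 2 with hd
  set G := eLpNorm (fun o => g o * b o) 2 μ with hG
  have hBm : ∀ θ, MeasurableSet (B θ) := fun θ => measurableSet_lt ((hl 0).const_mul 4) (hl θ)
  have hbm : Measurable b := ha 0
  have hdm : ∀ θ, Measurable (d θ) := fun θ =>
    (((ha θ).sub hbm).div_const _).sub ((hg.mul hbm).div_const _)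
  have hlπ : ∀ θ, Measurable fun o => l θ (π o) := fun θ => (hl θ).comp hπ
  have hhm : ∀ θ, Measurable (h θ) := fun θ => (hl θ).min ((hl 0).const_mul 4)
  have hhπ : ∀ θ, Measurable fun o => h θ (π o) := fun θ => (hhm θ).comp hπ
  have hh0 : ∀ θ x, 0 ≤ h θ x := fun θ x => le_min (hl0 θ x) (by linarith [hl0 0 x])
  have hhl : ∀ θ x, h θ x ≤ l θ x := fun θ x => min_le_left _ _
  have hhl0 : ∀ θ x, h θ x ≤ 4 * l 0 x := fun θ x => min_le_right _ _
  have hhC : ∀ θ x, h θ x ≤ C := fun θ x => (hhl θ x).trans (hlC θ x)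
  have hinc : ∀ θ : ℝ, θ ≠ 0 → ∀ o, a θ o - b o = θ * (d θ o + 1 / 2 * (g o * b o)) := by
    intro θ hθ o; simp only [hd]; field_simp; ring
  have hdiff : Tendsto (fun θ => eLpNorm (fun o => a θ o - b o) 2 μ) (𝓝[≠] 0) (𝓝 0) := by
    have hle : ∀ᶠ θ : ℝ in 𝓝[≠] 0, eLpNorm (fun o => a θ o - b o) 2 μ ≤
        ENNReal.ofReal |θ| * (eLpNorm (d θ) 2 μ + ENNReal.ofReal |1 / 2| * G) := by
      filter_upwards [self_mem_nhdsWithin] with θ hθ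
      rw [← eLpNorm_two_const_mul]
      calc eLpNorm (fun o => a θ o - b o) 2 μ
          = eLpNorm (fun o => θ * (d θ o + 1 / 2 * (g o * b o))) 2 μ := by
            congr 1; ext o; exact hinc θ hθ o
        _ ≤ _ := by
            rw [eLpNorm_two_const_mul]
            gcongr
            exact eLpNorm_two_add_le (hdm θ) ((hg.mul hbm).const_mul _)
    have hθ : Tendsto (fun θ : ℝ => ENNReal.ofReal |θ|) (𝓝[≠] 0) (𝓝 0) := by
      have : Tendsto (fun θ : ℝ => ENNReal.ofReal |θ|) (𝓝 0) (𝓝 (ENNReal.ofReal |0|)) :=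
        (ENNReal.continuous_ofReal.comp continuous_abs).tendsto 0
      simp only [abs_zero, ENNReal.ofReal_zero] at this
      exact this.mono_left nhdsWithin_le_nhds
    have hlim := ENNReal.Tendsto.mul hθ (Or.inr (by finiteness))
      (hsc.add (tendsto_const_nhds (x := ENNReal.ofReal |1 / 2| * G))) (Or.inr (by simp))
    rw [zero_mul] at hlim
    exact tendsto_of_tendsto_of_tendsto_of_le_of_le' tendsto_const_nhds hlim
      (Eventually.of_forall fun _ => zero_le) hle
  set y : ℝ → ℝ≥0∞ := fun θ => eLpNorm ((π ⁻¹' B θ).indicator fun o => √(l 0 (π o)) * b o) 2 μ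
    with hy
  have hy1 : ∀ θ, y θ ≤ ENNReal.ofReal 2 * eLpNorm ((π ⁻¹' B θ).indicator
      fun o => √(l 0 (π o)) * (a θ o - b o)) 2 μ := fun θ =>
    eLpNorm_indicator_highRatio_le hπ (hl θ) (hl0 θ) (hl 0) (hl0 0) (ha θ) hbm (hP θ) (hP 0)
  have hsC : ∀ x, √(l 0 x) ≤ √C := fun x => Real.sqrt_le_sqrt (hlC 0 x)
  have hind : ∀ (s : Set Ω) (u : Ω → ℝ) (o : Ω), |s.indicator u o| ≤ |u o| := by
    intro s u o
    by_cases ho : o ∈ s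
    · rw [Set.indicator_of_mem ho]
    · rw [Set.indicator_of_notMem ho]; simp
  have hyC : ∀ (s : Set Ω) (u : Ω → ℝ), eLpNorm (s.indicator fun o => √(l 0 (π o)) * u o) 2 μ ≤
      ENNReal.ofReal √C * eLpNorm u 2 μ := fun s u =>
    eLpNorm_two_le_const_mul (Real.sqrt_nonneg _) fun o => by
      refine (hind _ _ _).trans ?_
      rw [abs_mul, abs_of_nonneg (Real.sqrt_nonneg _)]
      gcongr; exact hlC _ _
  -- A bootstrap: the crude limit $y\to0$ shows that $g\sqrt{l_0}\,b$ vanishes in $L^2$ on `B θ`,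
  -- and this in turn improves the estimate to $y=o(\theta)$ in `hyw`.
  have hy0 : Tendsto y (𝓝[≠] 0) (𝓝 0) := by
    have hlim := ENNReal.Tendsto.const_mul (a := ENNReal.ofReal 2)
      (ENNReal.Tendsto.const_mul (a := ENNReal.ofReal √C) hdiff (Or.inr (by finiteness)))
      (Or.inr (by finiteness))
    rw [mul_zero, mul_zero] at hlim
    refine tendsto_of_tendsto_of_tendsto_of_le_of_le tendsto_const_nhds hlim
      (fun _ => zero_le) fun θ => (hy1 θ).trans ?_
    gcongr
    exact hyC _ _
  have hsm : Measurable fun o => √(l 0 (π o)) * b o := (hlπ 0).sqrt.mul hbm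
  set z : ℝ → ℝ≥0∞ := fun θ =>
    eLpNorm ((π ⁻¹' B θ).indicator fun o => g o * (√(l 0 (π o)) * b o)) 2 μ with hz
  have hz0 : Tendsto z (𝓝[≠] 0) (𝓝 0) := by
    refine tendsto_eLpNorm_indicator_mul hsm hg ?_ (fun θ => hπ (hBm θ)) hy0
    refine ne_top_of_le_ne_top (b := ENNReal.ofReal √C * G) (by finiteness) ?_
    refine eLpNorm_two_le_const_mul (Real.sqrt_nonneg _) fun o => ?_
    rw [show g o * (√(l 0 (π o)) * b o) = √(l 0 (π o)) * (g o * b o) by ring, abs_mul,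
      abs_of_nonneg (Real.sqrt_nonneg _)]
    gcongr; exact hlC _ _
  set w : ℝ → ℝ≥0∞ := fun θ =>
    ENNReal.ofReal 2 * (ENNReal.ofReal √C * eLpNorm (d θ) 2 μ + z θ) with hw
  have hw0 : Tendsto w (𝓝[≠] 0) (𝓝 0) := by
    have hlim := ENNReal.Tendsto.const_mul (a := ENNReal.ofReal 2)
      ((ENNReal.Tendsto.const_mul (a := ENNReal.ofReal √C) hsc (Or.inr (by finiteness))).add hz0)
      (Or.inr (by finiteness))
    simpa [hw, hd] using hlim
  have hyw : ∀ θ : ℝ, θ ≠ 0 → y θ ≤ ENNReal.ofReal |θ| * w θ := by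
    intro θ hθ
    refine (hy1 θ).trans ?_
    rw [hw, mul_left_comm]
    gcongr
    calc eLpNorm ((π ⁻¹' B θ).indicator fun o => √(l 0 (π o)) * (a θ o - b o)) 2 μ
        = eLpNorm (fun o => θ * ((π ⁻¹' B θ).indicator (fun o => √(l 0 (π o)) * d θ o) o +
            1 / 2 * (π ⁻¹' B θ).indicator (fun o => g o * (√(l 0 (π o)) * b o)) o)) 2 μ := by
          congr 1; ext o
          by_cases ho : o ∈ π ⁻¹' B θ
          · simp only [Set.indicator_of_mem ho]; rw [hinc θ hθ]; ring
          · simp only [Set.indicator_of_notMem ho]; ring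
      _ ≤ ENNReal.ofReal |θ| * (ENNReal.ofReal √C * eLpNorm (d θ) 2 μ + z θ) := by
          rw [eLpNorm_two_const_mul]
          gcongr
          refine (eLpNorm_two_add_le (((hlπ 0).sqrt.mul (hdm θ)).indicator (hπ (hBm θ)))
            (((hg.mul hsm).indicator (hπ (hBm θ))).const_mul _)).trans ?_
          refine add_le_add (hyC _ _) ?_
          rw [eLpNorm_two_const_mul]
          refine mul_le_of_le_one_left' ?_
          rw [ENNReal.ofReal_le_one]; norm_num
  have hya : ∀ θ, eLpNorm ((π ⁻¹' B θ).indicator fun o => √(l θ (π o)) * a θ o) 2 μ = y θ := by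
    intro θ
    refine (ENNReal.pow_right_strictMono (two_ne_zero)).injective ?_
    simp only [hy]
    rw [eLpNorm_indicator_sqrt_mul_sq hπ (hl0 θ) (hP θ) (hBm θ),
      eLpNorm_indicator_sqrt_mul_sq hπ (hl0 0) (hP 0) (hBm θ)]
  -- the square-root weighted functions
  set k := ENNReal.ofReal √C * K with hk
  have hkfin : k ≠ ∞ := by finiteness
  have hUa : ∀ θ, eLpNorm (fun o => h θ (π o) * f o * a θ o) 2 μ ≤ k := fun θ => by
    refine (eLpNorm_two_le_const_mul (Real.sqrt_nonneg C)
      (v := fun o => f o * (√(l θ (π o)) * a θ o)) fun o => ?_).trans (mul_le_mul_right (hK θ) _)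
    simpa using abs_mul_mul_le_sqrt (c := l θ (π o)) (k := 1) (f := f o) (v := a θ o)
      (hh0 θ _) (by simpa using hhl θ _) zero_le_one (hhC θ _)
  have hUb : ∀ θ, eLpNorm (fun o => h θ (π o) * f o * b o) 2 μ ≤ ENNReal.ofReal 2 * k := fun θ => by
    rw [hk, ← mul_assoc, ← ENNReal.ofReal_mul (by norm_num)]
    refine (eLpNorm_two_le_const_mul (c := 2 * √C) (by positivity)
      (v := fun o => f o * (√(l 0 (π o)) * b o)) fun o => ?_).trans (by gcongr; exact hK 0)
    exact abs_mul_mul_le_sqrt (hh0 θ _) (by linarith [hhl0 θ (π o)]) (by norm_num) (hhC θ _)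
  have hUl : eLpNorm (fun o => l 0 (π o) * f o * b o) 2 μ ≤ k := by
    refine (eLpNorm_two_le_const_mul (Real.sqrt_nonneg C)
      (v := fun o => f o * (√(l 0 (π o)) * b o)) fun o => ?_).trans (mul_le_mul_right (hK 0) _)
    simpa using abs_mul_mul_le_sqrt (c := l 0 (π o)) (k := 1) (f := f o) (v := b o)
      (hl0 0 _) (by simp) zero_le_one (hlC 0 _)
  have hUam : ∀ θ, Measurable fun o => h θ (π o) * f o * a θ o := fun θ =>
    ((hhπ θ).mul hf).mul (ha θ)
  have hUbm : ∀ θ, Measurable fun o => h θ (π o) * f o * b o := fun θ => ((hhπ θ).mul hf).mul hbm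
  have hUlm : Measurable fun o => l 0 (π o) * f o * b o := ((hlπ 0).mul hf).mul hbm
  have hU : ∀ θ, eLpNorm (fun o => h θ (π o) * f o * a θ o + h θ (π o) * f o * b o) 2 μ ≤
      k + ENNReal.ofReal 2 * k := fun θ =>
    (eLpNorm_two_add_le (hUam θ) (hUbm θ)).trans (add_le_add (hUa θ) (hUb θ))
  -- The error in replacing $h(a+b)$ by its limit $2l_0b$. It tends to zero in $L^2$, but $f r$ is
  -- only bounded there, so its pairing with $gb/2$ is handled by weak convergence.
  set r : ℝ → Ω → ℝ := fun θ o => h θ (π o) * (a θ o + b o) - 2 * l 0 (π o) * b o with hr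
  have hrm : ∀ θ, Measurable (r θ) := fun θ =>
    ((hhπ θ).mul ((ha θ).add hbm)).sub (((hlπ 0).const_mul 2).mul hbm)
  have hfr : ∀ θ, eLpNorm (fun o => f o * r θ o) 2 μ ≤
      ((k + ENNReal.ofReal 2 * k + ENNReal.ofReal 2 * k).toNNReal : ℝ≥0∞) := by
    intro θ
    rw [ENNReal.coe_toNNReal (by finiteness)]
    calc eLpNorm (fun o => f o * r θ o) 2 μ
        = eLpNorm (fun o => (h θ (π o) * f o * a θ o + h θ (π o) * f o * b o) +
            (-2) * (l 0 (π o) * f o * b o)) 2 μ := by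
          congr 1; ext o; simp only [hr]; ring
      _ ≤ _ := by
          refine (eLpNorm_two_add_le ((hUam θ).add (hUbm θ)) (hUlm.const_mul _)).trans
            (add_le_add (hU θ) ?_)
          rw [eLpNorm_two_const_mul]
          simp only [abs_neg, Nat.abs_ofNat]
          gcongr
  have hml0 : Tendsto (fun θ => eLpNorm (fun o => (h θ (π o) - l 0 (π o)) * b o) 2 μ)
      (𝓝[≠] 0) (𝓝 0) := by
    have h1 : Tendsto (fun θ => ENNReal.ofReal C * (ENNReal.ofReal C * 2 *
        eLpNorm (fun o => a θ o - b o) 2 μ)) (𝓝[≠] 0) (𝓝 0) := by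
      have := ENNReal.Tendsto.const_mul (a := ENNReal.ofReal C) (ENNReal.Tendsto.const_mul
        (a := ENNReal.ofReal C * 2) hdiff (Or.inr (by finiteness))) (Or.inr (by finiteness))
      simpa using this
    have h2 := tendsto_of_tendsto_of_tendsto_of_le_of_le tendsto_const_nhds h1
      (fun _ => zero_le) fun θ => eLpNorm_min_sub_mul_sq_le hπ (hl θ) (hl0 θ) (hlC θ) (hl 0)
        (hl0 0) (hlC 0) hC (ha θ) hbm (ha1 θ) (ha1 0) (hP θ) (hP 0)
    have h3 := h2.ennrpow_const (1 / 2 : ℝ)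
    simp only [← ENNReal.rpow_natCast, ← ENNReal.rpow_mul] at h3
    simpa using h3
  have hr0 : Tendsto (fun θ => eLpNorm (r θ) 2 μ) (𝓝[≠] 0) (𝓝 0) := by
    have hlim := (ENNReal.Tendsto.const_mul (a := ENNReal.ofReal C) hdiff
      (Or.inr (by finiteness))).add (ENNReal.Tendsto.const_mul (a := ENNReal.ofReal |2|) hml0
      (Or.inr (by finiteness)))
    rw [mul_zero, mul_zero, add_zero] at hlim
    refine tendsto_of_tendsto_of_tendsto_of_le_of_le tendsto_const_nhds hlim
      (fun _ => zero_le) fun θ => ?_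
    have e : r θ = fun o => h θ (π o) * (a θ o - b o) + 2 * ((h θ (π o) - l 0 (π o)) * b o) := by
      ext o; simp only [hr]; ring
    rw [e]
    refine (eLpNorm_two_add_le ((hhπ θ).mul ((ha θ).sub hbm))
      ((((hhπ θ).sub (hlπ 0)).mul hbm).const_mul 2)).trans ?_
    rw [eLpNorm_two_const_mul]
    refine add_le_add ?_ le_rfl
    refine eLpNorm_two_le_const_mul hC fun o => ?_
    change |h θ (π o) * (a θ o - b o)| ≤ _
    rw [abs_mul, abs_of_nonneg (hh0 θ _)]
    gcongr
    exact hhC θ _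
  have hA2 := tendsto_enorm_integral_mul_mul hf (((hg.mul hbm).const_mul (1 / 2))) hrm
    (k := fun o => 1 / 2 * (g o * b o))
    (by rw [eLpNorm_two_const_mul]; finiteness) hfr hr0
  -- the remainder on the set of large ratios
  set v : ℝ → Ω → ℝ := fun θ o => (l θ (π o) - h θ (π o)) / √(l θ (π o)) * a θ o with hv
  have hvm : ∀ θ, Measurable (v θ) := fun θ =>
    (((hlπ θ).sub (hhπ θ)).div (hlπ θ).sqrt).mul (ha θ)
  have hvy : ∀ θ, eLpNorm (v θ) 2 μ ≤ y θ := by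
    intro θ
    rw [← hya θ]
    refine eLpNorm_two_mono fun o => ?_
    by_cases ho : o ∈ π ⁻¹' B θ
    · rw [Set.indicator_of_mem ho]
      simp only [hv, abs_mul]
      refine mul_le_mul_of_nonneg_right ?_ (abs_nonneg _)
      rw [abs_of_nonneg (div_nonneg (by linarith [hhl θ (π o)]) (Real.sqrt_nonneg _)),
        abs_of_nonneg (Real.sqrt_nonneg _)]
      calc (l θ (π o) - h θ (π o)) / √(l θ (π o)) ≤ l θ (π o) / √(l θ (π o)) := by
            gcongr; linarith [hh0 θ (π o)]
        _ = √(l θ (π o)) := Real.div_sqrt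
    · have : h θ (π o) = l θ (π o) := min_eq_left (not_lt.1 ho)
      rw [Set.indicator_of_notMem ho]
      simp [hv, this]
  have huv : ∀ θ o, f o * (√(l θ (π o)) * a θ o) * v θ o =
      (l θ (π o) - h θ (π o)) * (f o * a θ o ^ 2) := by
    intro θ o
    simp only [hv]
    rcases (hl0 θ (π o)).eq_or_lt with h0 | h0
    · have : h θ (π o) = 0 := le_antisymm ((hhl θ _).trans h0.symm.le) (hh0 θ _)
      rw [this, ← h0]; simp
    · have : √(l θ (π o)) ≠ 0 := (Real.sqrt_pos.2 h0).ne'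
      field_simp
  have hum : ∀ θ, Measurable fun o => f o * (√(l θ (π o)) * a θ o) := fun θ =>
    hf.mul ((hlπ θ).sqrt.mul (ha θ))
  have hufin : ∀ θ, eLpNorm (fun o => f o * (√(l θ (π o)) * a θ o)) 2 μ ≠ ∞ := fun θ =>
    ((hK θ).trans_lt ENNReal.coe_lt_top).ne
  have hyfin : ∀ θ, y θ ≠ ∞ := fun θ =>
    ne_top_of_le_ne_top (b := ENNReal.ofReal √C * 1) (by finiteness)
      ((hyC _ _).trans (by gcongr; exact ha1 0))
  have hF0 : ∫ o, l 0 (π o) * (f o * b o ^ 2) ∂μ = 0 :=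
    hf0 (l 0) (hl 0) fun x => by rw [abs_of_nonneg (hl0 0 x)]; exact hlC 0 x
  have hhi : ∀ θ, Integrable (fun o => h θ (π o) * (f o * b o ^ 2)) μ := fun θ =>
    hfi.bdd_mul (c := C) (hhπ θ).aestronglyMeasurable (ae_of_all _ fun o => by
      rw [Real.norm_eq_abs, abs_of_nonneg (hh0 θ _)]; exact hhC θ _)
  -- This is where the weights drop out: the base integral vanishes for every bounded weight in the
  -- covariates, so $l_0$ may be replaced by $h_\theta$ in it at no cost.
  have hhz : ∀ θ, ∫ o, h θ (π o) * (f o * b o ^ 2) ∂μ = 0 := fun θ =>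
    hf0 (h θ) (hhm θ) fun x => by rw [abs_of_nonneg (hh0 θ x)]; exact hhC θ x
  have hLi : Integrable (fun o => l 0 (π o) * f o * g o * b o ^ 2) μ := by
    refine (integrable_mul_of_eLpNorm_two hUlm (hg.mul hbm)
      (ne_top_of_le_ne_top hkfin hUl) hg2).congr (ae_of_all _ fun o => ?_)
    simp only [Pi.mul_apply]; ring
  have hFi : ∀ θ, Integrable (fun o => l θ (π o) * (f o * a θ o ^ 2)) μ := fun θ => by
    have hs : Measurable fun o => √(l θ (π o)) * a θ o := (hlπ θ).sqrt.mul (ha θ)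
    have hs2 : eLpNorm (fun o => √(l θ (π o)) * a θ o) 2 μ ≠ ∞ := by
      refine ne_top_of_le_ne_top (b := ENNReal.ofReal √C * 1) (by finiteness)
        ((eLpNorm_two_le_const_mul (Real.sqrt_nonneg _) (v := a θ) fun o => ?_).trans
          (by gcongr; exact ha1 θ))
      rw [abs_mul, abs_of_nonneg (Real.sqrt_nonneg _)]
      gcongr; exact hlC _ _
    refine (integrable_mul_of_eLpNorm_two (hum θ) hs (hufin θ) hs2).congr (ae_of_all _ fun o => ?_)
    have := Real.mul_self_sqrt (hl0 θ (π o))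
    simp only
    calc _ = (√(l θ (π o)) * √(l θ (π o))) * (f o * a θ o ^ 2) := by ring
      _ = _ := by rw [this]
  have hdfin : ∀ᶠ θ in 𝓝[≠] (0 : ℝ), eLpNorm (d θ) 2 μ < ∞ :=
    hsc.eventually (gt_mem_nhds ENNReal.zero_lt_top)
  rw [hasDerivAt_iff_tendsto_slope_zero, tendsto_iff_edist_tendsto_0]
  simp only [zero_add, edist_eq_enorm_sub, smul_eq_mul]
  have hmain : ∀ᶠ θ in 𝓝[≠] (0 : ℝ),
      ‖θ⁻¹ * (∫ o, l θ (π o) * (f o * a θ o ^ 2) ∂μ - ∫ o, l 0 (π o) * (f o * b o ^ 2) ∂μ) -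
        ∫ o, l 0 (π o) * f o * g o * b o ^ 2 ∂μ‖ₑ ≤
      (k + ENNReal.ofReal 2 * k) * eLpNorm (d θ) 2 μ +
        ‖∫ o, f o * r θ o * (1 / 2 * (g o * b o)) ∂μ‖ₑ + K * w θ := by
    filter_upwards [self_mem_nhdsWithin, hdfin] with θ hθ hdθ
    have hθ' : θ ≠ 0 := hθ
    have i1 := integrable_mul_of_eLpNorm_two ((hUam θ).add (hUbm θ)) (hdm θ)
      (ne_top_of_le_ne_top (by finiteness) (hU θ)) hdθ.ne
    have i2 := integrable_mul_of_eLpNorm_two (hf.mul (hrm θ)) ((hg.mul hbm).const_mul (1 / 2))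
      (ne_top_of_le_ne_top ENNReal.coe_ne_top (hfr θ)) (by rw [eLpNorm_two_const_mul]; finiteness)
    have i3 := integrable_mul_of_eLpNorm_two (hum θ) (hvm θ) (hufin θ)
      (ne_top_of_le_ne_top (hyfin θ) (hvy θ))
    -- Uses $l a^2-h b^2=h(a+b)(a-b)+(l-h)a^2$ and $a-b=\theta(d+gb/2)$. The three terms are the
    -- error of quadratic mean differentiability, the error of the limiting factor, and the part on
    -- large ratios.
    have hdecomp : θ⁻¹ * (∫ o, l θ (π o) * (f o * a θ o ^ 2) ∂μ -
          ∫ o, l 0 (π o) * (f o * b o ^ 2) ∂μ) - ∫ o, l 0 (π o) * f o * g o * b o ^ 2 ∂μ =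
        ∫ o, (h θ (π o) * f o * a θ o + h θ (π o) * f o * b o) * d θ o ∂μ +
          ∫ o, f o * r θ o * (1 / 2 * (g o * b o)) ∂μ +
          θ⁻¹ * ∫ o, f o * (√(l θ (π o)) * a θ o) * v θ o ∂μ := by
      have e : ∫ o, l θ (π o) * (f o * a θ o ^ 2) ∂μ - ∫ o, l 0 (π o) * (f o * b o ^ 2) ∂μ =
          ∫ o, (l θ (π o) * (f o * a θ o ^ 2) - h θ (π o) * (f o * b o ^ 2)) ∂μ := by
        rw [hF0, integral_sub (hFi θ) (hhi θ), hhz θ]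
      rw [e, ← integral_const_mul,
        ← integral_sub (by exact ((hFi θ).sub (hhi θ)).const_mul _) hLi, ← integral_const_mul,
        ← integral_add (by exact i1) (by exact i2),
        ← integral_add (by exact i1.add i2) (i3.const_mul _)]
      refine integral_congr_ae (ae_of_all _ fun o => ?_)
      simp only
      rw [huv]
      simp only [hd, hr]
      field_simp
      ring
    rw [hdecomp]
    refine (enorm_add_le _ _).trans (add_le_add ((enorm_add_le _ _).trans
      (add_le_add ?_ le_rfl)) ?_)
    · refine (enorm_integral_mul_le ((hUam θ).add (hUbm θ)) (hdm θ)).trans ?_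
      gcongr
      exact hU θ
    · rw [enorm_mul]
      have h1 : ‖∫ o, f o * (√(l θ (π o)) * a θ o) * v θ o ∂μ‖ₑ ≤ K * (ENNReal.ofReal |θ| * w θ) :=
        (enorm_integral_mul_le (hum θ) (hvm θ)).trans
          (mul_le_mul' (hK θ) ((hvy θ).trans (hyw θ hθ')))
      refine (mul_le_mul_right h1 _).trans ?_
      rw [Real.enorm_eq_ofReal_abs, mul_left_comm, ← mul_assoc (ENNReal.ofReal _),
        ← ENNReal.ofReal_mul (abs_nonneg _), abs_inv, inv_mul_cancel₀ (abs_ne_zero.2 hθ')]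
      simp
  have hlim : Tendsto (fun θ => (k + ENNReal.ofReal 2 * k) * eLpNorm (d θ) 2 μ +
      ‖∫ o, f o * r θ o * (1 / 2 * (g o * b o)) ∂μ‖ₑ + K * w θ) (𝓝[≠] 0) (𝓝 0) := by
    have := ((ENNReal.Tendsto.const_mul (a := k + ENNReal.ofReal 2 * k) hsc
      (Or.inr (by finiteness))).add hA2).add
      (ENNReal.Tendsto.const_mul (a := (K : ℝ≥0∞)) hw0 (Or.inr (by finiteness)))
    simpa using this
  exact tendsto_of_tendsto_of_tendsto_of_le_of_le' tendsto_const_nhds hlim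
    (Eventually.of_forall fun _ => zero_le) hmain

end WeightedDerivative

/-! ### Conditional laws and conditional independence through kernels. -/

section ConditionalLaw

variable {Ω γ β : Type*} [MeasurableSpace Ω] [MeasurableSpace γ] [MeasurableSpace β]

/-- Under `ν`, the kernel `κ` is a conditional law of `V` given `k`. -/
def HasCondLaw (ν : Measure Ω) (k : Ω → γ) (V : Ω → β) (κ : Kernel γ β) : Prop :=
  ∀ F : γ × β → ℝ≥0∞, Measurable F →
    ∫⁻ ω, F (k ω, V ω) ∂ν = ∫⁻ ω, ∫⁻ v, F (k ω, v) ∂κ (k ω) ∂ν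

theorem hasCondLaw_iff_map_eq {ν : Measure Ω} [SFinite ν] {k : Ω → γ} {V : Ω → β}
    {κ : Kernel γ β} [IsSFiniteKernel κ] (hk : Measurable k) (hV : Measurable V) :
    HasCondLaw ν k V κ ↔ ν.map (fun ω => (k ω, V ω)) = ν.map k ⊗ₘ κ := by
  have h1 : ∀ F : γ × β → ℝ≥0∞, Measurable F →
      ∫⁻ z, F z ∂(ν.map fun ω => (k ω, V ω)) = ∫⁻ ω, F (k ω, V ω) ∂ν := fun F hF =>
    lintegral_map hF (hk.prodMk hV)
  have h2 : ∀ F : γ × β → ℝ≥0∞, Measurable F →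
      ∫⁻ z, F z ∂(ν.map k ⊗ₘ κ) = ∫⁻ ω, ∫⁻ v, F (k ω, v) ∂κ (k ω) ∂ν := fun F hF => by
    rw [Measure.lintegral_compProd hF, lintegral_map (by fun_prop) hk]
  constructor
  · intro h
    refine Measure.ext_of_lintegral _ fun F hF => ?_
    rw [h1 F hF, h2 F hF, h F hF]
  · intro h F hF
    rw [← h1 F hF, ← h2 F hF, h]

theorem hasCondLaw_condDistrib {ν : Measure Ω} [IsFiniteMeasure ν] [StandardBorelSpace β]
    [Nonempty β] {k : Ω → γ} {V : Ω → β} (hk : Measurable k) (hV : Measurable V) :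
    HasCondLaw ν k V (condDistrib V k ν) :=
  (hasCondLaw_iff_map_eq hk hV).2 (compProd_map_condDistrib hV.aemeasurable).symm

theorem HasCondLaw.smul {ν : Measure Ω} {k : Ω → γ} {V : Ω → β} {κ : Kernel γ β}
    (h : HasCondLaw ν k V κ) (c : ℝ≥0∞) : HasCondLaw (c • ν) k V κ := fun F hF => by
  rw [lintegral_smul_measure, lintegral_smul_measure, h F hF]

/-- Insensitivity to scaling is what makes the mixing probability of the labels immaterial. -/
theorem hasCondLaw_smul_iff {ν : Measure Ω} {k : Ω → γ} {V : Ω → β} {κ : Kernel γ β} {c : ℝ≥0∞}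
    (hc0 : c ≠ 0) (hc : c ≠ ∞) : HasCondLaw (c • ν) k V κ ↔ HasCondLaw ν k V κ := by
  refine ⟨fun h => ?_, fun h => h.smul c⟩
  have := h.smul c⁻¹
  rwa [smul_smul, ENNReal.inv_mul_cancel hc0 hc, one_smul] at this

theorem hasCondLaw_zero (k : Ω → γ) (V : Ω → β) (κ : Kernel γ β) :
    HasCondLaw (0 : Measure Ω) k V κ := fun F _ => by simp

variable [StandardBorelSpace Ω] [StandardBorelSpace β] [Nonempty β]

theorem hasCondLaw_of_condIndepFun {β' : Type*} [MeasurableSpace β'] [StandardBorelSpace β']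
    [Nonempty β'] {m : Measure Ω} [IsFiniteMeasure m] {k : Ω → γ} {U : Ω → β'} {V : Ω → β}
    (hk : Measurable k) (hU : Measurable U) (hV : Measurable V)
    (h : CondIndepFun (MeasurableSpace.comap k inferInstance) hk.comap_le U V m) :
    HasCondLaw m (fun ω => (k ω, U ω)) V ((condDistrib V k m).prodMkRight β') := by
  rw [condIndepFun_iff_condDistrib_prod_ae_eq_prodMkRight hV hU hk,
    condDistrib_ae_eq_iff_measure_eq_compProd _ hV.aemeasurable] at h
  exact (hasCondLaw_iff_map_eq (hk.prodMk hU) hV).2 h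

/-- Testing with functions that ignore `U` shows that `κ` is also a conditional law of `V` given `k`
alone; almost sure uniqueness of conditional laws then identifies the two. -/
theorem condIndepFun_of_hasCondLaw {β' : Type*} [MeasurableSpace β'] [StandardBorelSpace β']
    [Nonempty β'] {m : Measure Ω} [IsFiniteMeasure m] {k : Ω → γ} {U : Ω → β'} {V : Ω → β}
    (hk : Measurable k) (hU : Measurable U) (hV : Measurable V) {κ : Kernel γ β}
    [IsMarkovKernel κ] (h : HasCondLaw m (fun ω => (k ω, U ω)) V (κ.prodMkRight β')) :
    CondIndepFun (MeasurableSpace.comap k inferInstance) hk.comap_le U V m := by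
  have h1 : HasCondLaw m k V κ := fun F hF =>
    h (fun z => F (z.1.1, z.2)) (by fun_prop)
  have h2 : condDistrib V k m =ᵐ[m.map k] κ :=
    condDistrib_ae_eq_of_measure_eq_compProd k hV.aemeasurable
      ((hasCondLaw_iff_map_eq hk hV).1 h1)
  rw [condIndepFun_iff_condDistrib_prod_ae_eq_prodMkRight hV hU hk]
  have h3 := condDistrib_ae_eq_of_measure_eq_compProd (fun ω => (k ω, U ω)) hV.aemeasurable
    ((hasCondLaw_iff_map_eq (hk.prodMk hU) hV).1 h)
  have h4 : ∀ᵐ z ∂m.map (fun ω => (k ω, U ω)), condDistrib V k m z.1 = κ z.1 := by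
    refine (Measure.QuasiMeasurePreserving.ae
      (f := Prod.fst) ⟨measurable_fst, ?_⟩ h2 :)
    rw [Measure.map_map measurable_fst (hk.prodMk hU)]
    exact Measure.AbsolutelyContinuous.rfl
  filter_upwards [h3, h4] with z hz3 hz4
  rw [hz3, Kernel.prodMkRight_apply, Kernel.prodMkRight_apply, hz4]

theorem lintegral_bool_split {Ω : Type*} [MeasurableSpace Ω] (m : Measure Ω) {R : Ω → Bool}
    (hR : Measurable R) (G : Ω → ℝ≥0∞) :
    ∫⁻ ω, G ω ∂m = ∫⁻ ω in R ⁻¹' {true}, G ω ∂m + ∫⁻ ω in R ⁻¹' {false}, G ω ∂m := by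
  rw [← lintegral_add_compl G (hR (measurableSet_singleton true))]
  congr 3
  ext ω; simp

/-- A binary variable is conditionally independent of `V` given `k` iff both of its values share a
conditional law of `V` given `k`. -/
theorem condIndepFun_bool_iff {m : Measure Ω} [IsFiniteMeasure m] {k : Ω → γ} {R : Ω → Bool}
    {V : Ω → β} (hk : Measurable k) (hR : Measurable R) (hV : Measurable V) {c : Bool → ℝ≥0∞}
    {ν : Bool → Measure Ω} (hν : ∀ ℓ, m.restrict (R ⁻¹' {ℓ}) = c ℓ • ν ℓ)
    (hc : ∀ ℓ, (c ℓ ≠ 0 ∧ c ℓ ≠ ∞) ∨ ν ℓ = 0) :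
    CondIndepFun (MeasurableSpace.comap k inferInstance) hk.comap_le R V m ↔
      ∃ κ : Kernel γ β, IsMarkovKernel κ ∧ ∀ ℓ, HasCondLaw (ν ℓ) k V κ := by
  have key : ∀ κ : Kernel γ β, (∀ ℓ, HasCondLaw (ν ℓ) k V κ) ↔
      ∀ ℓ, HasCondLaw (m.restrict (R ⁻¹' {ℓ})) k V κ := by
    refine fun κ => forall_congr' fun ℓ => ?_
    rw [hν]
    rcases hc ℓ with h | h
    · rw [hasCondLaw_smul_iff h.1 h.2]
    · simp [h, hasCondLaw_zero]
  constructor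
  · intro h
    refine ⟨condDistrib V k m, inferInstance, (key _).2 fun ℓ F hF => ?_⟩
    -- An indicator of `R = ℓ` in the test function localises the common conditional law to one
    -- label.
    have h1 := hasCondLaw_of_condIndepFun hk hR hV h
      (fun z => (Prod.snd ⁻¹' {ℓ} : Set (γ × Bool)).indicator 1 z.1 * F (z.1.1, z.2))
      (((measurable_one.indicator (measurable_snd (measurableSet_singleton ℓ))).comp
        measurable_fst).mul (by fun_prop))
    rw [← lintegral_indicator (hR (measurableSet_singleton ℓ)),
      ← lintegral_indicator (hR (measurableSet_singleton ℓ))]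
    refine Eq.trans (lintegral_congr fun ω => ?_) (h1.trans (lintegral_congr fun ω => ?_))
    · by_cases hω : R ω = ℓ <;> simp [Set.indicator, hω]
    · by_cases hω : R ω = ℓ <;> simp [Set.indicator, hω]
  · rintro ⟨κ, hκ, h⟩
    rw [key] at h
    refine condIndepFun_of_hasCondLaw hk hR hV (κ := κ) fun F hF => ?_
    rw [lintegral_bool_split m hR, lintegral_bool_split m hR]
    have h1 : ∀ ℓ, ∫⁻ ω in R ⁻¹' {ℓ}, F ((k ω, R ω), V ω) ∂m = ∫⁻ ω in R ⁻¹' {ℓ},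
        ∫⁻ v, F ((k ω, R ω), v) ∂(κ.prodMkRight Bool) (k ω, R ω) ∂m := by
      intro ℓ
      have h2 := h ℓ (fun z => F ((z.1, ℓ), z.2)) (by fun_prop)
      refine Eq.trans (setLIntegral_congr_fun (hR (measurableSet_singleton ℓ)) fun ω hω => ?_)
        (h2.trans (setLIntegral_congr_fun (hR (measurableSet_singleton ℓ)) fun ω hω => ?_))
      · have : R ω = ℓ := hω
        simp only [this]
      · have : R ω = ℓ := hω
        simp only [this, Kernel.prodMkRight_apply]
    rw [h1, h1]

end ConditionalLaw

/-! ### The two labels and their mixtures. -/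

namespace Population

variable {𝒳 𝒮 : Type*} [MeasurableSpace 𝒳] [MeasurableSpace 𝒮]

/-- The weights of the two labels. -/
noncomputable def weight (ρ : unitInterval) (ℓ : Bool) : ℝ≥0∞ :=
  if ℓ then (unitInterval.toNNReal ρ : ℝ≥0∞) else unitInterval.toNNReal (unitInterval.symm ρ)

theorem mix_eq (p : Population 𝒳 𝒮) (ρ : unitInterval) :
    p.mix ρ = weight ρ true • p.given true + weight ρ false • p.given false := rfl

theorem weight_ne_top (ρ : unitInterval) (ℓ : Bool) : weight ρ ℓ ≠ ∞ := by
  cases ℓ <;> simp [weight]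

theorem weight_ne_zero {ρ : unitInterval} (h0 : 0 < ρ) (h1 : ρ < 1) (ℓ : Bool) :
    weight ρ ℓ ≠ 0 := by
  cases ℓ
  · have : unitInterval.toNNReal (unitInterval.symm ρ) ≠ 0 := by
      intro h
      have h' : (1 : ℝ) - ρ = 0 := by simpa using congrArg NNReal.toReal h
      have : (ρ : ℝ) < 1 := h1
      linarith
    simpa [weight] using this
  · have : unitInterval.toNNReal ρ ≠ 0 := by
      intro h
      have h' : (ρ : ℝ) = 0 := by simpa using congrArg NNReal.toReal h
      have : (0 : ℝ) < ρ := h0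
      linarith
    simpa [weight] using this

theorem given_label_ae (p : Population 𝒳 𝒮) (ℓ : Bool) : ∀ᵐ w ∂p.given ℓ, R w = ℓ := by
  have : p.given ℓ = (p.law ℓ : Measure (Unlabelled 𝒳 𝒮)).map fun u => (u, ℓ) := by
    rw [given, Measure.prod_dirac]
  rw [this]
  exact (ae_map_iff (by fun_prop) (measurable_R (measurableSet_singleton ℓ))).2
    (ae_of_all _ fun _ => rfl)

theorem given_restrict_label (p : Population 𝒳 𝒮) (ℓ : Bool) :
    (p.given ℓ).restrict (R ⁻¹' {ℓ}) = p.given ℓ :=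
  Measure.restrict_eq_self_of_ae_mem (p.given_label_ae ℓ)

theorem given_restrict_label_of_ne (p : Population 𝒳 𝒮) {ℓ ℓ' : Bool} (h : ℓ ≠ ℓ') :
    (p.given ℓ).restrict (R ⁻¹' {ℓ'}) = 0 := by
  rw [Measure.restrict_eq_zero]
  refine measure_mono_null ?_ (ae_iff.1 (p.given_label_ae ℓ))
  intro w hw
  have : R w = ℓ' := hw
  simpa [this] using h.symm

theorem mix_restrict_label (p : Population 𝒳 𝒮) (ρ : unitInterval) (ℓ : Bool) :
    (p.mix ρ).restrict (R ⁻¹' {ℓ}) = weight ρ ℓ • p.given ℓ := by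
  rw [mix_eq, Measure.restrict_add, Measure.restrict_smul, Measure.restrict_smul]
  cases ℓ
  · rw [given_restrict_label, given_restrict_label_of_ne p (by simp)]; simp
  · rw [given_restrict_label, given_restrict_label_of_ne p (by simp)]; simp

variable [StandardBorelSpace 𝒳] [StandardBorelSpace 𝒮] {γ β : Type*} [MeasurableSpace γ]
  [MeasurableSpace β] [StandardBorelSpace β] [Nonempty β]

/-- The right side does not mention `ρ`: independence of the label means that a single kernel serves
both labels. -/
theorem condIndepFun_label_mix_iff (p : Population 𝒳 𝒮) {ρ : unitInterval} (h0 : 0 < ρ)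
    (h1 : ρ < 1) {k : Full 𝒳 𝒮 → γ} {V : Full 𝒳 𝒮 → β} (hk : Measurable k) (hV : Measurable V) :
    CondIndepFun (MeasurableSpace.comap k inferInstance) hk.comap_le R V (p.mix ρ) ↔
      ∃ κ : Kernel γ β, IsMarkovKernel κ ∧ ∀ ℓ, HasCondLaw (p.given ℓ) k V κ :=
  condIndepFun_bool_iff hk measurable_R hV (mix_restrict_label p ρ)
    fun ℓ => Or.inl ⟨weight_ne_zero h0 h1 ℓ, weight_ne_top ρ ℓ⟩

theorem condIndepFun_label_cond_iff (p : Population 𝒳 𝒮) {ρ : unitInterval} (h0 : 0 < ρ)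
    (h1 : ρ < 1) {k : Full 𝒳 𝒮 → γ} {V : Full 𝒳 𝒮 → β} (hk : Measurable k) (hV : Measurable V)
    (s : Set (Full 𝒳 𝒮)) :
    CondIndepFun (MeasurableSpace.comap k inferInstance) hk.comap_le R V (cond (p.mix ρ) s) ↔
      ∃ κ : Kernel γ β, IsMarkovKernel κ ∧ ∀ ℓ, HasCondLaw ((p.given ℓ).restrict s) k V κ := by
  refine condIndepFun_bool_iff hk measurable_R hV
    (c := fun ℓ => (p.mix ρ s)⁻¹ * weight ρ ℓ) (fun ℓ => ?_) fun ℓ => ?_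
  · rw [ProbabilityTheory.cond, Measure.restrict_smul,
      Measure.restrict_comm (measurable_R (measurableSet_singleton ℓ)), mix_restrict_label,
      Measure.restrict_smul, smul_smul]
  -- If the conditioning event is null in the mixture it is null under both labels, because both
  -- weights are positive; the restricted laws are then zero.
  · by_cases hm : p.mix ρ s = 0
    · right
      rw [Measure.restrict_eq_zero]
      rw [mix_eq] at hm
      have ht := weight_ne_zero h0 h1 true
      have hf := weight_ne_zero h0 h1 false
      simp only [Measure.add_apply, Measure.smul_apply, smul_eq_mul, add_eq_zero, mul_eq_zero,
        ht, hf, false_or] at hm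
      cases ℓ
      · exact hm.2
      · exact hm.1
    · left
      exact ⟨mul_ne_zero (ENNReal.inv_ne_zero.2 (measure_ne_top _ _)) (weight_ne_zero h0 h1 ℓ),
        ENNReal.mul_ne_top (ENNReal.inv_ne_top.2 hm) (weight_ne_top ρ ℓ)⟩

end Population

/-! ### Transfer of the observed law from labelled units to the whole population. -/

namespace Population

variable {𝒳 𝒮 : Type*} [MeasurableSpace 𝒳] [MeasurableSpace 𝒮]

theorem nonempty_surrogate (p : Population 𝒳 𝒮) : Nonempty 𝒮 := by
  have : Nonempty (Unlabelled 𝒳 𝒮) :=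
    nonempty_of_isProbabilityMeasure (p.law true : Measure (Unlabelled 𝒳 𝒮))
  exact ⟨this.some.2.2.1 true⟩

theorem lintegral_P (p : Population 𝒳 𝒮) (G : Full 𝒳 𝒮 → ℝ≥0∞) :
    ∫⁻ w, G w ∂p.P = weight p.labelProb true * ∫⁻ w, G w ∂p.given true +
      weight p.labelProb false * ∫⁻ w, G w ∂p.given false := by
  rw [P, mix_eq, lintegral_add_measure, lintegral_smul_measure, lintegral_smul_measure,
    smul_eq_mul, smul_eq_mul]

theorem lintegral_treated_eq (m : Measure (Full 𝒳 𝒮)) (a : Bool) (G : Full 𝒳 𝒮 → ℝ≥0∞) :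
    ∫⁻ w in T ⁻¹' {a}, G w ∂m = ∫⁻ w, (if T w = a then 1 else 0) * G w ∂m := by
  rw [← lintegral_indicator (measurable_T (measurableSet_singleton a))]
  refine lintegral_congr fun w => ?_
  by_cases h : T w = a <;> simp [Set.indicator, h]

theorem measurable_ite_bool {α : Type*} [MeasurableSpace α] (a : Bool) {t : α → Bool}
    (ht : Measurable t) : Measurable fun z => if t z = a then (1 : ℝ≥0∞) else 0 :=
  Measurable.ite (ht (measurableSet_singleton a)) measurable_const measurable_const

variable [StandardBorelSpace 𝒳] [StandardBorelSpace 𝒮] {ε : ℝ} {C : ℝ≥0}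

/-- Both labels share the conditional law of `(T, S, Y)` given `X`. -/
theorem exists_common_obs_law {p : Population 𝒳 𝒮} (hp : Assumptions ε C p)
    {G : Obs 𝒳 𝒮 → ℝ≥0∞} (hG : Measurable G) :
    ∃ φ : 𝒳 → ℝ≥0∞, Measurable φ ∧ ∀ (ℓ : Bool) (u : 𝒳 → ℝ≥0∞), Measurable u →
      ∫⁻ w, u (X w) * G (obs w) ∂p.given ℓ = ∫⁻ w, u (X w) * φ (X w) ∂p.given ℓ := by
  have := p.nonempty_surrogate
  obtain ⟨ρ, h0, h1, hT⟩ := hp.label_treatment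
  obtain ⟨κT, _, hκT⟩ :=
    (p.condIndepFun_label_mix_iff h0 h1 measurable_X measurable_T).1 hT
  have hS : ∀ a, ∃ κ : Kernel (Bool × 𝒳) 𝒮, IsMarkovKernel κ ∧
      ∀ ℓ, HasCondLaw (p.given ℓ) (fun w => (T w, X w)) (Spot a) κ := fun a => by
    obtain ⟨ρ, h0, h1, h⟩ := hp.label_surrogate a
    exact (p.condIndepFun_label_mix_iff h0 h1 (measurable_T.prodMk measurable_X)
      (measurable_Spot a)).1 h
  have hY : ∀ a, ∃ κ : Kernel (𝒳 × 𝒮) ℝ, IsMarkovKernel κ ∧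
      ∀ ℓ, HasCondLaw ((p.given ℓ).restrict {w | T w = a}) (fun w => (X w, Spot a w))
        (Ypot a) κ := fun a => by
    obtain ⟨ρ, h0, h1, h⟩ := hp.missing_at_random a
    exact (p.condIndepFun_label_cond_iff h0 h1 (measurable_X.prodMk (measurable_Spot a))
      (measurable_Ypot a) _).1 h
  choose κS hκSm hκS using hS
  choose κY hκYm hκY using hY
  have := hκSm
  have := hκYm
  -- On `T = a` the outcome, the surrogate and the treatment are integrated out in turn (`H`, `J`,
  -- `φ`), each with a kernel shared by the labels: conditions (ii), (iii) and (iv) in this order.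
  let H : Bool → 𝒳 × 𝒮 → ℝ≥0∞ := fun a z => ∫⁻ y, G (z.1, a, z.2, y) ∂κY a z
  have hH : ∀ a, Measurable (H a) := fun a =>
    Measurable.lintegral_kernel_prod_right (κ := κY a)
      (f := fun z y => G (z.1, a, z.2, y)) (by unfold Function.uncurry; fun_prop)
  let J : Bool → Bool × 𝒳 → ℝ≥0∞ := fun a z => ∫⁻ s, H a (z.2, s) ∂κS a z
  have hJ : ∀ a, Measurable (J a) := fun a =>
    Measurable.lintegral_kernel_prod_right (κ := κS a)
      (f := fun z s => H a (z.2, s)) (by unfold Function.uncurry; have := hH a; fun_prop)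
  let φ : Bool → 𝒳 → ℝ≥0∞ := fun a x => ∫⁻ t, (if t = a then 1 else 0) * J a (t, x) ∂κT x
  have hφ : ∀ a, Measurable (φ a) := fun a =>
    Measurable.lintegral_kernel_prod_right (κ := κT)
      (f := fun x t => (if t = a then 1 else 0) * J a (t, x)) (by
        unfold Function.uncurry
        have := hJ a
        exact (measurable_ite_bool a measurable_snd).mul (by fun_prop))
  refine ⟨fun x => φ true x + φ false x, (hφ true).add (hφ false), fun ℓ u hu => ?_⟩
  have key : ∀ a, ∫⁻ w in T ⁻¹' {a}, u (X w) * G (obs w) ∂p.given ℓ =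
      ∫⁻ w, u (X w) * φ a (X w) ∂p.given ℓ := by
    intro a
    calc ∫⁻ w in T ⁻¹' {a}, u (X w) * G (obs w) ∂p.given ℓ
        = ∫⁻ w in {w | T w = a}, u (X w) * G (X w, a, Spot a w, Ypot a w) ∂p.given ℓ := by
          refine setLIntegral_congr_fun (measurable_T (measurableSet_singleton a)) fun w hw => ?_
          have : T w = a := hw
          simp only [obs, S, Y, this]
      _ = ∫⁻ w in T ⁻¹' {a}, u (X w) * H a (X w, Spot a w) ∂p.given ℓ := by
          rw [hκY a ℓ (fun z => u z.1.1 * G (z.1.1, a, z.1.2, z.2)) (by fun_prop)]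
          exact lintegral_congr fun w => lintegral_const_mul (u (X w))
            (f := fun y => G (X w, a, Spot a w, y)) (by fun_prop)
      _ = ∫⁻ w, (if T w = a then 1 else 0) * (u (X w) * J a (T w, X w)) ∂p.given ℓ := by
          have := hH a
          rw [lintegral_treated_eq, hκS a ℓ
            (fun z => (if z.1.1 = a then 1 else 0) * (u z.1.2 * H a (z.1.2, z.2)))
            ((measurable_ite_bool a (by fun_prop)).mul (by fun_prop))]
          refine lintegral_congr fun w => ?_
          have h1 : Measurable fun s => H a (X w, s) := by fun_prop
          exact (lintegral_const_mul (μ := κS a (T w, X w)) (if T w = a then 1 else 0)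
            (h1.const_mul (u (X w)))).trans (congrArg _ (lintegral_const_mul _ h1))
      _ = ∫⁻ w, u (X w) * φ a (X w) ∂p.given ℓ := by
          have := hJ a
          rw [hκT ℓ (fun z => (if z.2 = a then 1 else 0) * (u z.1 * J a (z.2, z.1)))
            ((measurable_ite_bool a (by fun_prop)).mul (by fun_prop))]
          refine lintegral_congr fun w => ?_
          have h3 : Measurable fun t => (if t = a then 1 else 0) * J a (t, X w) :=
            Measurable.of_discrete
          exact Eq.trans (lintegral_congr fun t => mul_left_comm _ _ _)
            (lintegral_const_mul (μ := κT (X w)) (u (X w)) h3)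
  rw [lintegral_bool_split _ measurable_T, key, key, ← lintegral_add_left]
  · refine lintegral_congr fun w => ?_
    ring
  · exact (hu.comp measurable_X).mul ((hφ true).comp measurable_X)

/-- The law of the observed variables under `P` has density `λ*(X)` with respect to `Q`. -/
theorem map_obs_P {p : Population 𝒳 𝒮} (hp : Assumptions ε C p) :
    p.P.map obs = p.Q.withDensity fun o => p.lawX.rnDeriv p.lawXLabelled o.1 := by
  refine Measure.ext_of_lintegral _ fun G hG => ?_
  obtain ⟨φ, hφ, h⟩ := exists_common_obs_law hp hG
  have hr : Measurable (p.lawX.rnDeriv p.lawXLabelled) := Measure.measurable_rnDeriv _ _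
  rw [lintegral_map hG measurable_obs, lintegral_withDensity_eq_lintegral_mul _ (by fun_prop) hG, Q,
    lintegral_map (by fun_prop) measurable_obs]
  simp only [Pi.mul_apply]
  have h1 := h true _ hr
  have h2 : ∀ ℓ, ∫⁻ w, G (obs w) ∂p.given ℓ = ∫⁻ w, φ (X w) ∂p.given ℓ := fun ℓ => by
    simpa using h ℓ (fun _ => 1) measurable_const
  have hac : p.lawXLabelled.withDensity (p.lawX.rnDeriv p.lawXLabelled) = p.lawX := by
    have : IsFiniteMeasure p.lawX := by unfold lawX; infer_instance
    have : IsFiniteMeasure p.lawXLabelled := by unfold lawXLabelled; infer_instance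
    exact Measure.withDensity_rnDeriv_eq _ _ hp.absolutelyContinuous
  calc ∫⁻ w, G (obs w) ∂p.P = ∫⁻ w, φ (X w) ∂p.P := by
        rw [lintegral_P, lintegral_P, h2, h2]
    _ = ∫⁻ x, φ x ∂p.lawX := by rw [lawX, lintegral_map hφ measurable_X]
    _ = ∫⁻ x, φ x ∂p.lawXLabelled.withDensity (p.lawX.rnDeriv p.lawXLabelled) := by rw [hac]
    _ = ∫⁻ w, p.lawX.rnDeriv p.lawXLabelled (X w) * φ (X w) ∂p.given true := by
        rw [lintegral_withDensity_eq_lintegral_mul _ hr hφ, lawXLabelled,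
          lintegral_map (by exact hr.mul hφ) measurable_X]
        rfl
    _ = _ := h1.symm

end Population

/-! ### Versions of the density ratio and the propensity that are bounded everywhere. -/

noncomputable section

namespace Population

variable {𝒳 𝒮 : Type*} [MeasurableSpace 𝒳] [MeasurableSpace 𝒮]

instance (p : Population 𝒳 𝒮) : IsProbabilityMeasure p.lawX :=
  Measure.isProbabilityMeasure_map measurable_X.aemeasurable

instance (p : Population 𝒳 𝒮) : IsProbabilityMeasure p.lawXLabelled :=
  Measure.isProbabilityMeasure_map measurable_X.aemeasurable

/-- The density ratio truncated at its essential bound. -/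
def clippedRatio (p : Population 𝒳 𝒮) (C : ℝ≥0) (x : 𝒳) : ℝ := min (p.densityRatio x) C

/-- The propensity of treatment `a`, truncated to its essential range. -/
def clippedPropensity (p : Population 𝒳 𝒮) (ε : ℝ) (a : Bool) (x : 𝒳) : ℝ :=
  if a then max ε (min (p.propensity x) (1 - ε)) else 1 - max ε (min (p.propensity x) (1 - ε))

/-- The signed inverse propensity weight. -/
def ipWeight (p : Population 𝒳 𝒮) (ε : ℝ) (x : 𝒳) (t : Bool) : ℝ :=
  if t then (p.clippedPropensity ε true x)⁻¹ else -(p.clippedPropensity ε false x)⁻¹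

/-- The inverse propensity weighted regression residual. -/
def residual (p : Population 𝒳 𝒮) (ε : ℝ) (o : Obs 𝒳 𝒮) : ℝ :=
  p.ipWeight ε o.1 o.2.1 * (o.2.2.2 - p.regression o.2.1 o.1 o.2.2.1)

theorem measurable_densityRatio (p : Population 𝒳 𝒮) : Measurable p.densityRatio :=
  (Measure.measurable_rnDeriv _ _).ennreal_toReal

theorem measurable_clippedRatio (p : Population 𝒳 𝒮) (C : ℝ≥0) : Measurable (p.clippedRatio C) :=
  p.measurable_densityRatio.min measurable_const

theorem clippedRatio_nonneg (p : Population 𝒳 𝒮) (C : ℝ≥0) (x : 𝒳) : 0 ≤ p.clippedRatio C x :=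
  le_min ENNReal.toReal_nonneg C.2

theorem clippedRatio_le (p : Population 𝒳 𝒮) (C : ℝ≥0) (x : 𝒳) : p.clippedRatio C x ≤ C :=
  min_le_right _ _

theorem measurable_propensity (p : Population 𝒳 𝒮) : Measurable p.propensity :=
  (Kernel.measurable_coe _ (measurableSet_singleton true)).ennreal_toReal

theorem measurable_clippedPropensity (p : Population 𝒳 𝒮) (ε : ℝ) (a : Bool) :
    Measurable (p.clippedPropensity ε a) := by
  have h : Measurable fun x => max ε (min (p.propensity x) (1 - ε)) :=
    measurable_const.max (p.measurable_propensity.min measurable_const)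
  cases a
  · simpa [clippedPropensity] using! h.const_sub 1
  · simpa [clippedPropensity] using! h

theorem le_clippedPropensity (p : Population 𝒳 𝒮) {ε : ℝ} (hε : ε < 1 / 2) (a : Bool) (x : 𝒳) :
    ε ≤ p.clippedPropensity ε a x := by
  cases a
  · simp only [clippedPropensity]
    have : max ε (min (p.propensity x) (1 - ε)) ≤ 1 - ε :=
      max_le (by linarith) (min_le_right _ _)
    simp only [Bool.false_eq_true, if_false]
    linarith
  · simp [clippedPropensity]

theorem clippedPropensity_of_mem (p : Population 𝒳 𝒮) {ε : ℝ} {x : 𝒳}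
    (h : ε ≤ p.propensity x ∧ p.propensity x ≤ 1 - ε) (a : Bool) :
    p.clippedPropensity ε a x = if a then p.propensity x else 1 - p.propensity x := by
  simp [clippedPropensity, min_eq_left h.2, max_eq_right h.1]

theorem measurable_ipWeight (p : Population 𝒳 𝒮) (ε : ℝ) :
    Measurable fun z : 𝒳 × Bool => p.ipWeight ε z.1 z.2 :=
  Measurable.ite (measurable_snd (measurableSet_singleton true))
    ((p.measurable_clippedPropensity ε true).inv.comp measurable_fst)
    ((p.measurable_clippedPropensity ε false).inv.neg.comp measurable_fst)

theorem abs_ipWeight_le (p : Population 𝒳 𝒮) {ε : ℝ} (hε0 : 0 < ε) (hε : ε < 1 / 2) (x : 𝒳)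
    (t : Bool) : |p.ipWeight ε x t| ≤ ε⁻¹ := by
  have h : ∀ a, |(p.clippedPropensity ε a x)⁻¹| ≤ ε⁻¹ := fun a => by
    have := p.le_clippedPropensity hε a x
    rw [abs_inv, abs_of_nonneg (hε0.le.trans this)]
    exact inv_anti₀ hε0 this
  cases t
  · simpa [ipWeight] using h false
  · simpa [ipWeight] using h true

theorem measurable_regression (p : Population 𝒳 𝒮) :
    Measurable fun z : 𝒳 × Bool × 𝒮 => p.regression z.2.1 z.1 z.2.2 :=
  (StronglyMeasurable.integral_condDistrib (f := fun z : (𝒳 × Bool × 𝒮) × ℝ => z.2)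
    (measurable_snd.stronglyMeasurable)).measurable

theorem measurable_residual (p : Population 𝒳 𝒮) (ε : ℝ) : Measurable (p.residual ε) := by
  have h1 : Measurable fun o : Obs 𝒳 𝒮 => p.ipWeight ε o.1 o.2.1 :=
    (p.measurable_ipWeight ε).comp (g := fun z : 𝒳 × Bool => p.ipWeight ε z.1 z.2)
      (f := fun o : Obs 𝒳 𝒮 => (o.1, o.2.1)) (by fun_prop)
  have h2 : Measurable fun o : Obs 𝒳 𝒮 => p.regression o.2.1 o.1 o.2.2.1 :=
    p.measurable_regression.comp
      (g := fun z : 𝒳 × Bool × 𝒮 => p.regression z.2.1 z.1 z.2.2)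
      (f := fun o : Obs 𝒳 𝒮 => (o.1, o.2.1, o.2.2.1)) (by fun_prop)
  have h3 : Measurable fun o : Obs 𝒳 𝒮 => o.2.2.2 := by fun_prop
  exact h1.mul (h3.sub h2)

theorem Q_map_fst (p : Population 𝒳 𝒮) : p.Q.map Prod.fst = p.lawXLabelled := by
  rw [Q, Measure.map_map measurable_fst measurable_obs]; rfl

theorem map_obs_map_fst (p : Population 𝒳 𝒮) : (p.P.map obs).map Prod.fst = p.lawX := by
  rw [Measure.map_map measurable_fst measurable_obs]; rfl

theorem ae_Q_of_ae_lawXLabelled (p : Population 𝒳 𝒮) {r : 𝒳 → Prop}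
    (h : ∀ᵐ x ∂p.lawXLabelled, r x) : ∀ᵐ o ∂p.Q, r o.1 := by
  rw [← Q_map_fst] at h
  exact ae_of_ae_map measurable_fst.aemeasurable h

theorem ae_P_of_ae_lawX (p : Population 𝒳 𝒮) {r : 𝒳 → Prop}
    (h : ∀ᵐ x ∂p.lawX, r x) : ∀ᵐ w ∂p.P, r (X w) :=
  ae_of_ae_map measurable_X.aemeasurable h

variable [StandardBorelSpace 𝒳] [StandardBorelSpace 𝒮] {ε : ℝ} {C : ℝ≥0}

/-- The law of $X$ is $\lambda^*$ times its law given $R=1$, so an exceptional null set can have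
labelled mass only where $\lambda^*=0$. -/
theorem ae_lawXLabelled_of_ae_lawX {p : Population 𝒳 𝒮} (hp : Assumptions ε C p) {r : 𝒳 → Prop}
    (h : ∀ᵐ x ∂p.lawX, r x) : ∀ᵐ x ∂p.lawXLabelled, p.densityRatio x ≠ 0 → r x := by
  rw [← Measure.withDensity_rnDeriv_eq _ _ hp.absolutelyContinuous,
    ae_withDensity_iff (Measure.measurable_rnDeriv _ _)] at h
  filter_upwards [h] with x hx h0
  refine hx fun h1 => h0 ?_
  simp [densityRatio, h1]

theorem clippedRatio_ae_eq {p : Population 𝒳 𝒮} (hp : Assumptions ε C p) :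
    ∀ᵐ x ∂p.lawXLabelled, p.clippedRatio C x = p.densityRatio x := by
  filter_upwards [ae_lawXLabelled_of_ae_lawX hp hp.densityRatio_le] with x hx
  refine min_eq_left ?_
  by_cases h : p.densityRatio x = 0
  · rw [h]; exact C.2
  · exact hx h

/-- The law of the observed variables under `P` has density `λ*(X)` with respect to `Q`. -/
theorem map_obs_P_eq_clipped {p : Population 𝒳 𝒮} (hp : Assumptions ε C p) :
    p.P.map obs = p.Q.withDensity fun o => ENNReal.ofReal (p.clippedRatio C o.1) := by
  rw [map_obs_P hp]
  refine withDensity_congr_ae ?_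
  filter_upwards [p.ae_Q_of_ae_lawXLabelled (clippedRatio_ae_eq hp),
    p.ae_Q_of_ae_lawXLabelled (Measure.rnDeriv_lt_top p.lawX p.lawXLabelled)] with o h1 h2
  rw [h1, densityRatio, ENNReal.ofReal_toReal h2.ne]

/-- Overlap holds only almost surely under $\mathbb P$, so on a set of positive labelled mass the
propensity may be arbitrary; there $\lambda^*=0$ and both sides vanish. -/
theorem psi_ae_eq {p : Population 𝒳 𝒮} (hp : Assumptions ε C p) :
    p.psi =ᵐ[p.Q] fun o => p.clippedRatio C o.1 * p.residual ε o := by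
  filter_upwards [p.ae_Q_of_ae_lawXLabelled (clippedRatio_ae_eq hp),
    p.ae_Q_of_ae_lawXLabelled (ae_lawXLabelled_of_ae_lawX hp hp.overlap)] with o h1 h2
  obtain ⟨x, t, s, y⟩ := o
  simp only at h1 h2
  rw [h1]
  by_cases h : p.densityRatio x = 0
  · simp [psi, h]
  · have h3 := p.clippedPropensity_of_mem (h2 h)
    cases t
    · simp [psi, residual, ipWeight, h3]; ring
    · simp [psi, residual, ipWeight, h3]; ring

/-- Unconfoundedness: selecting on the treatment amounts to weighting by the propensity. -/
theorem setLIntegral_treated {p : Population 𝒳 𝒮} {a : Bool}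
    (hu : CondIndepFun (MeasurableSpace.comap X inferInstance) measurable_X.comap_le
      (fun w => (Ypot a w, Spot a w)) T p.P)
    (ho : ∀ᵐ x ∂p.lawX, ε ≤ p.propensity x ∧ p.propensity x ≤ 1 - ε)
    {F : 𝒳 × ℝ → ℝ≥0∞} (hF : Measurable F) :
    ∫⁻ w in T ⁻¹' {a}, F (X w, Ypot a w) ∂p.P =
      ∫⁻ w, ENNReal.ofReal (p.clippedPropensity ε a (X w)) * F (X w, Ypot a w) ∂p.P := by
  have := p.nonempty_surrogate
  have h := hasCondLaw_of_condIndepFun measurable_X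
    ((measurable_Ypot a).prodMk (measurable_Spot a)) measurable_T hu
    (fun z => (if z.2 = a then 1 else 0) * F (z.1.1, z.1.2.1))
    ((measurable_ite_bool a (by fun_prop)).mul (by fun_prop))
  rw [lintegral_treated_eq, h]
  refine lintegral_congr_ae ?_
  filter_upwards [p.ae_P_of_ae_lawX ho] with w hw
  have h1 : ∫⁻ t, (if t = a then (1 : ℝ≥0∞) else 0) ∂condDistrib T X p.P (X w) =
      condDistrib T X p.P (X w) {a} := by
    rw [← lintegral_indicator_one (measurableSet_singleton a)]
    exact lintegral_congr fun t => by by_cases h : t = a <;> simp [h]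
  have h2 : condDistrib T X p.P (X w) {a} = ENNReal.ofReal (p.clippedPropensity ε a (X w)) := by
    rw [p.clippedPropensity_of_mem hw]
    have h3 : condDistrib T X p.P (X w) {true} = ENNReal.ofReal (p.propensity (X w)) := by
      rw [propensity, ofReal_measureReal]
    cases a
    · have h4 : ({false} : Set Bool) = {true}ᶜ := by ext b; cases b <;> simp
      rw [h4, prob_compl_eq_one_sub (measurableSet_singleton true), h3]
      simp only [Bool.false_eq_true, if_false]
      have h5 : 0 ≤ p.propensity (X w) := measureReal_nonneg
      rw [ENNReal.ofReal_sub _ h5, ENNReal.ofReal_one]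
    · simpa using h3
  simp only [Kernel.prodMkRight_apply]
  rw [lintegral_mul_const _ Measurable.of_discrete, h1, h2]

end Population

end

/-! ### Known quantities, moments and identification by inverse propensity weighting. -/

noncomputable section

namespace Population

variable {𝒳 𝒮 : Type*} [MeasurableSpace 𝒳] [MeasurableSpace 𝒮]

theorem lintegral_Y_sq_le (m : Measure (Full 𝒳 𝒮)) :
    ∫⁻ w, ENNReal.ofReal (Y w ^ 2) ∂m ≤
      ∫⁻ w, ENNReal.ofReal (Ypot true w ^ 2) ∂m + ∫⁻ w, ENNReal.ofReal (Ypot false w ^ 2) ∂m := by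
  have := measurable_Ypot (𝒳 := 𝒳) (𝒮 := 𝒮) true
  rw [← lintegral_add_left (by fun_prop)]
  refine lintegral_mono fun w => ?_
  simp only [Y]
  cases T w
  · exact le_add_self
  · exact le_self_add

theorem lawX_eq_of_lawXTS_eq {p q : Population 𝒳 𝒮} (h : p.lawXTS = q.lawXTS) :
    p.lawX = q.lawX := by
  have e : ∀ r : Population 𝒳 𝒮, r.lawX = r.lawXTS.map Prod.fst := fun r => by
    rw [lawXTS, Measure.map_map measurable_fst
      (measurable_X.prodMk (measurable_T.prodMk measurable_S))]; rfl
  rw [e, e, h]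

/-- Equality holds at every point, not just almost surely, because `condDistrib` is a function of
the joint law alone. -/
theorem propensity_eq_of_lawXTS_eq {p q : Population 𝒳 𝒮} (h : p.lawXTS = q.lawXTS) :
    p.propensity = q.propensity := by
  have e : ∀ r : Population 𝒳 𝒮, r.P.map (fun w => (X w, T w)) =
      r.lawXTS.map fun z => (z.1, z.2.1) := fun r => by
    rw [lawXTS, Measure.map_map (by fun_prop)
      (measurable_X.prodMk (measurable_T.prodMk measurable_S))]; rfl
  have : condDistrib T X p.P = condDistrib T X q.P := by
    rw [condDistrib, condDistrib]
    congr 1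
    rw [e, e, h]
  funext x
  rw [propensity, propensity, this]

theorem lawXLabelled_eq_of_Q_eq {p q : Population 𝒳 𝒮} (h : p.Q = q.Q) :
    p.lawXLabelled = q.lawXLabelled := by
  rw [← Q_map_fst, ← Q_map_fst, h]

theorem clippedPropensity_congr {p q : Population 𝒳 𝒮} (h : p.propensity = q.propensity) :
    p.clippedPropensity = q.clippedPropensity := by
  funext ε a x; simp [clippedPropensity, h]

theorem clippedRatio_congr {p q : Population 𝒳 𝒮} (h : p.lawX = q.lawX)
    (h' : p.lawXLabelled = q.lawXLabelled) : p.clippedRatio = q.clippedRatio := by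
  funext C x; rw [clippedRatio, clippedRatio, densityRatio, densityRatio, h, h']

/-- The conditional law of `Y` given `(X, T, S)` and `R = 1`. -/
def outcomeKernel (p : Population 𝒳 𝒮) : Kernel (𝒳 × Bool × 𝒮) ℝ :=
  condDistrib Y (fun w => (X w, T w, S w)) (p.given true)

instance (p : Population 𝒳 𝒮) : IsMarkovKernel p.outcomeKernel := by
  unfold outcomeKernel; infer_instance

theorem lintegral_Q_outcomeKernel (p : Population 𝒳 𝒮) {G : Obs 𝒳 𝒮 → ℝ≥0∞} (hG : Measurable G) :
    ∫⁻ o, G o ∂p.Q =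
      ∫⁻ o, ∫⁻ y, G (o.1, o.2.1, o.2.2.1, y) ∂p.outcomeKernel (o.1, o.2.1, o.2.2.1) ∂p.Q := by
  have h := hasCondLaw_condDistrib (ν := p.given true)
    (measurable_X.prodMk (measurable_T.prodMk measurable_S)) measurable_Y
    (fun z : (𝒳 × Bool × 𝒮) × ℝ => G (z.1.1, z.1.2.1, z.1.2.2, z.2)) (by fun_prop)
  have hm : Measurable fun z : 𝒳 × Bool × 𝒮 =>
      ∫⁻ y, G (z.1, z.2.1, z.2.2, y) ∂p.outcomeKernel z :=
    Measurable.lintegral_kernel_prod_right (κ := p.outcomeKernel)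
      (f := fun z y => G (z.1, z.2.1, z.2.2, y)) (by unfold Function.uncurry; fun_prop)
  rw [Q, lintegral_map hG measurable_obs, lintegral_map ?_ measurable_obs]
  · exact h
  · exact hm.comp (f := fun o : Obs 𝒳 𝒮 => (o.1, o.2.1, o.2.2.1)) (by fun_prop)

/-- Jensen's inequality for the squared mean. -/
theorem ofReal_integral_sq_le {Ω : Type*} [MeasurableSpace Ω] (ν : Measure Ω)
    [IsProbabilityMeasure ν] {f : Ω → ℝ} (hf : Measurable f) :
    ENNReal.ofReal ((∫ y, f y ∂ν) ^ 2) ≤ ∫⁻ y, ENNReal.ofReal (f y ^ 2) ∂ν := by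
  have h1 : ‖∫ y, f y ∂ν‖ₑ ≤ eLpNorm f 2 ν := by
    have := enorm_integral_mul_le (μ := ν) hf (measurable_const (a := (1 : ℝ)))
    simpa [eLpNorm_const (1 : ℝ) two_ne_zero (IsProbabilityMeasure.ne_zero ν)] using this
  rw [← eLpNorm_two_sq, ← sq_abs, ENNReal.ofReal_pow (abs_nonneg _), ← Real.enorm_eq_ofReal_abs]
  gcongr

theorem integrable_ipWeight_mul {p q : Population 𝒳 𝒮} {ε : ℝ} (hε0 : 0 < ε)
    (hε : ε < 1 / 2) {V : Full 𝒳 𝒮 → ℝ} (hV : Integrable V p.P) :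
    Integrable (fun w => q.ipWeight ε (X w) (T w) * V w) p.P := by
  have hm : Measurable fun w : Full 𝒳 𝒮 => q.ipWeight ε (X w) (T w) :=
    (q.measurable_ipWeight ε).comp (g := fun z : 𝒳 × Bool => q.ipWeight ε z.1 z.2)
      (f := fun w => (X w, T w)) (measurable_X.prodMk measurable_T)
  exact hV.bdd_mul (c := ε⁻¹) hm.aestronglyMeasurable
    (ae_of_all _ fun w => q.abs_ipWeight_le hε0 hε _ _)

variable [StandardBorelSpace 𝒳] [StandardBorelSpace 𝒮] {ε : ℝ} {C : ℝ≥0}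

theorem lintegral_outcome_sq {p : Population 𝒳 𝒮} (hp : Assumptions ε C p) (a : Bool) :
    ∫⁻ w, ENNReal.ofReal (Ypot a w ^ 2) ∂p.P = ENNReal.ofReal (∫ w, Ypot a w ^ 2 ∂p.P) :=
  (ofReal_integral_eq_lintegral_ofReal (hp.outcome_memLp a).integrable_sq
    (ae_of_all _ fun _ => sq_nonneg _)).symm

theorem lintegral_Y_sq_ne_top {p : Population 𝒳 𝒮} (hp : Assumptions ε C p) :
    ∫⁻ w, ENNReal.ofReal (Y w ^ 2) ∂p.P ≠ ∞ := by
  refine ne_top_of_le_ne_top ?_ (lintegral_Y_sq_le p.P)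
  rw [lintegral_outcome_sq hp, lintegral_outcome_sq hp]
  finiteness

theorem memLp_Y {p : Population 𝒳 𝒮} (hp : Assumptions ε C p) : MemLp Y 2 p.P := by
  refine ⟨measurable_Y.aestronglyMeasurable, ?_⟩
  rw [eLpNorm_two_eq]
  exact ENNReal.rpow_lt_top_of_nonneg (by norm_num) (lintegral_Y_sq_ne_top hp)

/-- The density of the law under $\mathbb P$ with respect to $Q$ depends on $X$ only, so it leaves
the conditional law of $Y$ given $(X,T,S)$ unchanged. -/
theorem lintegral_P_outcomeKernel {p : Population 𝒳 𝒮} (hp : Assumptions ε C p)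
    {G : Obs 𝒳 𝒮 → ℝ≥0∞} (hG : Measurable G) :
    ∫⁻ o, G o ∂(p.P.map obs) = ∫⁻ o, ∫⁻ y, G (o.1, o.2.1, o.2.2.1, y)
      ∂p.outcomeKernel (o.1, o.2.1, o.2.2.1) ∂(p.P.map obs) := by
  have hl : Measurable fun o : Obs 𝒳 𝒮 => ENNReal.ofReal (p.clippedRatio C o.1) :=
    ((p.measurable_clippedRatio C).comp measurable_fst).ennreal_ofReal
  have hm : Measurable fun z : 𝒳 × Bool × 𝒮 =>
      ∫⁻ y, G (z.1, z.2.1, z.2.2, y) ∂p.outcomeKernel z :=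
    Measurable.lintegral_kernel_prod_right (κ := p.outcomeKernel)
      (f := fun z y => G (z.1, z.2.1, z.2.2, y)) (by unfold Function.uncurry; fun_prop)
  have hm' : Measurable fun o : Obs 𝒳 𝒮 => ∫⁻ y, G (o.1, o.2.1, o.2.2.1, y)
      ∂p.outcomeKernel (o.1, o.2.1, o.2.2.1) :=
    hm.comp (f := fun o : Obs 𝒳 𝒮 => (o.1, o.2.1, o.2.2.1)) (by fun_prop)
  rw [map_obs_P_eq_clipped hp, lintegral_withDensity_eq_lintegral_mul _ hl hG,
    lintegral_withDensity_eq_lintegral_mul _ hl hm', lintegral_Q_outcomeKernel _ (hl.mul hG)]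
  refine lintegral_congr fun o => ?_
  simp only [Pi.mul_apply]
  rw [lintegral_const_mul _ (by fun_prop)]

/-- Jensen's inequality under $\mathbb P$, since under $Q$ the outcome is merely integrable. The
bound is stated for the known law of $(X,T,S)$ and so applies along the whole model. -/
theorem lintegral_regression_sq_ne_top {p : Population 𝒳 𝒮} (hp : Assumptions ε C p) :
    ∫⁻ z, ENNReal.ofReal (p.regression z.2.1 z.1 z.2.2 ^ 2) ∂p.lawXTS ≠ ∞ := by
  have hreg := p.measurable_regression
  have e1 : p.lawXTS = (p.P.map obs).map fun o => (o.1, o.2.1, o.2.2.1) := by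
    rw [lawXTS, Measure.map_map (by fun_prop) measurable_obs]; rfl
  refine ne_top_of_le_ne_top (lintegral_Y_sq_ne_top hp) ?_
  calc ∫⁻ z, ENNReal.ofReal (p.regression z.2.1 z.1 z.2.2 ^ 2) ∂p.lawXTS
      = ∫⁻ o, ENNReal.ofReal (p.regression o.2.1 o.1 o.2.2.1 ^ 2) ∂(p.P.map obs) := by
        rw [e1, lintegral_map (hreg.pow_const 2).ennreal_ofReal (by fun_prop)]
    _ ≤ ∫⁻ o, ∫⁻ y, ENNReal.ofReal (y ^ 2) ∂p.outcomeKernel (o.1, o.2.1, o.2.2.1)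
          ∂(p.P.map obs) :=
        lintegral_mono fun o => ofReal_integral_sq_le _ measurable_id
    _ = ∫⁻ o, ENNReal.ofReal (o.2.2.2 ^ 2) ∂(p.P.map obs) :=
        (lintegral_P_outcomeKernel hp (G := fun o => ENNReal.ofReal (o.2.2.2 ^ 2))
          (by fun_prop)).symm
    _ = ∫⁻ w, ENNReal.ofReal (Y w ^ 2) ∂p.P := by
        rw [lintegral_map (by fun_prop) measurable_obs]; rfl

/-- By unconfoundedness, restricting to `T = a` multiplies the law of $(X,Y(a))$ by the propensity
of `a`, which the inverse weight cancels. -/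
theorem integral_inv_propensity_treated {p : Population 𝒳 𝒮} (hp : Assumptions ε C p)
    (hε0 : 0 < ε) (hε : ε < 1 / 2) (a : Bool) :
    ∫ w in T ⁻¹' {a}, (p.clippedPropensity ε a (X w))⁻¹ * Y w ∂p.P = ∫ w, Ypot a w ∂p.P := by
  have hm : Measurable fun w : Full 𝒳 𝒮 => (X w, Ypot a w) :=
    measurable_X.prodMk (measurable_Ypot a)
  have hcm := p.measurable_clippedPropensity ε a
  have hc : Measurable fun z : 𝒳 × ℝ => ENNReal.ofReal (p.clippedPropensity ε a z.1) :=
    (hcm.comp measurable_fst).ennreal_ofReal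
  have hpos : ∀ x, 0 < p.clippedPropensity ε a x := fun x =>
    hε0.trans_le (p.le_clippedPropensity hε a x)
  have e : (p.P.restrict (T ⁻¹' {a})).map (fun w => (X w, Ypot a w)) =
      (p.P.map fun w => (X w, Ypot a w)).withDensity
        fun z => ENNReal.ofReal (p.clippedPropensity ε a z.1) := by
    refine Measure.ext_of_lintegral _ fun F hF => ?_
    rw [lintegral_map hF hm, setLIntegral_treated (hp.unconfounded a) hp.overlap hF,
      lintegral_withDensity_eq_lintegral_mul _ hc hF, lintegral_map (hc.mul hF) hm]
    rfl
  have hF : Measurable fun z : 𝒳 × ℝ => (p.clippedPropensity ε a z.1)⁻¹ * z.2 :=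
    (hcm.comp measurable_fst).inv.mul measurable_snd
  calc ∫ w in T ⁻¹' {a}, (p.clippedPropensity ε a (X w))⁻¹ * Y w ∂p.P
      = ∫ w in T ⁻¹' {a}, (p.clippedPropensity ε a (X w))⁻¹ * Ypot a w ∂p.P := by
        refine setIntegral_congr_fun (measurable_T (measurableSet_singleton a)) fun w hw => ?_
        have : T w = a := hw
        simp only [Y, this]
    _ = ∫ z, (p.clippedPropensity ε a z.1)⁻¹ * z.2
          ∂((p.P.restrict (T ⁻¹' {a})).map fun w => (X w, Ypot a w)) :=
        (integral_map hm.aemeasurable hF.aestronglyMeasurable).symm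
    _ = ∫ z, z.2 ∂(p.P.map fun w => (X w, Ypot a w)) := by
        rw [e, integral_withDensity_eq_integral_toReal_smul hc (by simp)]
        refine integral_congr_ae (ae_of_all _ fun z => ?_)
        simp only [smul_eq_mul]
        rw [ENNReal.toReal_ofReal (hpos _).le, ← mul_assoc, mul_inv_cancel₀ (hpos _).ne', one_mul]
    _ = ∫ w, Ypot a w ∂p.P := integral_map hm.aemeasurable (by fun_prop)

/-- Inverse propensity weighting identifies the average treatment effect. -/
theorem ate_eq_integral_ipWeight {p : Population 𝒳 𝒮} (hp : Assumptions ε C p)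
    (hε0 : 0 < ε) (hε : ε < 1 / 2) :
    p.ate = ∫ w, p.ipWeight ε (X w) (T w) * Y w ∂p.P := by
  have hi := integrable_ipWeight_mul (q := p) hε0 hε ((memLp_Y hp).integrable (by norm_num))
  have hT : MeasurableSet (T ⁻¹' {true} : Set (Full 𝒳 𝒮)) :=
    measurable_T (measurableSet_singleton true)
  have hc : (T ⁻¹' {true} : Set (Full 𝒳 𝒮))ᶜ = T ⁻¹' {false} := by ext w; simp
  rw [← integral_add_compl hT hi, hc, ate, ← integral_inv_propensity_treated hp hε0 hε true,
    ← integral_inv_propensity_treated hp hε0 hε false, sub_eq_add_neg, ← integral_neg]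
  congr 1
  · refine setIntegral_congr_fun hT fun w hw => ?_
    have : T w = true := hw
    simp [ipWeight, this]
  · refine setIntegral_congr_fun (measurable_T (measurableSet_singleton false)) fun w hw => ?_
    have : T w = false := hw
    simp [ipWeight, this]

end Population

end

/-! ### The weighted residual: centring, second moment and relation to the effect. -/

noncomputable section

namespace Population

variable {𝒳 𝒮 : Type*} [MeasurableSpace 𝒳] [MeasurableSpace 𝒮]

theorem integrable_Y_Q {p : Population 𝒳 𝒮} (h : Integrable Y (p.given true)) :
    Integrable (fun o : Obs 𝒳 𝒮 => o.2.2.2) p.Q :=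
  (integrable_map_measure (Measurable.aestronglyMeasurable (by fun_prop))
    measurable_obs.aemeasurable).2 h

theorem integrable_regression_Q {p : Population 𝒳 𝒮} (h : Integrable Y (p.given true)) :
    Integrable (fun o : Obs 𝒳 𝒮 => p.regression o.2.1 o.1 o.2.2.1) p.Q := by
  have hm : Measurable fun o : Obs 𝒳 𝒮 => p.regression o.2.1 o.1 o.2.2.1 :=
    p.measurable_regression.comp (g := fun z : 𝒳 × Bool × 𝒮 => p.regression z.2.1 z.1 z.2.2)
      (f := fun o : Obs 𝒳 𝒮 => (o.1, o.2.1, o.2.2.1)) (by fun_prop)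
  refine (integrable_map_measure hm.aestronglyMeasurable measurable_obs.aemeasurable).2 ?_
  have h1 : Integrable (fun z : (𝒳 × Bool × 𝒮) × ℝ => z.2)
      ((p.given true).map fun w => ((X w, T w, S w), Y w)) :=
    (integrable_map_measure (by fun_prop) ((measurable_X.prodMk
      (measurable_T.prodMk measurable_S)).prodMk measurable_Y).aemeasurable).2 h
  exact h1.integral_condDistrib (measurable_X.prodMk
    (measurable_T.prodMk measurable_S)).aemeasurable measurable_Y.aemeasurable

/-- The regression residual is centred given `(X, T, S)` and `R = 1`. -/
theorem integral_mul_sub_regression {p : Population 𝒳 𝒮} (h : Integrable Y (p.given true))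
    {u : 𝒳 × Bool × 𝒮 → ℝ} (hu : Measurable u) {c : ℝ} (hc : ∀ z, |u z| ≤ c) :
    ∫ o, u (o.1, o.2.1, o.2.2.1) * (o.2.2.2 - p.regression o.2.1 o.1 o.2.2.1) ∂p.Q = 0 := by
  have hY := integrable_Y_Q h
  have hr := integrable_regression_Q h
  have hum : Measurable fun o : Obs 𝒳 𝒮 => u (o.1, o.2.1, o.2.2.1) := by fun_prop
  have hi1 : Integrable (fun o : Obs 𝒳 𝒮 => u (o.1, o.2.1, o.2.2.1) * o.2.2.2) p.Q :=
    hY.bdd_mul (c := c) hum.aestronglyMeasurable (ae_of_all _ fun o => hc _)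
  have hi2 : Integrable (fun o : Obs 𝒳 𝒮 => u (o.1, o.2.1, o.2.2.1) *
      p.regression o.2.1 o.1 o.2.2.1) p.Q :=
    hr.bdd_mul (c := c) hum.aestronglyMeasurable (ae_of_all _ fun o => hc _)
  simp only [mul_sub]
  rw [integral_sub hi1 hi2, sub_eq_zero]
  have hk : Measurable fun w : Full 𝒳 𝒮 => (X w, T w, S w) :=
    measurable_X.prodMk (measurable_T.prodMk measurable_S)
  have hF : Measurable fun z : (𝒳 × Bool × 𝒮) × ℝ => u z.1 * z.2 := by fun_prop
  have hj : Integrable (fun z : (𝒳 × Bool × 𝒮) × ℝ => u z.1 * z.2)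
      ((p.given true).map fun w => ((X w, T w, S w), Y w)) :=
    (integrable_map_measure hF.aestronglyMeasurable
      (hk.prodMk measurable_Y).aemeasurable).2
        ((integrable_map_measure hi1.1 measurable_obs.aemeasurable).1 hi1)
  have e1 : ∫ o, u (o.1, o.2.1, o.2.2.1) * o.2.2.2 ∂p.Q =
      ∫ z, u z.1 * z.2 ∂((p.given true).map fun w => ((X w, T w, S w), Y w)) := by
    rw [Q, integral_map measurable_obs.aemeasurable (by fun_prop),
      integral_map (hk.prodMk measurable_Y).aemeasurable hF.aestronglyMeasurable]
    rfl
  rw [e1, Q, integral_map measurable_obs.aemeasurable hi2.1]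
  rw [← compProd_map_condDistrib measurable_Y.aemeasurable] at hj ⊢
  have hur : Measurable fun z => u z * p.regression z.2.1 z.1 z.2.2 := hu.mul p.measurable_regression
  calc _ = ∫ z, ∫ y, u z * y ∂p.outcomeKernel z ∂((p.given true).map fun w => (X w, T w, S w)) :=
        Measure.integral_compProd hj
    _ = ∫ z, u z * p.regression z.2.1 z.1 z.2.2
          ∂((p.given true).map fun w => (X w, T w, S w)) :=
        integral_congr_ae (ae_of_all _ fun z => integral_const_mul _ _)
    _ = _ := integral_map hk.aemeasurable hur.aestronglyMeasurable

theorem integrable_residual_Q {p : Population 𝒳 𝒮} (h : Integrable Y (p.given true)) {ε : ℝ}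
    (hε0 : 0 < ε) (hε : ε < 1 / 2) : Integrable (p.residual ε) p.Q := by
  have h1 : Measurable fun o : Obs 𝒳 𝒮 => p.ipWeight ε o.1 o.2.1 :=
    (p.measurable_ipWeight ε).comp (g := fun z : 𝒳 × Bool => p.ipWeight ε z.1 z.2)
      (f := fun o : Obs 𝒳 𝒮 => (o.1, o.2.1)) (by fun_prop)
  exact ((integrable_Y_Q h).sub (integrable_regression_Q h)).bdd_mul (c := ε⁻¹)
    h1.aestronglyMeasurable (ae_of_all _ fun o => p.abs_ipWeight_le hε0 hε _ _)

/-- The inverse propensity weight is a bounded function of $(X,T)$ and does not disturb the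
centring. This is the hypothesis that removes the density ratio from the derivative. -/
theorem integral_mul_residual {p : Population 𝒳 𝒮} (h : Integrable Y (p.given true)) {ε : ℝ}
    (hε0 : 0 < ε) (hε : ε < 1 / 2) {u : 𝒳 → ℝ} (hu : Measurable u) {c : ℝ} (hc : ∀ x, |u x| ≤ c) :
    ∫ o, u o.1 * p.residual ε o ∂p.Q = 0 := by
  have h1 : Measurable fun z : 𝒳 × Bool × 𝒮 => u z.1 * p.ipWeight ε z.1 z.2.1 :=
    (hu.comp measurable_fst).mul ((p.measurable_ipWeight ε).comp
      (g := fun z : 𝒳 × Bool => p.ipWeight ε z.1 z.2)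
      (f := fun z : 𝒳 × Bool × 𝒮 => (z.1, z.2.1)) (by fun_prop))
  have := integral_mul_sub_regression h h1 (c := c * ε⁻¹) fun z => by
    rw [abs_mul]
    exact mul_le_mul (hc _) (p.abs_ipWeight_le hε0 hε _ _) (abs_nonneg _)
      ((abs_nonneg _).trans (hc z.1))
  rw [← this]
  refine integral_congr_ae (ae_of_all _ fun o => ?_)
  simp only [residual]; ring

theorem lintegral_map_obs_XTS (p : Population 𝒳 𝒮) {F : 𝒳 × Bool × 𝒮 → ℝ≥0∞}
    (hF : Measurable F) :
    ∫⁻ o, F (o.1, o.2.1, o.2.2.1) ∂(p.P.map obs) = ∫⁻ z, F z ∂p.lawXTS := by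
  rw [lawXTS, lintegral_map hF (measurable_X.prodMk (measurable_T.prodMk measurable_S)),
    lintegral_map (by fun_prop) measurable_obs]
  rfl

/-- The second moment of the residual is controlled by those of the outcome and the regression. -/
theorem lintegral_residual_sq_le (p q : Population 𝒳 𝒮) {ε : ℝ} (hε0 : 0 < ε) (hε : ε < 1 / 2) :
    ∫⁻ o, ENNReal.ofReal (p.residual ε o ^ 2) ∂(q.P.map obs) ≤
      ENNReal.ofReal (2 * (ε⁻¹) ^ 2) *
        (∫⁻ w, ENNReal.ofReal (Y w ^ 2) ∂q.P +
          ∫⁻ z, ENNReal.ofReal (p.regression z.2.1 z.1 z.2.2 ^ 2) ∂q.lawXTS) := by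
  have hr : Measurable fun z : 𝒳 × Bool × 𝒮 =>
      ENNReal.ofReal (p.regression z.2.1 z.1 z.2.2 ^ 2) :=
    (p.measurable_regression.pow_const 2).ennreal_ofReal
  have e1 : ∫⁻ w, ENNReal.ofReal (Y w ^ 2) ∂q.P =
      ∫⁻ o, ENNReal.ofReal (o.2.2.2 ^ 2) ∂(q.P.map obs) := by
    rw [lintegral_map (by fun_prop) measurable_obs]; rfl
  rw [e1, ← lintegral_map_obs_XTS q hr, ← lintegral_add_left (by fun_prop),
    ← lintegral_const_mul' _ _ ENNReal.ofReal_ne_top]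
  refine lintegral_mono fun o => ?_
  rw [← ENNReal.ofReal_add (sq_nonneg _) (sq_nonneg _), ← ENNReal.ofReal_mul (by positivity)]
  refine ENNReal.ofReal_le_ofReal ?_
  have h1 : p.ipWeight ε o.1 o.2.1 ^ 2 ≤ (ε⁻¹) ^ 2 :=
    sq_le_sq' (by linarith [(abs_le.1 (p.abs_ipWeight_le hε0 hε o.1 o.2.1)).1])
      (abs_le.1 (p.abs_ipWeight_le hε0 hε o.1 o.2.1)).2
  rw [residual, mul_pow]
  calc _ ≤ (ε⁻¹) ^ 2 * (2 * (o.2.2.2 ^ 2 + p.regression o.2.1 o.1 o.2.2.1 ^ 2)) := by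
        refine mul_le_mul h1 ?_ (sq_nonneg _) (sq_nonneg _)
        nlinarith [sq_nonneg (o.2.2.2 + p.regression o.2.1 o.1 o.2.2.1)]
    _ = _ := by ring

variable [StandardBorelSpace 𝒳] [StandardBorelSpace 𝒮] {ε : ℝ} {C : ℝ≥0}

theorem lintegral_residual_sq_ne_top {p : Population 𝒳 𝒮} (hp : Assumptions ε C p)
    (hε0 : 0 < ε) (hε : ε < 1 / 2) :
    ∫⁻ o, ENNReal.ofReal (p.residual ε o ^ 2) ∂(p.P.map obs) ≠ ∞ := by
  refine ne_top_of_le_ne_top ?_ (lintegral_residual_sq_le p p hε0 hε)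
  exact ENNReal.mul_ne_top ENNReal.ofReal_ne_top (ENNReal.add_ne_top.2
    ⟨lintegral_Y_sq_ne_top hp, lintegral_regression_sq_ne_top hp⟩)

/-- The efficient influence function is square integrable. -/
theorem memLp_psi {p : Population 𝒳 𝒮} (hp : Assumptions ε C p)
    (hε0 : 0 < ε) (hε : ε < 1 / 2) : MemLp p.psi 2 p.Q := by
  have hl : Measurable fun o : Obs 𝒳 𝒮 => p.clippedRatio C o.1 :=
    (p.measurable_clippedRatio C).comp measurable_fst
  refine (memLp_congr_ae (psi_ae_eq hp)).2
    ⟨(hl.mul (p.measurable_residual ε)).aestronglyMeasurable, ?_⟩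
  rw [eLpNorm_two_eq]
  refine ENNReal.rpow_lt_top_of_nonneg (by norm_num) ?_
  refine ne_top_of_le_ne_top (ENNReal.mul_ne_top (ENNReal.coe_ne_top (r := C))
    (lintegral_residual_sq_ne_top hp hε0 hε)) ?_
  rw [map_obs_P_eq_clipped hp, lintegral_withDensity_eq_lintegral_mul _ (by fun_prop)
    ((p.measurable_residual ε).pow_const 2).ennreal_ofReal,
    ← lintegral_const_mul' _ _ ENNReal.coe_ne_top]
  refine lintegral_mono fun o => ?_
  simp only [Pi.mul_apply]
  rw [← ENNReal.ofReal_mul (p.clippedRatio_nonneg C _), ← ENNReal.ofReal_coe_nnreal,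
    ← ENNReal.ofReal_mul C.coe_nonneg]
  refine ENNReal.ofReal_le_ofReal ?_
  -- Of the two factors of the ratio, one is bounded by `C` and the other turns $Q$ into the law
  -- under $\mathbb P$, where the residual is square integrable.
  rw [mul_pow, sq (p.clippedRatio C o.1), mul_assoc]
  exact mul_le_mul_of_nonneg_right (p.clippedRatio_le C _)
    (mul_nonneg (p.clippedRatio_nonneg C _) (sq_nonneg _))

/-- In the model, the average treatment effect is a mean residual plus a known constant. -/
theorem ate_eq_integral_residual {p q : Population 𝒳 𝒮} (hp : Assumptions ε C p)
    (hq : Assumptions ε C q) (h : q.lawXTS = p.lawXTS) (hε0 : 0 < ε) (hε : ε < 1 / 2) :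
    q.ate = ∫ o, p.residual ε o ∂(q.P.map obs) +
      ∫ z, p.ipWeight ε z.1 z.2.1 * p.regression z.2.1 z.1 z.2.2 ∂p.lawXTS := by
  have hw : q.ipWeight = p.ipWeight := by
    funext ε x t
    simp [ipWeight, clippedPropensity_congr (propensity_eq_of_lawXTS_eq h)]
  have hk : Measurable fun w : Full 𝒳 𝒮 => (X w, T w, S w) :=
    measurable_X.prodMk (measurable_T.prodMk measurable_S)
  have hwm : Measurable fun z : 𝒳 × Bool × 𝒮 => p.ipWeight ε z.1 z.2.1 :=
    (p.measurable_ipWeight ε).comp (g := fun z : 𝒳 × Bool => p.ipWeight ε z.1 z.2)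
      (f := fun z : 𝒳 × Bool × 𝒮 => (z.1, z.2.1)) (by fun_prop)
  have hrm := p.measurable_regression
  have hwr : Measurable fun z : 𝒳 × Bool × 𝒮 =>
    p.ipWeight ε z.1 z.2.1 * p.regression z.2.1 z.1 z.2.2 := hwm.mul hrm
  have hr2 : MemLp (fun z : 𝒳 × Bool × 𝒮 => p.regression z.2.1 z.1 z.2.2) 2 q.lawXTS := by
    refine ⟨hrm.aestronglyMeasurable, ?_⟩
    rw [eLpNorm_two_eq, h]
    exact ENNReal.rpow_lt_top_of_nonneg (by norm_num) (lintegral_regression_sq_ne_top hp)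
  have : IsFiniteMeasure q.lawXTS := by unfold lawXTS; infer_instance
  have hr1 : Integrable (fun w => p.regression (T w) (X w) (S w)) q.P :=
    (integrable_map_measure hrm.aestronglyMeasurable hk.aemeasurable).1
      (hr2.integrable (by norm_num))
  have i1 := integrable_ipWeight_mul (q := p) hε0 hε ((memLp_Y hq).integrable (by norm_num))
  have i2 := integrable_ipWeight_mul (q := p) hε0 hε hr1
  rw [ate_eq_integral_ipWeight hq hε0 hε, hw, ← h,
    integral_map measurable_obs.aemeasurable (p.measurable_residual ε).aestronglyMeasurable,
    lawXTS, integral_map hk.aemeasurable hwr.aestronglyMeasurable]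
  have e : ∀ w : Full 𝒳 𝒮, p.residual ε (obs w) = p.ipWeight ε (X w) (T w) * Y w -
      p.ipWeight ε (X w) (T w) * p.regression (T w) (X w) (S w) := fun w => by
    simp only [residual, obs]; ring
  simp only [e]
  rw [integral_sub i1 i2]
  simp

end Population

end

/-! ### Differentiability of the effect along smooth submodels. -/

noncomputable section

theorem withDensity_sqrt_rnDeriv {Ω : Type*} [MeasurableSpace Ω] {Q μ : Measure Ω}
    [IsFiniteMeasure Q] [SigmaFinite μ] (h : Q ≪ μ) :
    μ.withDensity (fun o => ENNReal.ofReal (√(Q.rnDeriv μ o).toReal ^ 2)) = Q := by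
  conv_rhs => rw [← Measure.withDensity_rnDeriv_eq Q μ h]
  refine withDensity_congr_ae ?_
  filter_upwards [Q.rnDeriv_lt_top μ] with o ho
  rw [Real.sq_sqrt ENNReal.toReal_nonneg, ENNReal.ofReal_toReal ho.ne]

theorem integral_withDensity_ofReal {Ω : Type*} [MeasurableSpace Ω] {μ : Measure Ω} {r : Ω → ℝ}
    (hr : Measurable r) (hr0 : ∀ o, 0 ≤ r o) (f : Ω → ℝ) :
    ∫ o, f o ∂μ.withDensity (fun o => ENNReal.ofReal (r o)) = ∫ o, r o * f o ∂μ := by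
  rw [integral_withDensity_eq_integral_toReal_smul hr.ennreal_ofReal (by simp)]
  simp only [ENNReal.toReal_ofReal (hr0 _), smul_eq_mul]

namespace Population

variable {𝒳 𝒮 : Type*} [MeasurableSpace 𝒳] [MeasurableSpace 𝒮]
  [StandardBorelSpace 𝒳] [StandardBorelSpace 𝒮] {ε : ℝ} {C : ℝ≥0}

/-- Along every smooth submodel the average treatment effect is differentiable, and its derivative
is the inner product of `ψ̃` with the score. -/
theorem hasDerivAt_ate {p : Population 𝒳 𝒮} (hp : Assumptions ε C p)
    (hε0 : 0 < ε) (hε : ε < 1 / 2) {γ : ℝ → Population 𝒳 𝒮} {g : Lp ℝ 2 p.Q}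
    (hγ : IsSmoothSubmodel (model ε C p) p γ g) :
    HasDerivAt (fun θ => (γ θ).ate) (∫ o, p.psi o * g o ∂p.Q) 0 := by
  obtain ⟨μ, _, hac, hsc⟩ := hγ.score
  obtain ⟨K, hK⟩ := hγ.moment
  have hA : ∀ θ, Assumptions ε C (γ θ) := fun θ => (hγ.mem θ).1
  have hX : ∀ θ, (γ θ).lawXTS = p.lawXTS := fun θ => (hγ.mem θ).2
  set a : ℝ → Obs 𝒳 𝒮 → ℝ := fun θ o => √((γ θ).Q.rnDeriv μ o).toReal with ha
  have ham : ∀ θ, Measurable (a θ) := fun θ => (Measure.measurable_rnDeriv _ _).ennreal_toReal.sqrt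
  have hasq : ∀ θ, Measurable fun o => ENNReal.ofReal (a θ o ^ 2) := fun θ =>
    ((ham θ).pow_const 2).ennreal_ofReal
  have hQ : ∀ θ, μ.withDensity (fun o => ENNReal.ofReal (a θ o ^ 2)) = (γ θ).Q := fun θ =>
    withDensity_sqrt_rnDeriv (hac θ)
  set l : ℝ → 𝒳 → ℝ := fun θ => (γ θ).clippedRatio C with hl
  have hl0 : ∀ θ x, 0 ≤ l θ x := fun θ x => (γ θ).clippedRatio_nonneg C x
  have hlm : ∀ θ, Measurable (l θ) := fun θ => (γ θ).measurable_clippedRatio C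
  have hlm' : ∀ θ, Measurable fun o : Obs 𝒳 𝒮 => ENNReal.ofReal (l θ o.1) := fun θ =>
    ((hlm θ).comp measurable_fst).ennreal_ofReal
  have hPQ : ∀ θ, μ.withDensity (fun o => ENNReal.ofReal (l θ o.1 * a θ o ^ 2)) =
      (γ θ).P.map obs := fun θ => by
    rw [map_obs_P_eq_clipped (hA θ), ← hQ θ, ← withDensity_mul _ (hasq θ) (hlm' θ)]
    congr 1; ext o
    rw [Pi.mul_apply, ENNReal.ofReal_mul (hl0 _ _), mul_comm]
  have hla : ∀ θ, Measurable fun o : Obs 𝒳 𝒮 => l θ o.1 * a θ o ^ 2 := fun θ =>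
    ((hlm θ).comp measurable_fst).mul ((ham θ).pow_const 2)
  have hfm := p.measurable_residual ε
  -- The population `γ 0` need not be `p`; only the observed law and the law of $(X,T,S)$ agree, and
  -- these determine the ratio.
  have hl00 : l 0 = p.clippedRatio C := by
    simp only [hl]
    rw [clippedRatio_congr (lawX_eq_of_lawXTS_eq (hX 0)) (lawXLabelled_eq_of_Q_eq hγ.base)]
  have hQ0 : μ.withDensity (fun o => ENNReal.ofReal (a 0 o ^ 2)) = p.Q := (hQ 0).trans hγ.base
  have hint0 : ∀ f : Obs 𝒳 𝒮 → ℝ, ∫ o, f o ∂p.Q = ∫ o, a 0 o ^ 2 * f o ∂μ := fun f => by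
    rw [← hQ0, integral_withDensity_ofReal ((ham 0).pow_const 2) fun o => sq_nonneg _]
  have hlint0 : ∀ f : Obs 𝒳 𝒮 → ℝ≥0∞, Measurable f →
      ∫⁻ o, f o ∂p.Q = ∫⁻ o, ENNReal.ofReal (a 0 o ^ 2) * f o ∂μ := fun f hf => by
    rw [← hQ0, lintegral_withDensity_eq_lintegral_mul _ (hasq 0) hf]
    rfl
  have hgm : Measurable g := (Lp.stronglyMeasurable g).measurable
  have ha1 : ∀ θ, eLpNorm (a θ) 2 μ ≤ 1 := fun θ => by
    have h1 : ∫⁻ o, ENNReal.ofReal (a θ o ^ 2) ∂μ = 1 := by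
      have := measure_univ (μ := (γ θ).Q)
      rwa [← hQ θ, withDensity_apply _ MeasurableSet.univ, Measure.restrict_univ] at this
    rw [eLpNorm_two_eq, h1]; simp
  -- A bound for the residual's second moment that is uniform in `θ`: one `K` for each potential
  -- outcome, and the regression term under the law of $(X,T,S)$, which does not move.
  set B := ENNReal.ofReal (2 * (ε⁻¹) ^ 2) * (ENNReal.ofReal K + ENNReal.ofReal K +
    ∫⁻ z, ENNReal.ofReal (p.regression z.2.1 z.1 z.2.2 ^ 2) ∂p.lawXTS) with hB
  have hBfin : B ≠ ∞ := ENNReal.mul_ne_top ENNReal.ofReal_ne_top (ENNReal.add_ne_top.2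
    ⟨by finiteness, lintegral_regression_sq_ne_top hp⟩)
  have hres : ∀ θ, ∫⁻ o, ENNReal.ofReal (p.residual ε o ^ 2) ∂((γ θ).P.map obs) ≤ B := fun θ => by
    refine (lintegral_residual_sq_le p (γ θ) hε0 hε).trans ?_
    rw [hX θ]
    refine mul_le_mul_right (add_le_add ((lintegral_Y_sq_le _).trans ?_) le_rfl) _
    rw [lintegral_outcome_sq (hA θ), lintegral_outcome_sq (hA θ)]
    gcongr <;> exact hK θ _
  have hKf : ∀ θ, eLpNorm (fun o => p.residual ε o * (√(l θ o.1) * a θ o)) 2 μ ≤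
      ((B ^ (1 / 2 : ℝ)).toNNReal : ℝ≥0∞) := fun θ => by
    rw [ENNReal.coe_toNNReal (ENNReal.rpow_ne_top_of_nonneg (by norm_num) hBfin), eLpNorm_two_eq]
    refine ENNReal.rpow_le_rpow ((le_of_eq ?_).trans (hres θ)) (by norm_num)
    rw [← hPQ θ, lintegral_withDensity_eq_lintegral_mul _ (hla θ).ennreal_ofReal
      (hfm.pow_const 2).ennreal_ofReal]
    refine lintegral_congr fun o => ?_
    simp only [Pi.mul_apply]
    rw [← ENNReal.ofReal_mul (mul_nonneg (hl0 _ _) (sq_nonneg _)), mul_pow, mul_pow,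
      Real.sq_sqrt (hl0 _ _)]
    congr 1; ring
  have hfi : Integrable (fun o => p.residual ε o * a 0 o ^ 2) μ := by
    have h1 := integrable_residual_Q hp.outcome_integrable hε0 hε
    rw [← hQ0, integrable_withDensity_iff_integrable_smul' (hasq 0) (by simp)] at h1
    refine h1.congr (ae_of_all _ fun o => ?_)
    simp only [smul_eq_mul]
    rw [ENNReal.toReal_ofReal (sq_nonneg _), mul_comm]
  have hg2 : eLpNorm (fun o => g o * a 0 o) 2 μ ≠ ∞ := by
    have h1 : eLpNorm g 2 p.Q ≠ ∞ := (Lp.memLp g).2.ne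
    have h2 : eLpNorm (fun o => g o * a 0 o) 2 μ = eLpNorm g 2 p.Q := by
      rw [eLpNorm_two_eq, eLpNorm_two_eq, hlint0 _ (hgm.pow_const 2).ennreal_ofReal]
      congr 1
      refine lintegral_congr fun o => ?_
      rw [← ENNReal.ofReal_mul (sq_nonneg _), mul_pow, mul_comm]
    rwa [h2]
  have hmain := hasDerivAt_weighted_integral (μ := μ) (π := Prod.fst) measurable_fst ham ha1 hlm hl0
    C.coe_nonneg (fun θ x => (γ θ).clippedRatio_le C x) (P := p.lawX)
    (fun θ => by rw [hPQ θ, map_obs_map_fst, lawX_eq_of_lawXTS_eq (hX θ)])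
    hfm hKf hfi
    (fun u hu hc => by
      have := integral_mul_residual hp.outcome_integrable hε0 hε hu hc
      rw [hint0] at this
      refine Eq.trans (integral_congr_ae (ae_of_all _ fun o => ?_)) this
      simp only; ring)
    hgm hg2 (by
      simp only [eLpNorm_two_eq]
      have := hsc.ennrpow_const (1 / 2 : ℝ)
      simpa using this)
  have hval : ∫ o, l 0 o.1 * p.residual ε o * g o * a 0 o ^ 2 ∂μ = ∫ o, p.psi o * g o ∂p.Q := by
    have h1 : ∫ o, p.psi o * g o ∂p.Q =
        ∫ o, p.clippedRatio C o.1 * p.residual ε o * g o ∂p.Q := by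
      refine integral_congr_ae ?_
      filter_upwards [psi_ae_eq hp] with o ho
      rw [ho]
    rw [h1, hint0, hl00]
    refine integral_congr_ae (ae_of_all _ fun o => ?_)
    simp only; ring
  rw [hval] at hmain
  refine (hmain.add_const (∫ z, p.ipWeight ε z.1 z.2.1 * p.regression z.2.1 z.1 z.2.2
    ∂p.lawXTS)).congr_of_eventuallyEq (Eventually.of_forall fun θ => ?_)
  simp only
  rw [ate_eq_integral_residual hp (hA θ) (hX θ) hε0 hε, ← hPQ θ,
    integral_withDensity_ofReal (hla θ) fun o => mul_nonneg (hl0 _ _) (sq_nonneg _)]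
  congr 1
  refine integral_congr_ae (ae_of_all _ fun o => ?_)
  simp only; ring

end Population

end

/-! ### Populations built from prescribed conditional laws. -/

noncomputable section

namespace Population

variable {𝒳 𝒮 : Type*} [MeasurableSpace 𝒳] [MeasurableSpace 𝒮]

section OfKernels

variable (ν : Bool → ProbabilityMeasure 𝒳) (τ : Kernel 𝒳 Bool) [IsMarkovKernel τ]
  (σ : Kernel (𝒳 × Bool) 𝒮) [IsMarkovKernel σ] (κ : Kernel (𝒳 × Bool × 𝒮) ℝ) [IsMarkovKernel κ]

/-- The joint law of the surrogate and the outcome under treatment `a` given the covariates. -/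
def arm (a : Bool) : Kernel 𝒳 (𝒮 × ℝ) :=
  (σ.comap (fun x => (x, a)) (by fun_prop)) ⊗ₖ
    (κ.comap (fun z : 𝒳 × 𝒮 => (z.1, a, z.2)) (by fun_prop))

instance (a : Bool) : IsMarkovKernel (arm σ κ a) := by unfold arm; infer_instance

theorem lintegral_arm (a : Bool) (x : 𝒳)
    {F : 𝒮 × ℝ → ℝ≥0∞} (hF : Measurable F) :
    ∫⁻ z, F z ∂arm σ κ a x = ∫⁻ s, ∫⁻ y, F (s, y) ∂κ (x, a, s) ∂σ (x, a) := by
  rw [arm, Kernel.lintegral_compProd _ _ _ hF]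
  rfl

/-- Build a unit from its covariates, its treatment and its two arms. -/
def assemble (z : 𝒳 × Bool × (𝒮 × ℝ) × (𝒮 × ℝ)) : Unlabelled 𝒳 𝒮 :=
  (z.1, z.2.1, fun a => if a then z.2.2.1.1 else z.2.2.2.1,
    fun a => if a then z.2.2.1.2 else z.2.2.2.2)

theorem measurable_assemble : Measurable (assemble : _ → Unlabelled 𝒳 𝒮) := by
  refine measurable_fst.prodMk ((measurable_fst.comp measurable_snd).prodMk (Measurable.prodMk ?_ ?_))
  · exact measurable_pi_lambda _ fun a => by cases a <;> simp <;> fun_prop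
  · exact measurable_pi_lambda _ fun a => by cases a <;> simp <;> fun_prop

/-- The law of a unit whose treatment and arms are independent given the covariates. -/
def unitLaw (m : Measure 𝒳) : Measure (Unlabelled 𝒳 𝒮) :=
  (m ⊗ₘ (τ ×ₖ (arm σ κ true ×ₖ arm σ κ false))).map assemble

instance (m : Measure 𝒳) [IsProbabilityMeasure m] : IsProbabilityMeasure (unitLaw τ σ κ m) :=
  Measure.isProbabilityMeasure_map measurable_assemble.aemeasurable

/-- The population without labelled units in which both labels share the conditional laws of the
treatment, the surrogates and the outcomes given the covariates. -/
def ofKernels : Population 𝒳 𝒮 where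
  -- Then $\mathbb P$ is the law given $R=0$, and the covariate laws under $\mathbb P$ and given
  -- $R=1$ can be prescribed separately. A positive probability would force $\lambda^*$ to be
  -- bounded below.
  labelProb := 0
  law ℓ := ⟨unitLaw τ σ κ (ν ℓ : Measure 𝒳), inferInstance⟩

theorem P_ofKernels : (ofKernels ν τ σ κ).P = (ofKernels ν τ σ κ).given false := by
  rw [P, mix_eq]
  simp [weight, ofKernels]

theorem lintegral_given_ofKernels (ℓ a : Bool) {H : 𝒳 × Bool × 𝒮 × ℝ → ℝ≥0∞}
    (hH : Measurable H) :
    ∫⁻ w, H (X w, T w, Spot a w, Ypot a w) ∂(ofKernels ν τ σ κ).given ℓ =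
      ∫⁻ x, ∫⁻ t, ∫⁻ z, H (x, t, z) ∂arm σ κ a x ∂τ x ∂(ν ℓ : Measure 𝒳) := by
  have hm : Measurable fun w : Full 𝒳 𝒮 => H (X w, T w, Spot a w, Ypot a w) :=
    hH.comp (measurable_X.prodMk (measurable_T.prodMk
      ((measurable_Spot a).prodMk (measurable_Ypot a))))
  have hg : (ofKernels ν τ σ κ).given ℓ =
      (unitLaw τ σ κ (ν ℓ : Measure 𝒳)).map fun u => (u, ℓ) := by
    rw [given, Measure.prod_dirac]; rfl
  have hm1 : Measurable fun u : Unlabelled 𝒳 𝒮 =>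
      H (X (u, ℓ), T (u, ℓ), Spot a (u, ℓ), Ypot a (u, ℓ)) :=
    hm.comp (f := fun u => (u, ℓ)) (by fun_prop)
  have hm2 : Measurable fun z : 𝒳 × Bool × (𝒮 × ℝ) × (𝒮 × ℝ) => H (X (assemble z, ℓ),
      T (assemble z, ℓ), Spot a (assemble z, ℓ), Ypot a (assemble z, ℓ)) :=
    hm1.comp measurable_assemble
  rw [hg, lintegral_map hm (by fun_prop), unitLaw, lintegral_map hm1 measurable_assemble,
    Measure.lintegral_compProd hm2]
  refine lintegral_congr fun x => ?_
  cases a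
  · calc _ = ∫⁻ t, ∫⁻ z, H (x, t, z.2) ∂(arm σ κ true x).prod (arm σ κ false x) ∂τ x := by
          rw [Kernel.prod_apply, lintegral_prod]
          · simp only [Kernel.prod_apply]; rfl
          · exact (hm1.comp (measurable_assemble.comp measurable_prodMk_left)).aemeasurable
      _ = _ := by
          refine lintegral_congr fun t => ?_
          rw [lintegral_prod _ (by fun_prop)]
          simp
  · calc _ = ∫⁻ t, ∫⁻ z, H (x, t, z.1) ∂(arm σ κ true x).prod (arm σ κ false x) ∂τ x := by
          rw [Kernel.prod_apply, lintegral_prod]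
          · simp only [Kernel.prod_apply]; rfl
          · exact (hm1.comp (measurable_assemble.comp measurable_prodMk_left)).aemeasurable
      _ = _ := by
          refine lintegral_congr fun t => ?_
          rw [lintegral_prod _ (by fun_prop)]
          simp

theorem lintegral_X_ofKernels (ℓ : Bool) {H : 𝒳 → ℝ≥0∞} (hH : Measurable H) :
    ∫⁻ w, H (X w) ∂(ofKernels ν τ σ κ).given ℓ = ∫⁻ x, H x ∂(ν ℓ : Measure 𝒳) := by
  have := lintegral_given_ofKernels ν τ σ κ ℓ true (H := fun z => H z.1) (by fun_prop)
  simpa only [lintegral_const, measure_univ, mul_one] using this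

theorem map_X_ofKernels (ℓ : Bool) :
    ((ofKernels ν τ σ κ).given ℓ).map X = (ν ℓ : Measure 𝒳) := by
  refine Measure.ext_of_lintegral _ fun F hF => ?_
  rw [lintegral_map hF measurable_X, lintegral_X_ofKernels ν τ σ κ ℓ hF]

theorem hasCondLaw_treatment_ofKernels (ℓ : Bool) :
    HasCondLaw ((ofKernels ν τ σ κ).given ℓ) X T τ := fun F hF => by
  have h1 := lintegral_given_ofKernels ν τ σ κ ℓ true (H := fun z => F (z.1, z.2.1)) (by fun_prop)
  have h2 : Measurable fun x => ∫⁻ t, F (x, t) ∂τ x :=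
    Measurable.lintegral_kernel_prod_right (f := fun x t => F (x, t)) (by exact hF)
  rw [lintegral_X_ofKernels ν τ σ κ ℓ h2, h1]
  simp

/-- Given $X$ the treatment and the arms are drawn independently, so the claim is Tonelli's theorem.
-/
theorem hasCondLaw_unconfounded_ofKernels (ℓ a : Bool) :
    HasCondLaw ((ofKernels ν τ σ κ).given ℓ) (fun w => (X w, (Ypot a w, Spot a w))) T
      (τ.prodMkRight (ℝ × 𝒮)) := fun F hF => by
  have h1 := lintegral_given_ofKernels ν τ σ κ ℓ a
    (H := fun z => F ((z.1, (z.2.2.2, z.2.2.1)), z.2.1)) (by fun_prop)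
  have h2 : Measurable fun z : 𝒳 × Bool × 𝒮 × ℝ =>
      ∫⁻ t, F ((z.1, (z.2.2.2, z.2.2.1)), t) ∂τ z.1 :=
    Measurable.lintegral_kernel_prod_right
      (κ := τ.comap (fun z : 𝒳 × Bool × 𝒮 × ℝ => z.1) measurable_fst)
      (f := fun z t => F ((z.1, (z.2.2.2, z.2.2.1)), t)) (by unfold Function.uncurry; fun_prop)
  have h3 := lintegral_given_ofKernels ν τ σ κ ℓ a h2
  refine h1.trans (Eq.trans ?_ h3.symm)
  refine lintegral_congr fun x => ?_
  simp only [lintegral_const, measure_univ, mul_one]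
  exact lintegral_lintegral_swap (by unfold Function.uncurry; fun_prop)

/-- The kernel ignores the realised treatment, and it is the same for both labels, which is what
condition (iii) requires. -/
theorem hasCondLaw_surrogate_ofKernels (ℓ a : Bool) :
    HasCondLaw ((ofKernels ν τ σ κ).given ℓ) (fun w => (T w, X w)) (Spot a)
      (σ.comap (fun z : Bool × 𝒳 => (z.2, a)) (by fun_prop)) := fun F hF => by
  have h1 := lintegral_given_ofKernels ν τ σ κ ℓ a
    (H := fun z => F ((z.2.1, z.1), z.2.2.1)) (by fun_prop)
  have h2 : Measurable fun z : 𝒳 × Bool × 𝒮 × ℝ => ∫⁻ s, F ((z.2.1, z.1), s) ∂σ (z.1, a) :=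
    Measurable.lintegral_kernel_prod_right
      (κ := σ.comap (fun z : 𝒳 × Bool × 𝒮 × ℝ => (z.1, a)) (by fun_prop))
      (f := fun z s => F ((z.2.1, z.1), s)) (by unfold Function.uncurry; fun_prop)
  have h3 := lintegral_given_ofKernels ν τ σ κ ℓ a h2
  refine h1.trans (Eq.trans ?_ h3.symm)
  refine lintegral_congr fun x => lintegral_congr fun t => ?_
  rw [lintegral_arm σ κ a x (by fun_prop)]
  simp

theorem hasCondLaw_outcome_ofKernels (ℓ a : Bool) :
    HasCondLaw (((ofKernels ν τ σ κ).given ℓ).restrict {w | T w = a})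
      (fun w => (X w, Spot a w)) (Ypot a)
      (κ.comap (fun z : 𝒳 × 𝒮 => (z.1, a, z.2)) (by fun_prop)) := fun F hF => by
  have h1 := lintegral_given_ofKernels ν τ σ κ ℓ a
    (H := fun z => (if z.2.1 = a then 1 else 0) * F ((z.1, z.2.2.1), z.2.2.2))
    ((measurable_ite_bool a (by fun_prop)).mul (by fun_prop))
  have h2 : Measurable fun z : 𝒳 × 𝒮 => ∫⁻ y, F (z, y) ∂κ (z.1, a, z.2) :=
    Measurable.lintegral_kernel_prod_right
      (κ := κ.comap (fun z : 𝒳 × 𝒮 => (z.1, a, z.2)) (by fun_prop))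
      (f := fun z y => F (z, y)) (by exact hF)
  have h3 := lintegral_given_ofKernels ν τ σ κ ℓ a
    (H := fun z => (if z.2.1 = a then 1 else 0) * ∫⁻ y, F ((z.1, z.2.2.1), y) ∂κ (z.1, a, z.2.2.1))
    ((measurable_ite_bool a (by fun_prop)).mul
      (h2.comp (f := fun z : 𝒳 × Bool × 𝒮 × ℝ => (z.1, z.2.2.1)) (by fun_prop)))
  have e : ∀ G : Full 𝒳 𝒮 → ℝ≥0∞, ∫⁻ w in {w | T w = a}, G w ∂(ofKernels ν τ σ κ).given ℓ =
      ∫⁻ w, (if T w = a then 1 else 0) * G w ∂(ofKernels ν τ σ κ).given ℓ :=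
    fun G => lintegral_treated_eq _ a G
  rw [e, e]
  refine h1.trans (Eq.trans ?_ h3.symm)
  refine lintegral_congr fun x => lintegral_congr fun t => ?_
  have hx : Measurable fun s => ∫⁻ y, F ((x, s), y) ∂κ (x, a, s) :=
    h2.comp (f := fun s => (x, s)) (by fun_prop)
  by_cases h : t = a
  · simp only [h, if_true, one_mul]
    rw [lintegral_arm σ κ a x (F := fun z => F ((x, z.1), z.2)) (by fun_prop),
      lintegral_arm σ κ a x (F := fun z => ∫⁻ y, F ((x, z.1), y) ∂κ (x, a, z.1))
        (hx.comp measurable_fst)]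
    simp only [lintegral_const, measure_univ, mul_one]
  · simp [h]

/-- Only the arm selected by the treatment is observed; the arm that is not selected integrates to
one, whatever its coupling. -/
theorem lintegral_obs_ofKernels (ℓ : Bool) {G : Obs 𝒳 𝒮 → ℝ≥0∞} (hG : Measurable G) :
    ∫⁻ w, G (obs w) ∂(ofKernels ν τ σ κ).given ℓ =
      ∫⁻ x, ∫⁻ t, ∫⁻ s, ∫⁻ y, G (x, t, s, y) ∂κ (x, t, s) ∂σ (x, t) ∂τ x ∂(ν ℓ : Measure 𝒳) := by
  set p := ofKernels ν τ σ κ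
  have h1 : ∀ a, ∫⁻ w in T ⁻¹' {a}, G (obs w) ∂p.given ℓ = ∫⁻ x, ∫⁻ t, (if t = a then 1 else 0) *
      ∫⁻ s, ∫⁻ y, G (x, a, s, y) ∂κ (x, a, s) ∂σ (x, a) ∂τ x ∂(ν ℓ : Measure 𝒳) := by
    intro a
    have h2 := lintegral_given_ofKernels ν τ σ κ ℓ a
      (H := fun z => (if z.2.1 = a then 1 else 0) * G (z.1, a, z.2.2))
      ((measurable_ite_bool a (by fun_prop)).mul (by fun_prop))
    rw [lintegral_treated_eq]
    refine Eq.trans (lintegral_congr fun w => ?_) (h2.trans ?_)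
    · by_cases h : T w = a
      · simp [h, obs, S, Y]
      · simp [h]
    · refine lintegral_congr fun x => lintegral_congr fun t => ?_
      by_cases h : t = a
      · simp only [h, if_true, one_mul]
        exact lintegral_arm σ κ a x (F := fun z => G (x, a, z)) (by fun_prop)
      · simp [h]
  rw [lintegral_bool_split _ measurable_T, h1, h1, ← lintegral_add_left]
  · refine lintegral_congr fun x => ?_
    rw [← lintegral_add_left Measurable.of_discrete]
    refine lintegral_congr fun t => ?_
    cases t <;> simp
  · have h3 : Measurable fun z : 𝒳 × 𝒮 => ∫⁻ y, G (z.1, true, z.2, y) ∂κ (z.1, true, z.2) :=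
      Measurable.lintegral_kernel_prod_right
        (κ := κ.comap (fun z : 𝒳 × 𝒮 => (z.1, true, z.2)) (by fun_prop))
        (f := fun z y => G (z.1, true, z.2, y)) (by unfold Function.uncurry; fun_prop)
    have h4 : Measurable fun x => ∫⁻ s, ∫⁻ y, G (x, true, s, y) ∂κ (x, true, s) ∂σ (x, true) :=
      Measurable.lintegral_kernel_prod_right
        (κ := σ.comap (fun x : 𝒳 => (x, true)) (by fun_prop))
        (f := fun x s => ∫⁻ y, G (x, true, s, y) ∂κ (x, true, s)) (by exact h3)
    exact Measurable.lintegral_kernel_prod_right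
      (f := fun (x : 𝒳) (t : Bool) => (if t = true then 1 else 0) *
        ∫⁻ s, ∫⁻ y, G (x, true, s, y) ∂κ (x, true, s) ∂σ (x, true))
      ((measurable_ite_bool true measurable_snd).mul (h4.comp measurable_fst))

end OfKernels

end Population

end

/-! ### Tilting the conditional law of the outcome inside the model. -/

noncomputable section

namespace Population

variable {𝒳 𝒮 : Type*} [MeasurableSpace 𝒳] [MeasurableSpace 𝒮]

/-- Integration of a function of the observed variables given the covariates. -/
def chainIntegral (τ : Kernel 𝒳 Bool) (σ : Kernel (𝒳 × Bool) 𝒮) (κ : Kernel (𝒳 × Bool × 𝒮) ℝ)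
    (G : Obs 𝒳 𝒮 → ℝ≥0∞) (x : 𝒳) : ℝ≥0∞ :=
  ∫⁻ t, ∫⁻ s, ∫⁻ y, G (x, t, s, y) ∂κ (x, t, s) ∂σ (x, t) ∂τ x

section ChainIntegral

variable (τ : Kernel 𝒳 Bool) [IsMarkovKernel τ] (σ : Kernel (𝒳 × Bool) 𝒮) [IsMarkovKernel σ]
  (κ : Kernel (𝒳 × Bool × 𝒮) ℝ) [IsMarkovKernel κ] {G : Obs 𝒳 𝒮 → ℝ≥0∞}

theorem measurable_chainIntegral_outcome (hG : Measurable G) :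
    Measurable fun z : 𝒳 × Bool × 𝒮 => ∫⁻ y, G (z.1, z.2.1, z.2.2, y) ∂κ z :=
  Measurable.lintegral_kernel_prod_right (κ := κ)
    (f := fun z y => G (z.1, z.2.1, z.2.2, y)) (by unfold Function.uncurry; fun_prop)

theorem measurable_chainIntegral_surrogate (hG : Measurable G) :
    Measurable fun z : 𝒳 × Bool =>
      ∫⁻ s, ∫⁻ y, G (z.1, z.2, s, y) ∂κ (z.1, z.2, s) ∂σ z := by
  have h := measurable_chainIntegral_outcome κ hG
  exact Measurable.lintegral_kernel_prod_right (κ := σ)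
    (f := fun z s => ∫⁻ y, G (z.1, z.2, s, y) ∂κ (z.1, z.2, s))
    (h.comp (f := fun z : (𝒳 × Bool) × 𝒮 => (z.1.1, z.1.2, z.2)) (by fun_prop))

theorem measurable_chainIntegral (hG : Measurable G) :
    Measurable (chainIntegral τ σ κ G) :=
  Measurable.lintegral_kernel_prod_right (κ := τ)
    (f := fun x t => ∫⁻ s, ∫⁻ y, G (x, t, s, y) ∂κ (x, t, s) ∂σ (x, t))
    (measurable_chainIntegral_surrogate σ κ hG)

end ChainIntegral

theorem chainIntegral_const_mul (τ : Kernel 𝒳 Bool) (σ : Kernel (𝒳 × Bool) 𝒮) [IsMarkovKernel σ]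
    (κ : Kernel (𝒳 × Bool × 𝒮) ℝ) [IsMarkovKernel κ] {G : Obs 𝒳 𝒮 → ℝ≥0∞} (hG : Measurable G)
    (u : 𝒳 → ℝ≥0∞) (x : 𝒳) :
    chainIntegral τ σ κ (fun o => u o.1 * G o) x = u x * chainIntegral τ σ κ G x := by
  have h1 := measurable_chainIntegral_outcome κ hG
  have h2 := measurable_chainIntegral_surrogate σ κ hG
  have e1 : ∀ t s, ∫⁻ y, u x * G (x, t, s, y) ∂κ (x, t, s) =
      u x * ∫⁻ y, G (x, t, s, y) ∂κ (x, t, s) := fun t s =>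
    lintegral_const_mul _ (by fun_prop)
  have e2 : ∀ t, ∫⁻ s, u x * ∫⁻ y, G (x, t, s, y) ∂κ (x, t, s) ∂σ (x, t) =
      u x * ∫⁻ s, ∫⁻ y, G (x, t, s, y) ∂κ (x, t, s) ∂σ (x, t) := fun t =>
    lintegral_const_mul _ (h1.comp (f := fun s => (x, t, s)) (by fun_prop))
  simp only [chainIntegral, e1, e2]
  exact lintegral_const_mul _ Measurable.of_discrete

/-- The conditional law of `T` given `X` and `R = 1`. -/
def treatmentKernel (p : Population 𝒳 𝒮) : Kernel 𝒳 Bool := condDistrib T X (p.given true)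

instance (p : Population 𝒳 𝒮) : IsMarkovKernel p.treatmentKernel := by
  unfold treatmentKernel; infer_instance

/-- The conditional law of `Y` given `(X, T, S)` and `R = 1`, reweighted by `D`. -/
def tiltedKernel (p : Population 𝒳 𝒮) (D : Obs 𝒳 𝒮 → ℝ≥0∞) : Kernel (𝒳 × Bool × 𝒮) ℝ :=
  p.outcomeKernel.withDensity fun z y => D (z.1, z.2.1, z.2.2, y)

theorem lintegral_tiltedKernel (p : Population 𝒳 𝒮) {D : Obs 𝒳 𝒮 → ℝ≥0∞} (hD : Measurable D)
    (z : 𝒳 × Bool × 𝒮) {F : ℝ → ℝ≥0∞} (hF : Measurable F) :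
    ∫⁻ y, F y ∂p.tiltedKernel D z =
      ∫⁻ y, D (z.1, z.2.1, z.2.2, y) * F y ∂p.outcomeKernel z :=
  Kernel.lintegral_withDensity _ (by unfold Function.uncurry; fun_prop) z hF

theorem isMarkovKernel_tiltedKernel (p : Population 𝒳 𝒮) {D : Obs 𝒳 𝒮 → ℝ≥0∞}
    (hD : Measurable D)
    (h1 : ∀ z : 𝒳 × Bool × 𝒮, ∫⁻ y, D (z.1, z.2.1, z.2.2, y) ∂p.outcomeKernel z = 1) :
    IsMarkovKernel (p.tiltedKernel D) := by
  refine ⟨fun z => ⟨?_⟩⟩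
  rw [← h1 z, ← lintegral_one, p.lintegral_tiltedKernel hD z measurable_const]
  simp

theorem chainIntegral_tiltedKernel (p : Population 𝒳 𝒮) {D : Obs 𝒳 𝒮 → ℝ≥0∞} (hD : Measurable D)
    (τ : Kernel 𝒳 Bool) (σ : Kernel (𝒳 × Bool) 𝒮) {G : Obs 𝒳 𝒮 → ℝ≥0∞} (hG : Measurable G) :
    chainIntegral τ σ (p.tiltedKernel D) G =
      chainIntegral τ σ p.outcomeKernel (fun o => D o * G o) := by
  funext x
  refine lintegral_congr fun t => lintegral_congr fun s => ?_
  exact p.lintegral_tiltedKernel hD (x, t, s) (F := fun y => G (x, t, s, y)) (by fun_prop)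

variable [StandardBorelSpace 𝒮] [Nonempty 𝒮]

/-- The conditional law of `S` given `(X, T)` and `R = 1`. -/
def surrogateKernel (p : Population 𝒳 𝒮) : Kernel (𝒳 × Bool) 𝒮 :=
  condDistrib S (fun w => (X w, T w)) (p.given true)

instance (p : Population 𝒳 𝒮) : IsMarkovKernel p.surrogateKernel := by
  unfold surrogateKernel; infer_instance

theorem lintegral_Q_eq_chainIntegral (p : Population 𝒳 𝒮) {G : Obs 𝒳 𝒮 → ℝ≥0∞}
    (hG : Measurable G) :
    ∫⁻ o, G o ∂p.Q = ∫⁻ x, chainIntegral p.treatmentKernel p.surrogateKernel p.outcomeKernel G x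
      ∂p.lawXLabelled := by
  have h1 := measurable_chainIntegral_outcome p.outcomeKernel hG
  have h2 := measurable_chainIntegral_surrogate p.surrogateKernel p.outcomeKernel hG
  have h3 := measurable_chainIntegral p.treatmentKernel p.surrogateKernel p.outcomeKernel hG
  have e1 := hasCondLaw_condDistrib (ν := p.given true)
    (measurable_X.prodMk (measurable_T.prodMk measurable_S)) measurable_Y
    (fun z : (𝒳 × Bool × 𝒮) × ℝ => G (z.1.1, z.1.2.1, z.1.2.2, z.2)) (by fun_prop)
  have e2 := hasCondLaw_condDistrib (ν := p.given true)
    (measurable_X.prodMk measurable_T) measurable_S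
    (fun z : (𝒳 × Bool) × 𝒮 => ∫⁻ y, G (z.1.1, z.1.2, z.2, y) ∂p.outcomeKernel (z.1.1, z.1.2, z.2))
    (h1.comp (f := fun z : (𝒳 × Bool) × 𝒮 => (z.1.1, z.1.2, z.2)) (by fun_prop))
  have e3 := hasCondLaw_condDistrib (ν := p.given true) measurable_X measurable_T _ h2
  rw [Q, lintegral_map hG measurable_obs, lawXLabelled, lintegral_map h3 measurable_X]
  exact e1.trans (e2.trans e3)


/-- The kernels are those given $R=1$, yet they also describe $\mathbb P$: the density ratio passes
through the inner integrals and only changes the law of $X$. -/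
theorem lintegral_P_eq_chainIntegral [StandardBorelSpace 𝒳] {ε : ℝ} {C : ℝ≥0}
    {p : Population 𝒳 𝒮} (hp : Assumptions ε C p)
    {G : Obs 𝒳 𝒮 → ℝ≥0∞} (hG : Measurable G) :
    ∫⁻ o, G o ∂(p.P.map obs) =
      ∫⁻ x, chainIntegral p.treatmentKernel p.surrogateKernel p.outcomeKernel G x ∂p.lawX := by
  have hr : Measurable (p.lawX.rnDeriv p.lawXLabelled) := Measure.measurable_rnDeriv _ _
  have h3 := measurable_chainIntegral p.treatmentKernel p.surrogateKernel p.outcomeKernel hG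
  rw [map_obs_P hp, lintegral_withDensity_eq_lintegral_mul _ (by fun_prop) hG,
    lintegral_Q_eq_chainIntegral p (by fun_prop)]
  conv_rhs => rw [← Measure.withDensity_rnDeriv_eq _ _ hp.absolutelyContinuous]
  rw [lintegral_withDensity_eq_lintegral_mul _ hr h3]
  exact lintegral_congr fun x => chainIntegral_const_mul _ _ _ hG _ x

/-- The population obtained by reweighting the conditional law of the outcome. -/
def tilt (p : Population 𝒳 𝒮) (D : Obs 𝒳 𝒮 → ℝ≥0∞) [IsMarkovKernel (p.tiltedKernel D)] :
    Population 𝒳 𝒮 :=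
  -- Label $0$ receives the covariate law of the whole population, since it is the only label with
  -- positive probability here; this keeps the density ratio.
  ofKernels (fun ℓ => if ℓ then ⟨p.lawXLabelled, inferInstance⟩ else ⟨p.lawX, inferInstance⟩)
    p.treatmentKernel p.surrogateKernel (p.tiltedKernel D)

section Tilt

variable (p : Population 𝒳 𝒮) (D : Obs 𝒳 𝒮 → ℝ≥0∞) [IsMarkovKernel (p.tiltedKernel D)]

theorem lawX_tilt : (p.tilt D).lawX = p.lawX := by
  rw [lawX, tilt, P_ofKernels, map_X_ofKernels]
  rfl

theorem lawXLabelled_tilt : (p.tilt D).lawXLabelled = p.lawXLabelled := by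
  rw [lawXLabelled, tilt, map_X_ofKernels]
  rfl

variable {D}

theorem Q_tilt (hD : Measurable D) : (p.tilt D).Q = p.Q.withDensity D := by
  refine Measure.ext_of_lintegral _ fun G hG => ?_
  rw [Q, lintegral_map hG measurable_obs, tilt, lintegral_obs_ofKernels _ _ _ _ _ hG,
    lintegral_withDensity_eq_lintegral_mul _ hD hG,
    lintegral_Q_eq_chainIntegral p (hD.mul hG)]
  exact lintegral_congr fun x =>
    congrFun (p.chainIntegral_tiltedKernel hD p.treatmentKernel p.surrogateKernel hG) x

variable {p} [StandardBorelSpace 𝒳] {ε : ℝ} {C : ℝ≥0}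

theorem map_obs_P_tilt (hp : Assumptions ε C p) (hD : Measurable D) :
    (p.tilt D).P.map obs = (p.P.map obs).withDensity D := by
  refine Measure.ext_of_lintegral _ fun G hG => ?_
  rw [lintegral_map hG measurable_obs, tilt, P_ofKernels, lintegral_obs_ofKernels _ _ _ _ _ hG,
    lintegral_withDensity_eq_lintegral_mul _ hD hG,
    lintegral_P_eq_chainIntegral hp (hD.mul hG)]
  exact lintegral_congr fun x =>
    congrFun (p.chainIntegral_tiltedKernel hD p.treatmentKernel p.surrogateKernel hG) x

/-- The tilted kernel still has total mass one in the outcome, so it disappears from integrals of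
functions of $(X,T,S)$. -/
theorem lawXTS_tilt (hp : Assumptions ε C p) : (p.tilt D).lawXTS = p.lawXTS := by
  refine Measure.ext_of_lintegral _ fun F hF => ?_
  rw [← lintegral_map_obs_XTS _ hF, ← lintegral_map_obs_XTS _ hF,
    lintegral_map (by fun_prop) measurable_obs,
    lintegral_P_eq_chainIntegral hp (by fun_prop), tilt, P_ofKernels,
    lintegral_obs_ofKernels _ _ _ _ _ (G := fun o => F (o.1, o.2.1, o.2.2.1)) (by fun_prop)]
  simp only [chainIntegral, lintegral_const, measure_univ, mul_one]
  rfl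

theorem unconfounded_tilt (a : Bool) :
    CondIndepFun (MeasurableSpace.comap X inferInstance) measurable_X.comap_le
      (fun w => (Ypot a w, Spot a w)) T (p.tilt D).P := by
  refine condIndepFun_of_hasCondLaw measurable_X
    ((measurable_Ypot a).prodMk (measurable_Spot a)) measurable_T (κ := p.treatmentKernel) ?_
  rw [tilt, P_ofKernels]
  exact hasCondLaw_unconfounded_ofKernels _ _ _ _ _ _

theorem overlap_tilt (hp : Assumptions ε C p) :
    ∀ᵐ x ∂(p.tilt D).lawX, ε ≤ (p.tilt D).propensity x ∧ (p.tilt D).propensity x ≤ 1 - ε := by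
  rw [lawX_tilt, propensity_eq_of_lawXTS_eq (lawXTS_tilt hp)]
  exact hp.overlap

/-- The tilt controls the observed $Y$, at a factor $2$. To reach the potential outcome on all
units, selection on `T = a` is rewritten as weighting by a propensity of at least `ε`, at a factor
$\epsilon^{-1}$. -/
theorem lintegral_outcome_sq_tilt_le (hp : Assumptions ε C p) (hε0 : 0 < ε) (hε : ε < 1 / 2)
    (hD : Measurable D) (h2 : ∀ o, D o ≤ 2) (a : Bool) :
    ∫⁻ w, ENNReal.ofReal (Ypot a w ^ 2) ∂(p.tilt D).P ≤
      ENNReal.ofReal ε⁻¹ * (2 * ∫⁻ w, ENNReal.ofReal (Y w ^ 2) ∂p.P) := by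
  have hY : Measurable fun o : Obs 𝒳 𝒮 => ENNReal.ofReal (o.2.2.2 ^ 2) := by fun_prop
  have hYp := measurable_Ypot (𝒳 := 𝒳) (𝒮 := 𝒮) a
  have h1 : ∫⁻ w in T ⁻¹' {a}, ENNReal.ofReal (Ypot a w ^ 2) ∂(p.tilt D).P ≤
      2 * ∫⁻ w, ENNReal.ofReal (Y w ^ 2) ∂p.P := by
    calc ∫⁻ w in T ⁻¹' {a}, ENNReal.ofReal (Ypot a w ^ 2) ∂(p.tilt D).P
        = ∫⁻ w in T ⁻¹' {a}, ENNReal.ofReal (Y w ^ 2) ∂(p.tilt D).P := by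
          refine setLIntegral_congr_fun (measurable_T (measurableSet_singleton a)) fun w hw => ?_
          have : T w = a := hw
          simp only [Y, this]
      _ ≤ ∫⁻ w, ENNReal.ofReal (Y w ^ 2) ∂(p.tilt D).P := setLIntegral_le_lintegral _ _
      _ = ∫⁻ o, (D * fun o : Obs 𝒳 𝒮 => ENNReal.ofReal (o.2.2.2 ^ 2)) o ∂(p.P.map obs) := by
          rw [← lintegral_withDensity_eq_lintegral_mul _ hD hY, ← map_obs_P_tilt hp hD,
            lintegral_map hY measurable_obs]
          rfl
      _ ≤ ∫⁻ o, 2 * ENNReal.ofReal (o.2.2.2 ^ 2) ∂(p.P.map obs) :=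
          lintegral_mono fun o => mul_le_mul_left (h2 o) _
      _ = 2 * ∫⁻ w, ENNReal.ofReal (Y w ^ 2) ∂p.P := by
          rw [lintegral_const_mul _ hY, lintegral_map hY measurable_obs]
          rfl
  rw [setLIntegral_treated (unconfounded_tilt a) (overlap_tilt hp)
    (F := fun z => ENNReal.ofReal (z.2 ^ 2)) (by fun_prop)] at h1
  refine le_trans ?_ (mul_le_mul_right h1 _)
  rw [← lintegral_const_mul' _ _ ENNReal.ofReal_ne_top]
  refine lintegral_mono fun w => ?_
  rw [← mul_assoc, ← ENNReal.ofReal_mul (inv_nonneg.2 hε0.le)]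
  refine le_mul_of_one_le_left zero_le ?_
  rw [← ENNReal.ofReal_one]
  refine ENNReal.ofReal_le_ofReal ?_
  rw [← inv_mul_cancel₀ hε0.ne']
  exact mul_le_mul_of_nonneg_left (le_clippedPropensity _ hε a _) (inv_nonneg.2 hε0.le)

/-- Reweighting the conditional law of the outcome by a bounded density stays within the model. -/
theorem assumptions_tilt (hp : Assumptions ε C p) (hε0 : 0 < ε) (hε : ε < 1 / 2)
    (hD : Measurable D) (h2 : ∀ o, D o ≤ 2) : Assumptions ε C (p.tilt D) := by
  have hρ : ∃ ρ : unitInterval, 0 < ρ ∧ ρ < 1 :=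
    ⟨⟨1 / 2, by norm_num, by norm_num⟩, by rw [← Subtype.coe_lt_coe]; norm_num,
      by rw [← Subtype.coe_lt_coe]; norm_num⟩
  obtain ⟨ρ, h0, h1⟩ := hρ
  have hf := lintegral_Y_sq_ne_top hp
  refine ⟨unconfounded_tilt, fun a => ⟨ρ, h0, h1, ?_⟩, fun a => ⟨ρ, h0, h1, ?_⟩, ⟨ρ, h0, h1, ?_⟩,
    overlap_tilt hp, ?_, ?_, fun a => ⟨(measurable_Ypot a).aestronglyMeasurable, ?_⟩, ?_⟩
  · exact ((p.tilt D).condIndepFun_label_cond_iff h0 h1 (measurable_X.prodMk (measurable_Spot a))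
      (measurable_Ypot a) _).2
        ⟨_, inferInstance, fun ℓ => hasCondLaw_outcome_ofKernels _ _ _ _ ℓ a⟩
  · exact ((p.tilt D).condIndepFun_label_mix_iff h0 h1 (measurable_T.prodMk measurable_X)
      (measurable_Spot a)).2 ⟨_, inferInstance, fun ℓ => hasCondLaw_surrogate_ofKernels _ _ _ _ ℓ a⟩
  · exact ((p.tilt D).condIndepFun_label_mix_iff h0 h1 measurable_X measurable_T).2
      ⟨_, inferInstance, fun ℓ => hasCondLaw_treatment_ofKernels _ _ _ _ ℓ⟩
  · rw [lawX_tilt, lawXLabelled_tilt]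
    exact hp.absolutelyContinuous
  · have : (p.tilt D).densityRatio = p.densityRatio := by
      funext x; rw [densityRatio, densityRatio, lawX_tilt, lawXLabelled_tilt]
    rw [lawX_tilt, this]
    exact hp.densityRatio_le
  · rw [eLpNorm_two_eq]
    refine ENNReal.rpow_lt_top_of_nonneg (by norm_num)
      (ne_top_of_le_ne_top ?_ (lintegral_outcome_sq_tilt_le hp hε0 hε hD h2 a))
    finiteness
  · have h3 : Integrable (fun o : Obs 𝒳 𝒮 => o.2.2.2) (p.tilt D).Q := by
      have h4 := integrable_Y_Q hp.outcome_integrable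
      refine ⟨Measurable.aestronglyMeasurable (by fun_prop), ?_⟩
      rw [HasFiniteIntegral, Q_tilt p hD, lintegral_withDensity_eq_lintegral_mul _ hD (by fun_prop)]
      refine lt_of_le_of_lt (lintegral_mono fun o => mul_le_mul_left (h2 o) _) ?_
      rw [lintegral_const_mul _ (by fun_prop)]
      exact ENNReal.mul_lt_top (by simp) h4.2
    exact (integrable_map_measure (Measurable.aestronglyMeasurable (by fun_prop))
      measurable_obs.aemeasurable).1 h3

theorem tilt_mem_model (hp : Assumptions ε C p) (hε0 : 0 < ε) (hε : ε < 1 / 2)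
    (hD : Measurable D) (h2 : ∀ o, D o ≤ 2) : p.tilt D ∈ model ε C p :=
  ⟨assumptions_tilt hp hε0 hε hD h2, lawXTS_tilt hp⟩

theorem integral_outcome_sq_tilt_le (hp : Assumptions ε C p) (hε0 : 0 < ε) (hε : ε < 1 / 2)
    (hD : Measurable D) (h2 : ∀ o, D o ≤ 2) (a : Bool) :
    ∫ w, Ypot a w ^ 2 ∂(p.tilt D).P ≤
      (ENNReal.ofReal ε⁻¹ * (2 * ∫⁻ w, ENNReal.ofReal (Y w ^ 2) ∂p.P)).toReal := by
  have h := lintegral_outcome_sq_tilt_le hp hε0 hε hD h2 a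
  rw [lintegral_outcome_sq (assumptions_tilt hp hε0 hε hD h2) a] at h
  have hf := lintegral_Y_sq_ne_top hp
  exact (ENNReal.ofReal_le_iff_le_toReal (by finiteness)).1 h

end Tilt

end Population

end

/-! ### Scores of linear tilts. -/

noncomputable section

/-- With $r=\sqrt{1+u}$ the left side is $(r-1)^2/2$, while $u^2=(r-1)^2(r+1)^2$ and $r+1\ge1$. -/
theorem abs_sqrt_one_add_sub_le {u : ℝ} (hu : |u| ≤ 1) : |√(1 + u) - 1 - u / 2| ≤ u ^ 2 / 2 := by
  have h1 : 0 ≤ 1 + u := by linarith [(abs_le.1 hu).1]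
  have h2 := Real.sqrt_nonneg (1 + u)
  have h3 := Real.sq_sqrt h1
  set r := √(1 + u)
  have h4 : u = r ^ 2 - 1 := by linarith
  have h5 : r - 1 - u / 2 = -((r - 1) ^ 2 / 2) := by rw [h4]; ring
  have h6 : u ^ 2 = (r - 1) ^ 2 * (r + 1) ^ 2 := by rw [h4]; ring
  rw [h5, abs_neg, abs_of_nonneg (by positivity), h6]
  have : 1 ≤ (r + 1) ^ 2 := by nlinarith
  nlinarith [sq_nonneg (r - 1)]

/-- The linear perturbation of a law by a bounded function has that function as its score. -/
theorem hasScore_of_withDensity {O : Type*} [MeasurableSpace O] {Q : Measure O}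
    [IsProbabilityMeasure Q] {g f : O → ℝ} (hf : Measurable f) (hgf : g =ᵐ[Q] f) {M : ℝ}
    (hM0 : 0 < M) (hM : ∀ o, |f o| ≤ M) {c : ℝ → ℝ} (hc : ∀ θ, |θ| ≤ M⁻¹ → c θ = θ)
    {Qθ : ℝ → Measure O}
    (hQ : ∀ θ, Qθ θ = Q.withDensity fun o => ENNReal.ofReal (1 + c θ * f o)) :
    HasScore Qθ g := by
  refine ⟨Q, inferInstance, fun θ => hQ θ ▸ withDensity_absolutelyContinuous _ _, ?_⟩
  have hd : ∀ θ, (Qθ θ).rnDeriv Q =ᵐ[Q] fun o => ENNReal.ofReal (1 + c θ * f o) := fun θ => by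
    rw [hQ]
    exact Measure.rnDeriv_withDensity _ (by fun_prop)
  have hlim : Tendsto (fun θ : ℝ => ENNReal.ofReal ((|θ| * M ^ 2 / 2) ^ 2)) (𝓝[≠] 0) (𝓝 0) := by
    have : Tendsto (fun θ : ℝ => ENNReal.ofReal ((|θ| * M ^ 2 / 2) ^ 2)) (𝓝 0)
        (𝓝 (ENNReal.ofReal ((|(0 : ℝ)| * M ^ 2 / 2) ^ 2))) :=
      Continuous.tendsto (ENNReal.continuous_ofReal.comp (by fun_prop)) 0
    simp only [abs_zero, zero_mul, zero_div, ne_eq, OfNat.ofNat_ne_zero, not_false_eq_true,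
      zero_pow, ENNReal.ofReal_zero] at this
    exact this.mono_left nhdsWithin_le_nhds
  refine tendsto_of_tendsto_of_tendsto_of_le_of_le' tendsto_const_nhds hlim
    (Eventually.of_forall fun _ => zero_le) ?_
  have hev : ∀ᶠ θ : ℝ in 𝓝[≠] 0, |θ| ≤ M⁻¹ := by
    have h1 : ∀ᶠ θ : ℝ in 𝓝 0, |θ| < M⁻¹ :=
      (continuous_abs.tendsto (0 : ℝ)).eventually_lt_const (by simpa using hM0)
    filter_upwards [nhdsWithin_le_nhds h1] with θ h using h.le
  filter_upwards [hev, self_mem_nhdsWithin] with θ hθ hθ0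
  have hθ0' : θ ≠ 0 := hθ0
  refine (lintegral_mono_ae (g := fun _ => ENNReal.ofReal ((|θ| * M ^ 2 / 2) ^ 2)) ?_).trans
    (by simp)
  filter_upwards [hd θ, hd 0, hgf] with o h1 h2 h3
  rw [h1, h2, h3, hc θ hθ, hc 0 (by simpa using hM0.le), zero_mul, add_zero, ENNReal.ofReal_one]
  have hu : |θ * f o| ≤ 1 := by
    rw [abs_mul, ← inv_mul_cancel₀ hM0.ne']
    exact mul_le_mul hθ (hM o) (abs_nonneg _) (inv_nonneg.2 hM0.le)
  rw [ENNReal.toReal_ofReal (by linarith [(abs_le.1 hu).1]), ENNReal.toReal_one, Real.sqrt_one,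
    mul_one]
  refine ENNReal.ofReal_le_ofReal (sq_le_sq' ?_ ?_) <;>
  · have h4 := abs_sqrt_one_add_sub_le hu
    have h5 : (√(1 + θ * f o) - 1) / θ - f o / 2 = (√(1 + θ * f o) - 1 - θ * f o / 2) / θ := by
      field_simp
    have h6 : |(√(1 + θ * f o) - 1) / θ - f o / 2| ≤ |θ| * M ^ 2 / 2 := by
      rw [h5, abs_div, div_le_iff₀ (abs_pos.2 hθ0')]
      refine h4.trans ?_
      have h7 : f o ^ 2 ≤ M ^ 2 := sq_le_sq' (abs_le.1 (hM o)).1 (abs_le.1 (hM o)).2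
      have h8 : |θ| * |θ| = θ ^ 2 := abs_mul_abs_self θ |>.trans (sq θ).symm
      calc (θ * f o) ^ 2 / 2 = θ ^ 2 * f o ^ 2 / 2 := by ring
        _ ≤ θ ^ 2 * M ^ 2 / 2 := by gcongr
        _ = |θ| * M ^ 2 / 2 * |θ| := by rw [← h8]; ring
    have := abs_le.1 h6
    linarith [this.1, this.2]

namespace Population

variable {𝒳 𝒮 : Type*} [MeasurableSpace 𝒳] [MeasurableSpace 𝒮]
  [StandardBorelSpace 𝒳] [StandardBorelSpace 𝒮] {ε : ℝ} {C : ℝ≥0}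

/-- Every bounded function with conditional mean zero given `(X, T, S)` is a score. -/
theorem exists_isSmoothSubmodel {p : Population 𝒳 𝒮} (hp : Assumptions ε C p)
    (hε0 : 0 < ε) (hε : ε < 1 / 2) {f : Obs 𝒳 𝒮 → ℝ} (hf : Measurable f) {M : ℝ} (hM0 : 0 < M)
    (hM : ∀ o, |f o| ≤ M)
    (h0 : ∀ z : 𝒳 × Bool × 𝒮, ∫ y, f (z.1, z.2.1, z.2.2, y) ∂p.outcomeKernel z = 0)
    (hL : MemLp f 2 p.Q) :
    ∃ γ, IsSmoothSubmodel (model ε C p) p γ (hL.toLp f) := by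
  have := p.nonempty_surrogate
  -- A submodel is indexed by all real `θ`; clamping keeps $1+c(\theta)f$ between $0$ and $2$ and
  -- changes nothing near $0$.
  let c : ℝ → ℝ := fun θ => max (-M⁻¹) (min θ M⁻¹)
  have hMi : 0 < M⁻¹ := inv_pos.2 hM0
  have hc : ∀ θ, |c θ| ≤ M⁻¹ := fun θ =>
    abs_le.2 ⟨le_max_left _ _, max_le (by linarith) (min_le_right _ _)⟩
  have hc' : ∀ θ, |θ| ≤ M⁻¹ → c θ = θ := fun θ h => by
    simp only [c]
    rw [min_eq_left (abs_le.1 h).2, max_eq_right (abs_le.1 h).1]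
  have hcf : ∀ θ o, |c θ * f o| ≤ 1 := fun θ o => by
    rw [abs_mul, ← inv_mul_cancel₀ hM0.ne']
    exact mul_le_mul (hc θ) (hM o) (abs_nonneg _) hMi.le
  let D : ℝ → Obs 𝒳 𝒮 → ℝ≥0∞ := fun θ o => ENNReal.ofReal (1 + c θ * f o)
  have hD : ∀ θ, Measurable (D θ) := fun θ => by fun_prop
  have hD2 : ∀ θ o, D θ o ≤ 2 := fun θ o => by
    refine ENNReal.ofReal_le_of_le_toReal ?_
    have := (abs_le.1 (hcf θ o)).2
    norm_num
    linarith
  have hm : ∀ θ, IsMarkovKernel (p.tiltedKernel (D θ)) := fun θ => by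
    refine p.isMarkovKernel_tiltedKernel (hD θ) fun z => ?_
    have hi : Integrable (fun y => f (z.1, z.2.1, z.2.2, y)) (p.outcomeKernel z) :=
      Integrable.of_bound (C := M) (Measurable.aestronglyMeasurable (by fun_prop))
        (ae_of_all _ fun y => hM _)
    have hi1 : Integrable (fun y => 1 + c θ * f (z.1, z.2.1, z.2.2, y)) (p.outcomeKernel z) :=
      (integrable_const 1).add (hi.const_mul (c θ))
    have hpos : ∀ y, 0 ≤ 1 + c θ * f (z.1, z.2.1, z.2.2, y) := fun y => by
      linarith [(abs_le.1 (hcf θ (z.1, z.2.1, z.2.2, y))).1]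
    refine (ofReal_integral_eq_lintegral_ofReal hi1 (ae_of_all _ hpos)).symm.trans ?_
    rw [integral_add (integrable_const 1) (hi.const_mul (c θ)), integral_const_mul, h0]
    simp
  have hQ : ∀ θ, (p.tilt (D θ)).Q = p.Q.withDensity (D θ) := fun θ => Q_tilt p (hD θ)
  refine ⟨fun θ => p.tilt (D θ), fun θ => tilt_mem_model hp hε0 hε (hD θ) (hD2 θ), ?_,
    hasScore_of_withDensity hf hL.coeFn_toLp hM0 hM hc' hQ,
    _, fun θ a => integral_outcome_sq_tilt_le hp hε0 hε (hD θ) (hD2 θ) a⟩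
  have : D 0 = 1 := by
    funext o
    simp [D, hc' 0 (by simpa using hMi.le)]
  rw [hQ, this, withDensity_one]

end Population

end

/-! ### Approximation by scores and the efficiency bound. -/

noncomputable section

namespace Population

variable {𝒳 𝒮 : Type*} [MeasurableSpace 𝒳] [MeasurableSpace 𝒮]

theorem measurable_integral_outcomeKernel (p : Population 𝒳 𝒮) {f : Obs 𝒳 𝒮 → ℝ}
    (hf : Measurable f) : Measurable fun o : Obs 𝒳 𝒮 =>
      ∫ y, f (o.1, o.2.1, o.2.2.1, y) ∂p.outcomeKernel (o.1, o.2.1, o.2.2.1) := by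
  have h : StronglyMeasurable fun z : 𝒳 × Bool × 𝒮 =>
      ∫ y, f (z.1, z.2.1, z.2.2, y) ∂p.outcomeKernel z :=
    StronglyMeasurable.integral_kernel_prod_right (κ := p.outcomeKernel)
      (f := fun z y => f (z.1, z.2.1, z.2.2, y))
      (Measurable.stronglyMeasurable (by unfold Function.uncurry; fun_prop))
  exact h.measurable.comp (f := fun o : Obs 𝒳 𝒮 => (o.1, o.2.1, o.2.2.1)) (by fun_prop)

/-- Taking the conditional mean given `(X, T, S)` is a contraction in `L²(Q)`. -/
theorem eLpNorm_integral_outcomeKernel_le (p : Population 𝒳 𝒮) {f : Obs 𝒳 𝒮 → ℝ}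
    (hf : Measurable f) : eLpNorm (fun o : Obs 𝒳 𝒮 =>
      ∫ y, f (o.1, o.2.1, o.2.2.1, y) ∂p.outcomeKernel (o.1, o.2.1, o.2.2.1)) 2 p.Q ≤
      eLpNorm f 2 p.Q := by
  rw [eLpNorm_two_eq, eLpNorm_two_eq, p.lintegral_Q_outcomeKernel (hf.pow_const 2).ennreal_ofReal]
  refine ENNReal.rpow_le_rpow (lintegral_mono fun o => ?_) (by norm_num)
  exact ofReal_integral_sq_le _ (by fun_prop)

theorem ae_integrable_outcomeKernel {p : Population 𝒳 𝒮} {f : Obs 𝒳 𝒮 → ℝ}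
    (hf : Measurable f) (hi : Integrable f p.Q) : ∀ᵐ o ∂p.Q,
      Integrable (fun y => f (o.1, o.2.1, o.2.2.1, y)) (p.outcomeKernel (o.1, o.2.1, o.2.2.1)) := by
  have h := hi.2
  rw [HasFiniteIntegral, p.lintegral_Q_outcomeKernel hf.enorm] at h
  have hm : Measurable fun z : 𝒳 × Bool × 𝒮 =>
      ∫⁻ y, ‖f (z.1, z.2.1, z.2.2, y)‖ₑ ∂p.outcomeKernel z :=
    measurable_chainIntegral_outcome p.outcomeKernel hf.enorm
  filter_upwards [ae_lt_top
    (hm.comp (f := fun o : Obs 𝒳 𝒮 => (o.1, o.2.1, o.2.2.1)) (by fun_prop)) h.ne] with o ho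
  exact ⟨Measurable.aestronglyMeasurable (by fun_prop), ho⟩

/-- The weighted residual has conditional mean zero given `(X, T, S)`. -/
theorem ae_integral_weighted_residual {p : Population 𝒳 𝒮} (h : Integrable Y (p.given true))
    (ε : ℝ) (C : ℝ≥0) : ∀ᵐ o ∂p.Q,
      Integrable (fun y => p.clippedRatio C o.1 * p.residual ε (o.1, o.2.1, o.2.2.1, y))
          (p.outcomeKernel (o.1, o.2.1, o.2.2.1)) ∧
        ∫ y, p.clippedRatio C o.1 * p.residual ε (o.1, o.2.1, o.2.2.1, y)
          ∂p.outcomeKernel (o.1, o.2.1, o.2.2.1) = 0 := by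
  filter_upwards [ae_integrable_outcomeKernel (by fun_prop) (integrable_Y_Q h)] with o ho
  have h1 : Integrable (fun y => y - p.regression o.2.1 o.1 o.2.2.1)
      (p.outcomeKernel (o.1, o.2.1, o.2.2.1)) := ho.sub (integrable_const _)
  simp only [residual]
  refine ⟨(h1.const_mul _).const_mul _, ?_⟩
  rw [integral_const_mul, integral_const_mul, integral_sub ho (integrable_const _), integral_const]
  simp [regression, outcomeKernel]

variable [StandardBorelSpace 𝒳] [StandardBorelSpace 𝒮] {ε : ℝ} {C : ℝ≥0}

/-- The function `ψ̃` is a limit of scores of smooth submodels. -/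
theorem exists_tendsto_score {p : Population 𝒳 𝒮} (hp : Assumptions ε C p)
    (hε0 : 0 < ε) (hε : ε < 1 / 2) :
    ∃ g : ℕ → Lp ℝ 2 p.Q, (∀ n, ∃ γ, IsSmoothSubmodel (model ε C p) p γ (g n)) ∧
      Tendsto g atTop (𝓝 ((memLp_psi hp hε0 hε).toLp p.psi)) := by
  set φ : Obs 𝒳 𝒮 → ℝ := fun o => p.clippedRatio C o.1 * p.residual ε o with hφ
  have hψφ : p.psi =ᵐ[p.Q] φ := psi_ae_eq hp
  have hφm : Measurable φ :=
    ((p.measurable_clippedRatio C).comp measurable_fst).mul (p.measurable_residual ε)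
  have hφL : MemLp φ 2 p.Q := (memLp_congr_ae hψφ).1 (memLp_psi hp hε0 hε)
  let t : ℕ → Obs 𝒳 𝒮 → ℝ := fun n => {o | (n : ℝ) < |φ o|}.indicator φ
  let h : ℕ → Obs 𝒳 𝒮 → ℝ := fun n => {o | (n : ℝ) < |φ o|}ᶜ.indicator φ
  have hs : ∀ n : ℕ, MeasurableSet {o | (n : ℝ) < |φ o|} := fun n =>
    measurableSet_lt measurable_const hφm.abs
  have htm : ∀ n, Measurable (t n) := fun n => hφm.indicator (hs n)
  have hhm : ∀ n, Measurable (h n) := fun n => hφm.indicator (hs n).compl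
  have hth : ∀ n o, t n o + h n o = φ o := fun n o =>
    congrFun (Set.indicator_self_add_compl {o | (n : ℝ) < |φ o|} φ) o
  have hhb : ∀ n o, |h n o| ≤ n := fun n o => by
    by_cases ho : (n : ℝ) < |φ o|
    · have : o ∉ {o | (n : ℝ) < |φ o|}ᶜ := fun h' => h' ho
      simp [h, Set.indicator_of_notMem this]
    · have : o ∈ {o | (n : ℝ) < |φ o|}ᶜ := ho
      simp only [h, Set.indicator_of_mem this]
      exact not_lt.1 ho
  let E : (Obs 𝒳 𝒮 → ℝ) → Obs 𝒳 𝒮 → ℝ := fun f o =>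
    ∫ y, f (o.1, o.2.1, o.2.2.1, y) ∂p.outcomeKernel (o.1, o.2.1, o.2.2.1)
  have hEb : ∀ n o, |E (h n) o| ≤ n := fun n o => by
    have := norm_integral_le_of_norm_le_const (μ := p.outcomeKernel (o.1, o.2.1, o.2.2.1))
      (f := fun y => h n (o.1, o.2.1, o.2.2.1, y)) (C := n) (ae_of_all _ fun y => hhb n _)
    simpa using this
  -- Truncation destroys the conditional centring, and subtracting the conditional mean restores it
  -- at every point. The bound $2n+1$, rather than $2n$, is positive also for $n=0$.
  let f : ℕ → Obs 𝒳 𝒮 → ℝ := fun n o => h n o - E (h n) o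
  have hEm : ∀ n, Measurable (E (h n)) := fun n => p.measurable_integral_outcomeKernel (hhm n)
  have hfm : ∀ n, Measurable (f n) := fun n => (hhm n).sub (hEm n)
  have hfb : ∀ n o, |f n o| ≤ 2 * n + 1 := fun n o => by
    refine (abs_sub _ _).trans ?_
    linarith [hhb n o, hEb n o]
  have hfL : ∀ n, MemLp (f n) 2 p.Q := fun n =>
    MemLp.of_bound (hfm n).aestronglyMeasurable (2 * n + 1) (ae_of_all _ (hfb n))
  have hf0 : ∀ n, ∀ z : 𝒳 × Bool × 𝒮, ∫ y, f n (z.1, z.2.1, z.2.2, y) ∂p.outcomeKernel z = 0 :=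
    fun n z => by
      have hi : Integrable (fun y => h n (z.1, z.2.1, z.2.2, y)) (p.outcomeKernel z) :=
        Integrable.of_bound (C := n)
          (Measurable.aestronglyMeasurable ((hhm n).comp (by fun_prop)))
          (ae_of_all _ fun y => hhb n _)
      simp only [f, E]
      rw [integral_sub hi (integrable_const _), integral_const]
      simp
  refine ⟨fun n => (hfL n).toLp (f n), fun n => exists_isSmoothSubmodel hp hε0 hε (hfm n)
    (M := 2 * n + 1) (by positivity) (hfb n) (hf0 n) (hfL n), ?_⟩
  rw [Lp.tendsto_Lp_iff_tendsto_eLpNorm'']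
  have hlim := tendsto_eLpNorm_two_tail hφm hφm hφL.2.ne
  have hlim2 : Tendsto (fun n => eLpNorm (t n) 2 p.Q + eLpNorm (t n) 2 p.Q) atTop (𝓝 0) := by
    simpa using hlim.add hlim
  refine tendsto_of_tendsto_of_tendsto_of_le_of_le tendsto_const_nhds hlim2
    (fun _ => zero_le) fun n => ?_
  -- Since $\tilde\psi$ has conditional mean zero, the error is the recentred tail, and conditional
  -- means contract in $L^2$.
  have hae : f n - p.psi =ᵐ[p.Q] -(t n - E (t n)) := by
    filter_upwards [hψφ, ae_integral_weighted_residual hp.outcome_integrable ε C] with o h1 h2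
    have hi : Integrable (fun y => h n (o.1, o.2.1, o.2.2.1, y))
        (p.outcomeKernel (o.1, o.2.1, o.2.2.1)) :=
      Integrable.of_bound (C := n)
        (Measurable.aestronglyMeasurable ((hhm n).comp (by fun_prop)))
        (ae_of_all _ fun y => hhb n _)
    have h3 : E (t n) o = -E (h n) o := by
      have h4 : ∀ y, t n (o.1, o.2.1, o.2.2.1, y) =
          φ (o.1, o.2.1, o.2.2.1, y) - h n (o.1, o.2.1, o.2.2.1, y) := fun y => by
        rw [← hth n]; ring
      simp only [E, h4]
      rw [integral_sub h2.1 hi, h2.2, zero_sub]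
    simp only [Pi.sub_apply, Pi.neg_apply, f, h1, h3]
    rw [← hth n o]
    ring
  rw [eLpNorm_congr_ae hae, eLpNorm_neg]
  refine (eLpNorm_sub_le (htm n).aestronglyMeasurable
    (p.measurable_integral_outcomeKernel (htm n)).aestronglyMeasurable (by norm_num)).trans ?_
  exact add_le_add le_rfl (p.eLpNorm_integral_outcomeKernel_le (htm n))

theorem isEfficientInfluenceFunction_psi {p : Population 𝒳 𝒮} (hp : Assumptions ε C p)
    (hε0 : 0 < ε) (hε : ε < 1 / 2) :
    IsEfficientInfluenceFunction (model ε C p) p p.psi := by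
  refine ⟨⟨memLp_psi hp hε0 hε, ?_⟩, fun γ g hγ => hasDerivAt_ate hp hε0 hε hγ⟩
  obtain ⟨g, hg, hlim⟩ := exists_tendsto_score hp hε0 hε
  exact mem_closure_of_tendsto hlim (Eventually.of_forall fun n => Submodule.subset_span (hg n))

/-- Each Cramér-Rao bound is $\langle\tilde\psi,g\rangle^2/\|g\|^2\le\|\tilde\psi\|^2$. Equality
need not be attained, since $\tilde\psi$ may be unbounded and is only shown to be a limit of scores;
continuity of the quotient at $\tilde\psi\ne0$ gives the supremum. -/
theorem efficiencyBound_eq {p : Population 𝒳 𝒮} (hp : Assumptions ε C p)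
    (hε0 : 0 < ε) (hε : ε < 1 / 2) :
    efficiencyBound (model ε C p) p = ENNReal.ofReal (∫ o, p.psi o ^ 2 ∂p.Q) := by
  set Ψ : Lp ℝ 2 p.Q := (memLp_psi hp hε0 hε).toLp p.psi with hΨ
  have hΨc : Ψ =ᵐ[p.Q] p.psi := MemLp.coeFn_toLp _
  have hin : ∀ g : Lp ℝ 2 p.Q, ∫ o, p.psi o * g o ∂p.Q = inner ℝ Ψ g := fun g => by
    rw [L2.inner_def]
    refine integral_congr_ae ?_
    filter_upwards [hΨc] with o ho
    rw [ho]
    simp [mul_comm]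
  have hsq : ∀ g : Lp ℝ 2 p.Q, ∫ o, g o ^ 2 ∂p.Q = ‖g‖ ^ 2 := fun g => by
    rw [← real_inner_self_eq_norm_sq, L2.inner_def]
    refine integral_congr_ae (ae_of_all _ fun o => ?_)
    simp [sq]
  have hV : ∫ o, p.psi o ^ 2 ∂p.Q = ‖Ψ‖ ^ 2 := by
    rw [← hsq]
    refine integral_congr_ae ?_
    filter_upwards [hΨc] with o ho
    rw [ho]
  rw [hV]
  refine le_antisymm ?_ ?_
  · refine iSup_le fun γ => iSup_le fun g => iSup_le fun hγ => iSup_le fun d => iSup_le fun hd => ?_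
    refine ENNReal.div_le_of_le_mul ?_
    rw [hd.unique (hasDerivAt_ate hp hε0 hε hγ), hin, hsq,
      ← ENNReal.ofReal_mul (sq_nonneg _), ← mul_pow]
    refine ENNReal.ofReal_le_ofReal (sq_le_sq' ?_ ?_)
    · exact neg_le_of_abs_le (abs_real_inner_le_norm _ _)
    · exact real_inner_le_norm _ _
  · by_cases h0 : Ψ = 0
    · simp [h0]
    obtain ⟨g, hg, hlim⟩ := exists_tendsto_score hp hε0 hε
    have hpos : 0 < ‖Ψ‖ ^ 2 := by
      have := norm_pos_iff.2 h0
      positivity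
    have h1 : Tendsto (fun n => ENNReal.ofReal (inner ℝ Ψ (g n) ^ 2) /
        ENNReal.ofReal (‖g n‖ ^ 2)) atTop
        (𝓝 (ENNReal.ofReal (inner ℝ Ψ Ψ ^ 2) / ENNReal.ofReal (‖Ψ‖ ^ 2))) :=
      ENNReal.Tendsto.div
        (ENNReal.tendsto_ofReal ((tendsto_const_nhds.inner hlim).pow 2))
        (Or.inr (ENNReal.ofReal_pos.2 hpos).ne')
        (ENNReal.tendsto_ofReal (hlim.norm.pow 2)) (Or.inl ENNReal.ofReal_ne_top)
    have h2 : ENNReal.ofReal (inner ℝ Ψ Ψ ^ 2) / ENNReal.ofReal (‖Ψ‖ ^ 2) =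
        ENNReal.ofReal (‖Ψ‖ ^ 2) := by
      rw [← ENNReal.ofReal_div_of_pos hpos, real_inner_self_eq_norm_sq]
      congr 1
      field_simp
    rw [h2] at h1
    refine le_of_tendsto h1 (Eventually.of_forall fun n => ?_)
    obtain ⟨γ, hγ⟩ := hg n
    rw [← hin, ← hsq]
    exact le_iSup_of_le γ (le_iSup_of_le (g n) (le_iSup_of_le hγ
      (le_iSup_of_le _ (le_iSup_of_le (hasDerivAt_ate hp hε0 hε hγ) le_rfl))))

end Population

end

end SurrogateATE

theorem theorem6 {𝒳 𝒮 : Type*} [MeasurableSpace 𝒳] [MeasurableSpace 𝒮]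
    [StandardBorelSpace 𝒳] [StandardBorelSpace 𝒮]
    (ε : ℝ) (hε : 0 < ε) (hε' : ε < 1 / 2) (C : ℝ≥0) (hC : 0 < C)
    (p : SurrogateATE.Population 𝒳 𝒮) (hp : SurrogateATE.Assumptions ε C p) :
    SurrogateATE.IsEfficientInfluenceFunction (SurrogateATE.model ε C p) p p.psi ∧
      SurrogateATE.efficiencyBound (SurrogateATE.model ε C p) p =
        ENNReal.ofReal (∫ o, p.psi o ^ 2 ∂p.Q) :=
  ⟨SurrogateATE.Population.isEfficientInfluenceFunction_psi hp hε hε',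
    SurrogateATE.Population.efficiencyBound_eq hp hε hε'⟩
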